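/- **Setting.** Let $P^n=(\mathbb P^1_{\mathbb C})^n$ with coordinates $z_1,\dots,z_n$, regarded as a compact semi-algebraic set. For $1\le i\le n$ and $\alpha\in\{0,\infty\}$ put $H_{i,\alpha}=\{z_i=\alpha\}$, and let $\mathbf D^n=\bigcup_i\{z_i=1\}$. A cubical face is an intersection of several $H_{i,\alpha}$. A *good triangulation* of $P^n$ is a finite simplicial complex $K$ with a semi-algebraic homeomorphism $\Phi_K:|K|\to P^n$ (used to identify $|K|$ with $P^n$) such that $\mathbf D^n$ and all the sets $\{|z_i|\le 1\}$ are subcomplexes, every union of cubical faces is a full subcomplex, and the image of each open simplex is a regular submanifold. A good triangulation $K'$ is a *subdivision* of $K$ if each simplex of $K'$ is contained in a simplex of $K$ and each simplex of $K$ is a union of simplices of $K'$. A semi-algebraic set $S\subset P^n$ is *admissible* if $\dim(S\cap(H-\mathbf D^n))\le\dim S-2\operatorname{codim}H$ for every cubical face $H$ (with $\dim\emptyset=-\infty$). A relative simplicial chain $\gamma\in C_k(K,\mathbf D^n;\mathbb Q)$ is admissible if the support of a representative is admissible, and $AC_k(K,\mathbf D^n;\mathbb Q)$ is the space of those $\gamma$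 for which $\gamma$ and $\delta\gamma$ are admissible. If $K'$ is a subdivision of $K$, the *subdivision operator* $\lambda:C_\bullet(K,\mathbf D^n;\mathbb Q)\to C_\bullet(K',\mathbf D^n;\mathbb Q)$ is induced by the augmentation preserving chain map $C_\bullet(K;\mathbb Q)\to C_\bullet(K';\mathbb Q)$ that carries each simplex $\sigma$ to a chain supported in $\sigma$ (there is exactly one such chain map). It maps $AC_\bullet$ to $AC_\bullet$, and $AC_\bullet(P^n,\mathbf D^n;\mathbb Q)=\varinjlim_K AC_\bullet(K,\mathbf D^n;\mathbb Q)$, the limit being taken over the good triangulations $K$. Fix $n\ge1$, $i$ and $\alpha$. Let $\zeta=z_i$ if $\alpha=0$ and $\zeta=1/z_i$ if $\alpha=\infty$, and let $\Delta=\{|\zeta|<1\}\subset P^n$. For a good triangulation $K$ let $W$ be the union of the simplices of $K$ that do not meet $H_{i,\alpha}$; then $L=K\cap H_{i,\alpha}$ is a good triangulation of $H_{i,\alpha}=P^{n-1}$. A *Thom cocycle* of $H_{i,\alpha}$ is a simplicial cocycle $T\in C^2(K,W;\mathbb Q)$ whose class corresponds, under the isomorphisms $$H^2(K,W;\mathbb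 Q)\xleftarrow{\ \simeq\ }H^2_{\rm sing}(P^n,P^n-H_{i,\alpha};\mathbb Q)\xrightarrow{\ \simeq\ }H^2_{\rm sing}(\Delta,\Delta-H_{i,\alpha};\mathbb Q),$$ to the image of the (rational) de Rham class $\big[\frac{1}{2\pi i}\frac{d\zeta}{\zeta}\big]\in H^1_{\rm sing}(\Delta-H_{i,\alpha};\mathbb Q)$ under the connecting homomorphism. A *good ordering* $\mathcal O$ of $K$ with respect to $H_{i,\alpha}$ is a partial ordering of the vertices that is total on the vertices of each simplex and such that $v\in H_{i,\alpha}$ and $w\ge v$ imply $w\in H_{i,\alpha}$. The cap product is defined by $T\overset{\mathcal O}\cap[v_0,\dots,v_k]=T([v_0,v_1,v_2])\,[v_2,\dots,v_k]$ for $v_0<\dots<v_k$; it induces $T\overset{\mathcal O}\cap:C_k(K,\mathbf D^n;\mathbb Q)\to C_{k-2}(L,\mathbf D^{n-1};\mathbb Q)$. **Proposition.** Let $k\ge2$ (for $k<2$ the target groups are zero). 1. For every good triangulation $K$ of $P^n$, every Thom cocycle $T$ of $H_{i,\alpha}$, every good ordering $\mathcal O$ and every $\gamma\in AC_k(K,\mathbf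 D^n;\mathbb Q)$, the chain $T\overset{\mathcal O}\cap\gamma$ is in $AC_{k-2}(L,\mathbf D^{n-1};\mathbb Q)$. 2. For $\gamma\in AC_k(K,\mathbf D^n;\mathbb Q)$ the chain $T\overset{\mathcal O}\cap\gamma$ does not depend on the Thom cocycle $T$ and the good ordering $\mathcal O$. 3. Let $K'$ be a good triangulation that is a subdivision of $K$, $T'$ a Thom cocycle and $\mathcal O'$ a good ordering for $K'$, and $L'=K'\cap H_{i,\alpha}$. Then the subdivision operator $C_\bullet(K;\mathbb Q)\to C_\bullet(K';\mathbb Q)$ exists, and $$\lambda\big(T\overset{\mathcal O}\cap\gamma\big)=T'\overset{\mathcal O'}\cap\lambda(\gamma)\quad\text{in } C_{k-2}(L',\mathbf D^{n-1};\mathbb Q)$$ for all $\gamma\in AC_k(K,\mathbf D^n;\mathbb Q)$. 4. Consequently there is exactly one family of linear maps $\partial_{i,\alpha}:AC_k(P^n,\mathbf D^n;\mathbb Q)\to AC_{k-2}(P^{n-1},\mathbf D^{n-1};\mathbb Q)$, $k\ge 2$, that commutes with the differentials $\delta$ and maps the class of $\gamma\in AC_k(K,\mathbf D^n;\mathbb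 Q)$ to the class of $T\overset{\mathcal O}\cap\gamma\in AC_{k-2}(L,\mathbf D^{n-1};\mathbb Q)$ for all $K$, $T$, $\mathcal O$ and $\gamma$ as in 1. -/

import Mathlib

open Set Topology
open scoped ContDiff

noncomputable section

namespace CubicalChain

/-! ### Semi-algebraic sets and regular submanifolds -/

/-- The semi-algebraic subsets of `ℝ^σ`: the smallest class of subsets that contains all sets
`{f > 0}` (`f` a polynomial) and is closed under finite unions, finite intersections and
complements. -/
inductive IsSemialgebraic {σ : Type} : Set (σ → ℝ) → Prop
  | pos (f : MvPolynomial σ ℝ) : IsSemialgebraic {x | 0 < MvPolynomial.eval x f}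
  | union {A B : Set (σ → ℝ)} :
      IsSemialgebraic A → IsSemialgebraic B → IsSemialgebraic (A ∪ B)
  | inter {A B : Set (σ → ℝ)} :
      IsSemialgebraic A → IsSemialgebraic B → IsSemialgebraic (A ∩ B)
  | compl {A : Set (σ → ℝ)} : IsSemialgebraic A → IsSemialgebraic Aᶜ

/-- `S` is a regular (embedded) `C^∞` submanifold of dimension `d`: near each of its points it is
the image of an immersion of an open subset of `ℝ^d` that is a homeomorphism onto its image. -/
def IsRegularSubmanifold {E : Type} [NormedAddCommGroup E] [NormedSpace ℝ E]
    (d : ℕ) (S : Set E) : Prop :=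
  ∀ p ∈ S, ∃ (U : Set E) (V : Set (Fin d → ℝ)) (φ : (Fin d → ℝ) → E),
    IsOpen U ∧ p ∈ U ∧ IsOpen V ∧ ContDiffOn ℝ ∞ φ V ∧
      (∀ x ∈ V, Function.Injective (fderiv ℝ φ x)) ∧ φ '' V = S ∩ U ∧ IsEmbedding (V.domRestrict φ)

/-- The dimension of a semi-algebraic set `S`: the largest `d` such that `S` contains a non-empty
`d`-dimensional regular submanifold. The empty set has dimension `⊥ = -∞`. -/
def semialgDim {σ : Type} [Fintype σ] (S : Set (σ → ℝ)) : WithBot ℕ∞ :=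
  ⨆ (d : ℕ) (_ : ∃ M ⊆ S, M.Nonempty ∧ IsRegularSubmanifold d M), (d : WithBot ℕ∞)

/-! ### The space `P^n = (ℙ¹_ℂ)^n` and its cubical faces -/

/-- `P^n = (ℙ¹_ℂ)^n`, where `ℙ¹_ℂ = ℂ ∪ {∞}`. -/
abbrev PP (n : ℕ) : Type := Fin n → OnePoint ℂ

/-- The real algebraic embedding of `ℙ¹_ℂ` in `ℝ³` as the unit sphere (stereographic projection):
`z ↦ (2 Re z, 2 Im z, |z|² - 1) / (|z|² + 1)`, `∞ ↦ (0, 0, 1)`. -/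
def sphere (x : OnePoint ℂ) : Fin 3 → ℝ :=
  x.elim ![0, 0, 1] fun z =>
    ![2 * z.re / (‖z‖ ^ 2 + 1), 2 * z.im / (‖z‖ ^ 2 + 1), (‖z‖ ^ 2 - 1) / (‖z‖ ^ 2 + 1)]

/-- `P^n` as a compact real algebraic subset of `ℝ^{3n}`. -/
def embed {n : ℕ} (p : PP n) : Fin n × Fin 3 → ℝ := fun a => sphere (p a.1) a.2

/-- The two points `0` and `∞` of `ℙ¹_ℂ`. -/
inductive Pole : Type
  | zero : Pole
  | infty : Pole

/-- The point of `ℙ¹_ℂ` denoted by a pole. -/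
def Pole.pt : Pole → OnePoint ℂ
  | .zero => ((0 : ℂ) : OnePoint ℂ)
  | .infty => OnePoint.infty

/-- The divisor `H_{i,α} = {z_i = α}` of `P^n`. -/
def divH {n : ℕ} (i : Fin n) (α : Pole) : Set (PP n) := {p | p i = α.pt}

/-- The divisor `D^n = ⋃_i {z_i = 1}` of `P^n`. -/
def divD (n : ℕ) : Set (PP n) := {p | ∃ i, p i = ((1 : ℂ) : OnePoint ℂ)}

/-- The cubical face `H_J`: the intersection of the `H_{i,α}` with `J i = α`. (The intersections
containing both `H_{i,0}` and `H_{i,∞}` are empty.) -/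
def cubicalFace {n : ℕ} (J : Fin n → Option Pole) : Set (PP n) :=
  {p | ∀ i, ∀ α ∈ J i, p i = α.pt}

/-- The codimension of the cubical face `H_J`. -/
def codim {n : ℕ} (J : Fin n → Option Pole) : ℕ :=
  (Finset.univ.filter fun i => (J i).isSome = true).card

/-- A subset `S` of `P^n` is admissible if `dim (S ∩ (H - D^n)) ≤ dim S - 2 codim H` for every
cubical face `H`. -/
def IsAdmissible {n : ℕ} (S : Set (PP n)) : Prop :=
  ∀ J : Fin n → Option Pole,
    semialgDim (embed '' (S ∩ (cubicalFace J \ divD n))) + ((2 * codim J : ℕ) : WithBot ℕ∞) ≤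
      semialgDim (embed '' S)

/-! ### Semi-algebraic triangulations -/

/-- The relative interior of a simplex: the complement of the union of its proper faces. -/
def relInterior {E : Type} [AddCommGroup E] [Module ℝ E] (s : Finset E) : Set E :=
  convexHull ℝ (s : Set E) \ ⋃ t : {t : Finset E // t ⊂ s}, convexHull ℝ (t.1 : Set E)

/-- A semi-algebraic triangulation of `P^n`: a finite simplicial complex `K` in some `ℝ^m` together
with a semi-algebraic homeomorphism `|K| → P^n` (i.e. one with a semi-algebraic graph). -/
structure Triangulation (n : ℕ) : Type where
  /-- the dimension of the ambient Euclidean space of `K` -/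
  m : ℕ
  /-- the simplicial complex `K` -/
  complex : Geometry.SimplicialComplex ℝ (Fin m → ℝ)
  finite : complex.faces.Finite
  /-- the homeomorphism `|K| → P^n` -/
  homeo : complex.space ≃ₜ PP n
  semialgebraic : IsSemialgebraic {x : Fin m ⊕ (Fin n × Fin 3) → ℝ |
    ∃ y : complex.space, x ∘ Sum.inl = y.1 ∧ x ∘ Sum.inr = embed (homeo y)}

namespace Triangulation

variable {n : ℕ} (K : Triangulation n)

/-- The ambient Euclidean space `ℝ^m` of the simplicial complex. -/
abbrev E : Type := Fin K.m → ℝ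

/-- The image in `P^n` of (the part in `|K|` of) a subset of `ℝ^m`. -/
def img (A : Set K.E) : Set (PP n) := {p | ∃ y : K.complex.space, y.1 ∈ A ∧ K.homeo y = p}

/-- The image in `P^n` of the simplex with vertex set `s`. -/
def simplexImg (s : Finset K.E) : Set (PP n) := K.img (convexHull ℝ (s : Set K.E))

/-- `S ⊆ P^n` is (the image of) a subcomplex of `K`: it is a union of images of simplices. -/
def IsSubcomplex (S : Set (PP n)) : Prop :=
  ∀ p ∈ S, ∃ s ∈ K.complex.faces, p ∈ K.simplexImg s ∧ K.simplexImg s ⊆ S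

/-- `S ⊆ P^n` is a full subcomplex of `K`: a simplex all of whose vertices are in `S` is in `S`. -/
def IsFullSubcomplex (S : Set (PP n)) : Prop :=
  K.IsSubcomplex S ∧
    ∀ s ∈ K.complex.faces, (∀ v ∈ s, K.simplexImg {v} ⊆ S) → K.simplexImg s ⊆ S

/-- `K ∩ S`: the simplicial complex of all simplices of `K` that are contained in `S`. -/
def restrict (S : Set (PP n)) : Geometry.SimplicialComplex ℝ K.E where
  faces := {s ∈ K.complex.faces | K.simplexImg s ⊆ S}
  isRelLowerSet_faces := by
    rintro s ⟨hs, hS⟩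
    refine ⟨K.complex.nonempty_of_mem_faces hs, fun t hts ht => ⟨K.complex.down_closed hs hts ht, ?_⟩⟩
    rintro p ⟨y, hy, rfl⟩
    exact hS ⟨y, convexHull_mono (Finset.coe_subset.2 hts) hy, rfl⟩
  indep hs := K.complex.indep hs.1
  inter_subset_convexHull hs ht := K.complex.inter_subset_convexHull hs.1 ht.1

/-- `K'` is a subdivision of `K`: the image of each simplex of `K'` is contained in the image of a
simplex of `K`, and the image of each simplex of `K` is a union of images of simplices of `K'`. -/
def IsSubdivision (K K' : Triangulation n) : Prop :=
  (∀ s' ∈ K'.complex.faces, ∃ s ∈ K.complex.faces, K'.simplexImg s' ⊆ K.simplexImg s) ∧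
    ∀ s ∈ K.complex.faces, ∃ F ⊆ K'.complex.faces, K.simplexImg s = ⋃ s' ∈ F, K'.simplexImg s'

end Triangulation

/-- A good triangulation of `P^n`. -/
structure GoodTriangulation (n : ℕ) : Type extends Triangulation n where
  /-- `D^n` is a subcomplex -/
  divisor : toTriangulation.IsSubcomplex (divD n)
  /-- `|K| → P^n` is a facewise regular embedding -/
  facewise : ∀ s ∈ complex.faces,
    IsRegularSubmanifold (s.card - 1) (embed '' toTriangulation.img (relInterior s))
  /-- every union of cubical faces is a full subcomplex -/
  full : ∀ 𝒥 : Set (Fin n → Option Pole),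
    toTriangulation.IsFullSubcomplex (⋃ J ∈ 𝒥, cubicalFace J)
  /-- `{|z_i| ≤ 1}` is a subcomplex -/
  disc : ∀ i : Fin n,
    toTriangulation.IsSubcomplex {p | ∃ z : ℂ, p i = (z : OnePoint ℂ) ∧ ‖z‖ ≤ 1}

/-- Good triangulations are preordered by subdivision: `K ≤ K'` iff `K'` is a subdivision of `K`. -/
instance (n : ℕ) : Preorder (GoodTriangulation n) where
  le K K' := K.toTriangulation.IsSubdivision K'.toTriangulation
  le_refl K := ⟨fun s hs => ⟨s, hs, subset_rfl⟩,
    fun s hs => ⟨{s}, by simpa using hs, by simp⟩⟩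
  le_trans K K' K'' h h' := by
    refine ⟨fun s hs => ?_, fun s hs => ?_⟩
    · obtain ⟨s', hs', h1⟩ := h'.1 s hs
      obtain ⟨t, ht, h2⟩ := h.1 s' hs'
      exact ⟨t, ht, h1.trans h2⟩
    · obtain ⟨F, hF, h1⟩ := h.2 s hs
      choose! G hG h2 using h'.2
      refine ⟨⋃ s' ∈ F, G s', by simpa using fun s' hs' => hG s' (hF hs'), ?_⟩
      rw [h1]
      ext p
      simp only [mem_iUnion, exists_prop]
      constructor
      · rintro ⟨s', hs', hp⟩
        rw [h2 s' (hF hs')] at hp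
        simp only [mem_iUnion, exists_prop] at hp
        obtain ⟨t, ht, hp⟩ := hp
        exact ⟨t, ⟨s', hs', ht⟩, hp⟩
      · rintro ⟨t, ⟨s', hs', ht⟩, hp⟩
        refine ⟨s', hs', ?_⟩
        rw [h2 s' (hF hs')]
        simp only [mem_iUnion, exists_prop]
        exact ⟨t, ht, hp⟩

/-! ### Auxiliary facts: simplices and dimensions -/

section aux

variable {E : Type} [AddCommGroup E] [Module ℝ E]

theorem exists_mem_relInterior (s : Finset E) {x : E} (hx : x ∈ convexHull ℝ (s : Set E)) :
    ∃ t ⊆ s, t.Nonempty ∧ x ∈ relInterior t := by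
  induction s using Finset.strongInduction with
  | H s ih =>
    by_cases h : ∃ t : {t : Finset E // t ⊂ s}, x ∈ convexHull ℝ (t.1 : Set E)
    · obtain ⟨⟨t, ht⟩, hxt⟩ := h
      obtain ⟨u, hu, h1, h2⟩ := ih t ht hxt
      exact ⟨u, hu.trans ht.subset, h1, h2⟩
    · refine ⟨s, subset_rfl, ?_, hx, by simpa using h⟩
      rw [← Finset.coe_nonempty]
      exact convexHull_nonempty_iff.1 ⟨x, hx⟩

theorem subset_of_mem_relInterior {C : Geometry.SimplicialComplex ℝ E} {s t : Finset E}
    (hs : s ∈ C.faces) (ht : t ∈ C.faces) {x : E} (hx : x ∈ relInterior t)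
    (hxs : x ∈ convexHull ℝ (s : Set E)) : t ⊆ s := by
  classical
  have h := C.inter_subset_convexHull ht hs ⟨hx.1, hxs⟩
  by_contra hts
  refine hx.2 (mem_iUnion.2 ⟨⟨t ∩ s, ?_⟩, by simpa using h⟩)
  exact ⟨Finset.inter_subset_left, fun h' => hts (h'.trans Finset.inter_subset_right)⟩

theorem relInterior_nonempty {s : Finset E} (hs : s.Nonempty)
    (hi : AffineIndependent ℝ ((↑) : s → E)) : (relInterior s).Nonempty := by
  classical
  have hc : (0 : ℝ) < s.card := by exact_mod_cast hs.card_pos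
  refine ⟨∑ y ∈ s, (s.card : ℝ)⁻¹ • y, ?_, ?_⟩
  · rw [Finset.mem_convexHull']
    exact ⟨fun _ => (s.card : ℝ)⁻¹, fun _ _ => by positivity, by simp [hc.ne'], rfl⟩
  · intro hx
    obtain ⟨⟨t, ht⟩, hxt⟩ := mem_iUnion.1 hx
    rw [Finset.mem_convexHull'] at hxt
    obtain ⟨w, -, hw1, hw2⟩ := hxt
    obtain ⟨a, has, hat⟩ := Finset.exists_of_ssubset ht
    have hA : ∑ y ∈ s, (if y ∈ t then w y else 0) = 1 := by
      rw [← Finset.sum_filter, Finset.filter_mem_eq_inter, Finset.inter_eq_right.2 ht.subset, hw1]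
    have hB : ∑ y ∈ s, (if y ∈ t then w y else 0) • y = ∑ y ∈ s, (s.card : ℝ)⁻¹ • y := by
      rw [← hw2]
      simp only [ite_smul, zero_smul]
      rw [← Finset.sum_filter, Finset.filter_mem_eq_inter, Finset.inter_eq_right.2 ht.subset]
    have := (affineIndependent_iff.1 hi) Finset.univ
      (fun y => (if y.1 ∈ t then w y.1 else 0) - (s.card : ℝ)⁻¹) ?_ ?_ ⟨a, has⟩ (Finset.mem_univ _)
    · simp only [hat, if_false, zero_sub, neg_eq_zero, inv_eq_zero] at this
      exact hc.ne' this
    · rw [Finset.univ_eq_attach, Finset.sum_attach s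
        (fun y => (if y ∈ t then w y else 0) - (s.card : ℝ)⁻¹), Finset.sum_sub_distrib, hA]
      simp [hc.ne']
    · rw [Finset.univ_eq_attach, Finset.sum_attach s
        (fun y => ((if y ∈ t then w y else 0) - (s.card : ℝ)⁻¹) • y)]
      simp only [sub_smul]
      rw [Finset.sum_sub_distrib, hB, sub_self]

end aux

theorem IsRegularSubmanifold.dimH_le {σ : Type} [Fintype σ] {d : ℕ} {S : Set (σ → ℝ)}
    (h : IsRegularSubmanifold d S) : dimH S ≤ d := by
  have hloc : ∀ p ∈ S, ∃ t ∈ 𝓝[S] p, dimH t ≤ d := by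
    intro p hp
    obtain ⟨U, V, φ, hU, hpU, hV, hφ, -, himg, -⟩ := h p hp
    refine ⟨S ∩ U, inter_mem_nhdsWithin _ (hU.mem_nhds hpU), ?_⟩
    rw [← himg]
    refine (dimH_image_le_of_locally_lipschitzOn (s := V) fun x hx => ?_).trans ?_
    · have h1 : ContDiffAt ℝ 1 φ x :=
        (hφ.contDiffAt (hV.mem_nhds hx)).of_le (by exact_mod_cast le_top)
      obtain ⟨C, t, ht, hC⟩ := h1.exists_lipschitzOnWith
      exact ⟨C, t, mem_nhdsWithin_of_mem_nhds ht, hC⟩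
    · exact (dimH_mono (subset_univ V)).trans (by simp [Real.dimH_univ_pi_fin])
  rw [← bsupr_limsup_dimH]
  refine iSup₂_le fun p hp => ?_
  obtain ⟨t, ht, hd⟩ := hloc p hp
  refine (Filter.limsup_le_of_le (by isBoundedDefault) ?_).trans hd
  rw [Filter.eventually_smallSets]
  exact ⟨t, ht, fun u hu => dimH_mono hu⟩

theorem IsRegularSubmanifold.le_dimH {σ : Type} [Fintype σ] {d : ℕ} {S : Set (σ → ℝ)}
    (h : IsRegularSubmanifold d S) (hne : S.Nonempty) : (d : ENNReal) ≤ dimH S := by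
  obtain ⟨p, hp⟩ := hne
  obtain ⟨U, V, φ, hU, hpU, hV, hφ, himm, himg, -⟩ := h p hp
  obtain ⟨x, hx, -⟩ : p ∈ φ '' V := himg ▸ ⟨hp, hpU⟩
  have hd : HasStrictFDerivAt φ (fderiv ℝ φ x) x :=
    (hφ.contDiffAt (hV.mem_nhds hx)).hasStrictFDerivAt (by simp)
  obtain ⟨g, hg⟩ := LinearMap.exists_leftInverse_of_injective (fderiv ℝ φ x : _ →ₗ[ℝ] _)
    (LinearMap.ker_eq_bot.2 (by exact himm x hx))
  let L : (σ → ℝ) →L[ℝ] (Fin d → ℝ) := LinearMap.toContinuousLinearMap g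
  have hL : HasStrictFDerivAt (L ∘ φ) (ContinuousLinearEquiv.refl ℝ (Fin d → ℝ) : _ →L[ℝ] _) x := by
    have h1 : (L ∘L fderiv ℝ φ x) = (ContinuousLinearEquiv.refl ℝ (Fin d → ℝ) : _ →L[ℝ] _) := by
      ext1 y
      exact LinearMap.congr_fun hg y
    exact h1 ▸ L.hasStrictFDerivAt.comp x hd
  have h2 : (L ∘ φ) '' V ∈ 𝓝 ((L ∘ φ) x) := by
    rw [← hL.map_nhds_eq_of_equiv]
    exact Filter.image_mem_map (hV.mem_nhds hx)
  calc (d : ENNReal) = dimH ((L ∘ φ) '' V) := by rw [Real.dimH_of_mem_nhds h2]; simp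
    _ = dimH (L '' (φ '' V)) := by rw [image_comp]
    _ ≤ dimH (φ '' V) := L.lipschitz.dimH_image_le _
    _ ≤ dimH S := dimH_mono (himg ▸ inter_subset_left)

theorem le_semialgDim {σ : Type} [Fintype σ] {d : ℕ} {M S : Set (σ → ℝ)} (hMS : M ⊆ S)
    (hne : M.Nonempty) (hM : IsRegularSubmanifold d M) : (d : WithBot ℕ∞) ≤ semialgDim S :=
  le_iSup₂_of_le (f := fun (d : ℕ) (_ : ∃ M ⊆ S, M.Nonempty ∧ IsRegularSubmanifold d M) =>
    (d : WithBot ℕ∞)) d ⟨M, hMS, hne, hM⟩ le_rfl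

theorem semialgDim_mono {σ : Type} [Fintype σ] {S T : Set (σ → ℝ)} (h : S ⊆ T) :
    semialgDim S ≤ semialgDim T :=
  iSup₂_le fun _ ⟨_, hM, hne, hr⟩ => le_semialgDim (hM.trans h) hne hr

theorem semialgDim_empty {σ : Type} [Fintype σ] : semialgDim (∅ : Set (σ → ℝ)) = ⊥ := by
  refine le_bot_iff.1 (iSup₂_le ?_)
  rintro d ⟨M, hM, hne, -⟩
  exact absurd (hne.mono hM) not_nonempty_empty

/-- A set covered by finitely many regular submanifolds of dimension at most `N` has dimension at
most `N`. -/
theorem semialgDim_le_of_cover {σ : Type} [Fintype σ] {ι : Type} {F : Set ι} (hF : F.Finite)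
    {N : ℕ} {S : Set (σ → ℝ)} (X : ι → Set (σ → ℝ)) (hS : S ⊆ ⋃ a ∈ F, X a)
    (hX : ∀ a ∈ F, ∃ d ≤ N, IsRegularSubmanifold d (X a)) : semialgDim S ≤ (N : WithBot ℕ∞) := by
  refine iSup₂_le ?_
  rintro d ⟨M, hM, hne, hr⟩
  have h1 : (d : ENNReal) ≤ N := by
    refine (hr.le_dimH hne).trans ((dimH_mono (hM.trans hS)).trans ?_)
    rw [dimH_bUnion hF.countable]
    refine iSup₂_le fun a ha => ?_
    obtain ⟨e, he, hre⟩ := hX a ha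
    exact hre.dimH_le.trans (by exact_mod_cast he)
  exact_mod_cast h1

/-! ### Simplicial chains -/

section chains

variable {E : Type}

open scoped Classical in
/-- The set of the vertices `v_0, …, v_p`. -/
def verts {p : ℕ} (v : Fin (p + 1) → E) : Finset E := Finset.univ.image v

theorem verts_comp_perm {p : ℕ} (v : Fin (p + 1) → E) (π : Equiv.Perm (Fin (p + 1))) :
    verts (v ∘ π) = verts v := by
  ext x
  simp only [verts, Finset.mem_image, Finset.mem_univ, true_and, Function.comp_apply]
  exact (π.surjective.exists (p := fun i => v i = x)).symm

theorem mem_verts {p : ℕ} {v : Fin (p + 1) → E} {x : E} : x ∈ verts v ↔ ∃ i, v i = x := by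
  simp [verts]

theorem verts_nonempty {p : ℕ} (v : Fin (p + 1) → E) : (verts v).Nonempty :=
  ⟨v 0, mem_verts.2 ⟨0, rfl⟩⟩

theorem mapDomain_tail_apply {p : ℕ} (c : (Fin (p + 2) → E) →₀ ℚ) (π : Equiv.Perm (Fin (p + 1)))
    (hc : ∀ v (τ : Equiv.Perm (Fin (p + 2))), c (v ∘ τ) = (Equiv.Perm.sign τ : ℤ) * c v)
    (w : Fin (p + 1) → E) :
    Finsupp.mapDomain Fin.tail c (w ∘ π) =
      (Equiv.Perm.sign π : ℤ) * Finsupp.mapDomain Fin.tail c w := by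
  classical
  let τ : Equiv.Perm (Fin (p + 2)) := Equiv.Perm.decomposeFin.symm (0, π)
  have hτ : Equiv.Perm.sign τ = Equiv.Perm.sign π := by
    simp [τ, Equiv.Perm.decomposeFin.symm_sign]
  have hτ0 : τ 0 = 0 := by simp [τ]
  have hτs : ∀ i : Fin (p + 1), τ i.succ = (π i).succ := by
    intro i; simp [τ, Equiv.Perm.decomposeFin_symm_apply_succ]
  have key : Finsupp.mapDomain (fun v : Fin (p + 2) → E => v ∘ τ) c =
      ((Equiv.Perm.sign π : ℤ) : ℚ) • c := by
    ext v
    have h1 : v = (fun u : Fin (p + 2) → E => u ∘ τ) (v ∘ τ.symm) := by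
      ext i; simp
    conv_lhs => rw [h1]
    rw [Finsupp.mapDomain_apply]
    · rw [hc]
      simp [hτ]
    · intro a b hab
      ext i
      simpa using congrFun hab (τ.symm i)
  have h2 : Finsupp.mapDomain (fun w : Fin (p + 1) → E => w ∘ π) (Finsupp.mapDomain Fin.tail c) =
      ((Equiv.Perm.sign π : ℤ) : ℚ) • Finsupp.mapDomain Fin.tail c := by
    rw [← Finsupp.mapDomain_comp, ← Finsupp.mapDomain_smul, ← key, ← Finsupp.mapDomain_comp]
    congr 1
  have h3 : Function.Injective fun w : Fin (p + 1) → E => w ∘ π := by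
    intro a b hab
    ext i
    simpa using congrFun hab (π.symm i)
  have h4 := DFunLike.congr_fun h2 (w ∘ π)
  rw [Finsupp.mapDomain_apply h3 (Finsupp.mapDomain Fin.tail c) w] at h4
  rw [h4, Finsupp.smul_apply, smul_eq_mul, ← mul_assoc]
  have h5 : (((Equiv.Perm.sign π : ℤ) : ℚ)) * ((Equiv.Perm.sign π : ℤ) : ℚ) = 1 := by
    rw [← Int.cast_mul, ← Units.val_mul, Int.units_mul_self]
    simp
  rw [h5, one_mul]

theorem exists_of_mapDomain_tail_ne_zero {p : ℕ} {c : (Fin (p + 2) → E) →₀ ℚ}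
    {w : Fin (p + 1) → E} (h : Finsupp.mapDomain Fin.tail c w ≠ 0) :
    ∃ v, c v ≠ 0 ∧ Fin.tail v = w := by
  classical
  have := Finsupp.mapDomain_support (Finsupp.mem_support_iff.2 h)
  simpa using this

variable [AddCommGroup E] [Module ℝ E]

/-- `(v_0, …, v_p)` is an ordered `p`-simplex of the simplicial complex `C`. -/
def IsSimplex (C : Geometry.SimplicialComplex ℝ E) {p : ℕ} (v : Fin (p + 1) → E) : Prop :=
  Function.Injective v ∧ verts v ∈ C.faces

/-- The group `C_p(C; ℚ)` of oriented simplicial chains. A chain is given by its coefficients: `c v`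
is the coefficient of the oriented simplex `[v_0, …, v_p]`, so that `c (v ∘ π) = sign π • c v` for
every permutation `π`, and `c v = 0` unless `v_0, …, v_p` are the vertices of a `p`-simplex. -/
def chains (C : Geometry.SimplicialComplex ℝ E) (p : ℕ) :
    Submodule ℚ ((Fin (p + 1) → E) →₀ ℚ) where
  carrier := {c | (∀ v (π : Equiv.Perm (Fin (p + 1))),
    c (v ∘ π) = (Equiv.Perm.sign π : ℤ) * c v) ∧ ∀ v, c v ≠ 0 → IsSimplex C v}
  zero_mem' := by simp
  add_mem' := by
    rintro a b ⟨ha, ha'⟩ ⟨hb, hb'⟩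
    refine ⟨fun v π => by simp [ha, hb, mul_add], fun v hv => ?_⟩
    by_cases h : a v = 0
    · exact hb' v fun h' => hv (by simp [h, h'])
    · exact ha' v h
  smul_mem' := by
    rintro r a ⟨ha, ha'⟩
    refine ⟨fun v π => ?_, fun v hv => ha' v fun h => hv (by simp [h])⟩
    simp only [Finsupp.smul_apply, ha, smul_eq_mul]
    ring

/-- The elementary chain of the oriented simplex `[v_0, …, v_p]` (for distinct `v_0, …, v_p`): its
coefficient at `[v_{π 0}, …, v_{π p}]` is `sign π`. -/
def oriented {p : ℕ} (v : Fin (p + 1) → E) : (Fin (p + 1) → E) →₀ ℚ :=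
  ∑ π : Equiv.Perm (Fin (p + 1)), Finsupp.single (v ∘ π) ((Equiv.Perm.sign π : ℤ) : ℚ)

/-- The boundary on coefficients: the coefficient of `[w_0, …, w_p]` in the boundary of `c` is the
sum over all points `x` of the coefficient of `[x, w_0, …, w_p]` in `c`. This is the linear map with
`[v_0, …, v_{p+1}] ↦ ∑ i, (-1)^i [v_0, …, v̂_i, …, v_{p+1}]`. -/
def boundaryAux (E : Type) (p : ℕ) :
    ((Fin (p + 2) → E) →₀ ℚ) →ₗ[ℚ] ((Fin (p + 1) → E) →₀ ℚ) :=
  Finsupp.lmapDomain ℚ ℚ Fin.tail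

theorem IsSimplex.card {C : Geometry.SimplicialComplex ℝ E} {p : ℕ} {v : Fin (p + 1) → E}
    (h : IsSimplex C v) : (verts v).card = p + 1 := by
  classical
  have : verts v = Finset.univ.image v := by ext; simp [mem_verts]
  rw [this, Finset.card_image_of_injective _ h.1]
  simp

/-- Passing to some of the vertices of a simplex gives a simplex. -/
theorem IsSimplex.comp {C : Geometry.SimplicialComplex ℝ E} {p q : ℕ} {v : Fin (p + 1) → E}
    (h : IsSimplex C v) {f : Fin (q + 1) → Fin (p + 1)} (hf : Function.Injective f) :
    IsSimplex C (v ∘ f) := by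
  refine ⟨h.1.comp hf, C.down_closed h.2 ?_ (verts_nonempty _)⟩
  intro x hx
  obtain ⟨i, rfl⟩ := mem_verts.1 hx
  exact mem_verts.2 ⟨f i, rfl⟩

theorem boundaryAux_mem (C : Geometry.SimplicialComplex ℝ E) (p : ℕ)
    (c : (Fin (p + 2) → E) →₀ ℚ) (hc : c ∈ chains C (p + 1)) :
    boundaryAux E p c ∈ chains C p := by
  refine ⟨fun w π => mapDomain_tail_apply c π hc.1 w, fun w hw => ?_⟩
  obtain ⟨v, hv, rfl⟩ := exists_of_mapDomain_tail_ne_zero hw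
  exact (hc.2 v hv).comp (Fin.succ_injective _)

/-- The boundary `δ : C_{p+1}(C; ℚ) → C_p(C; ℚ)`. -/
def boundary (C : Geometry.SimplicialComplex ℝ E) (p : ℕ) :
    chains C (p + 1) →ₗ[ℚ] chains C p :=
  (boundaryAux E p).restrict (boundaryAux_mem C p)

theorem boundary_boundary (C : Geometry.SimplicialComplex ℝ E) (p : ℕ) (c : chains C (p + 2)) :
    boundary C p (boundary C (p + 1) c) = 0 := by
  classical
  ext w
  change Finsupp.mapDomain Fin.tail (Finsupp.mapDomain Fin.tail c.1) w = 0
  rw [← Finsupp.mapDomain_comp]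
  let τ : Equiv.Perm (Fin (p + 3)) := Equiv.swap 0 1
  have hτ : Equiv.Perm.sign τ = -1 := Equiv.Perm.sign_swap (by simp)
  have key : Finsupp.mapDomain (fun v : Fin (p + 3) → E => v ∘ τ) c.1 = - c.1 := by
    ext v
    have h1 : v = (fun u : Fin (p + 3) → E => u ∘ τ) (v ∘ τ.symm) := by
      ext i; simp
    conv_lhs => rw [h1]
    rw [Finsupp.mapDomain_apply]
    · rw [c.2.1]
      simp [τ]
    · intro a b hab
      ext i
      simpa using congrFun hab (τ.symm i)
  have h2 : Finsupp.mapDomain (Fin.tail ∘ Fin.tail : (Fin (p + 3) → E) → _) c.1 =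
      - Finsupp.mapDomain (Fin.tail ∘ Fin.tail : (Fin (p + 3) → E) → _) c.1 := by
    rw [← neg_one_smul ℚ, ← Finsupp.mapDomain_smul, neg_one_smul, ← key, ← Finsupp.mapDomain_comp]
    congr 1
  have h3 := DFunLike.congr_fun h2 w
  rw [Finsupp.neg_apply] at h3
  linarith

theorem oriented_mem {C : Geometry.SimplicialComplex ℝ E} {p : ℕ} {v : Fin (p + 1) → E}
    (hv : IsSimplex C v) : oriented v ∈ chains C p := by
  classical
  refine ⟨fun w π => ?_, fun w hw => ?_⟩
  · simp only [oriented, Finsupp.coe_finsetSum, Finset.sum_apply]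
    rw [Finset.mul_sum]
    refine Fintype.sum_equiv (Equiv.mulRight π⁻¹) _ _ fun τ => ?_
    have h1 : (v ∘ τ = w ∘ π) ↔ v ∘ (τ * π⁻¹ : Equiv.Perm _) = w := by
      constructor
      · intro h; ext i
        simpa using congrFun h (π⁻¹ i)
      · rintro rfl; ext i; simp
    simp only [Equiv.coe_mulRight, Finsupp.single_apply, h1]
    split_ifs
    · rw [Equiv.Perm.sign_mul, Equiv.Perm.sign_inv, ← Int.cast_mul, ← Units.val_mul, mul_comm,
        mul_assoc, Int.units_mul_self, mul_one]
    · simp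
  · have : ∃ π : Equiv.Perm (Fin (p + 1)), v ∘ π = w := by
      by_contra h
      push Not at h
      refine hw ?_
      simp [oriented, h]
    obtain ⟨π, rfl⟩ := this
    exact hv.comp π.injective

end chains

/-! ### Relative chains and admissible chains of a triangulation -/

namespace Triangulation

variable {n : ℕ} (K : Triangulation n)

theorem img_mono {A B : Set K.E} (h : A ⊆ B) : K.img A ⊆ K.img B := by
  rintro p ⟨y, hy, rfl⟩
  exact ⟨y, h hy, rfl⟩

theorem simplexImg_mono {s t : Finset K.E} (h : s ⊆ t) : K.simplexImg s ⊆ K.simplexImg t :=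
  K.img_mono (convexHull_mono (Finset.coe_subset.2 h))

theorem exists_mem_img_relInterior {s : Finset K.E} {p : PP n} (hp : p ∈ K.simplexImg s) :
    ∃ t ⊆ s, t.Nonempty ∧ p ∈ K.img (relInterior t) := by
  obtain ⟨y, hy, rfl⟩ := hp
  obtain ⟨t, hts, hne, hyt⟩ := exists_mem_relInterior s hy
  exact ⟨t, hts, hne, y, hyt, rfl⟩

theorem subset_of_mem_img {s t : Finset K.E} (hs : s ∈ K.complex.faces)
    (ht : t ∈ K.complex.faces) {p : PP n} (hp : p ∈ K.img (relInterior t))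
    (hps : p ∈ K.simplexImg s) : t ⊆ s := by
  obtain ⟨y, hy, rfl⟩ := hp
  obtain ⟨y', hy', h⟩ := hps
  obtain rfl := K.homeo.injective h
  exact subset_of_mem_relInterior hs ht hy hy'

theorem img_relInterior_subset (t : Finset K.E) : K.img (relInterior t) ⊆ K.simplexImg t :=
  K.img_mono fun _ h => h.1

theorem img_relInterior_nonempty {t : Finset K.E} (ht : t ∈ K.complex.faces) :
    (K.img (relInterior t)).Nonempty := by
  obtain ⟨x, hx⟩ := relInterior_nonempty (K.complex.nonempty_of_mem_faces ht) (K.complex.indep ht)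
  exact ⟨_, ⟨x, K.complex.convexHull_subset_space ht hx.1⟩, hx, rfl⟩

theorem simplexImg_nonempty {t : Finset K.E} (ht : t ∈ K.complex.faces) :
    (K.simplexImg t).Nonempty :=
  (K.img_relInterior_nonempty ht).mono (K.img_relInterior_subset t)

theorem exists_mem_img (p : PP n) : ∃ t ∈ K.complex.faces, p ∈ K.img (relInterior t) := by
  obtain ⟨s, hs, hy⟩ := Geometry.SimplicialComplex.mem_space_iff.1 (K.homeo.symm p).2
  obtain ⟨t, hts, hne, hyt⟩ := exists_mem_relInterior s hy
  exact ⟨t, K.complex.down_closed hs hts hne, K.homeo.symm p, hyt, by simp⟩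

variable {K} in
/-- A subcomplex that meets the interior of a simplex contains the simplex. -/
theorem IsSubcomplex.simplexImg_subset {S : Set (PP n)} (hS : K.IsSubcomplex S)
    {t : Finset K.E} (ht : t ∈ K.complex.faces) {p : PP n} (hp : p ∈ K.img (relInterior t))
    (hpS : p ∈ S) : K.simplexImg t ⊆ S := by
  obtain ⟨s, hs, hps, hsS⟩ := hS p hpS
  exact (K.simplexImg_mono (K.subset_of_mem_img hs ht hp hps)).trans hsS

/-- The relative chain group `C_p(K, D^n; ℚ) = C_p(K; ℚ) / C_p(K ∩ D^n; ℚ)`. -/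
abbrev RelChain (p : ℕ) : Type :=
  chains K.complex p ⧸ (chains (K.restrict (divD n)) p).submoduleOf (chains K.complex p)

/-- The class in `C_p(K, D^n; ℚ)` of a chain. -/
abbrev relClass (p : ℕ) : chains K.complex p →ₗ[ℚ] K.RelChain p := Submodule.mkQ _

/-- The boundary `δ : C_{p+1}(K, D^n; ℚ) → C_p(K, D^n; ℚ)`. -/
def relBoundary (p : ℕ) : K.RelChain (p + 1) →ₗ[ℚ] K.RelChain p :=
  Submodule.mapQ _ _ (boundary K.complex p) fun c hc =>
    boundaryAux_mem (K.restrict (divD n)) p c.1 hc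

theorem relBoundary_relBoundary (p : ℕ) (γ : K.RelChain (p + 2)) :
    K.relBoundary p (K.relBoundary (p + 1) γ) = 0 := by
  obtain ⟨c, rfl⟩ := Submodule.mkQ_surjective _ γ
  change K.relClass p (boundary _ p (boundary _ (p + 1) c)) = 0
  rw [boundary_boundary, map_zero]

/-- The support `|c| ⊆ P^n` of a chain: the union of the simplices with a non-zero coefficient. -/
def support {p : ℕ} (c : chains K.complex p) : Set (PP n) :=
  ⋃ v ∈ c.1.support, K.simplexImg (verts v)

/-- A relative chain is admissible if the support of a representative is admissible. -/
def IsAdmissibleChain {p : ℕ} (γ : K.RelChain p) : Prop :=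
  ∃ c : chains K.complex p, K.relClass p c = γ ∧ IsAdmissible (K.support c)

end Triangulation

namespace GoodTriangulation

variable {n : ℕ} (K : GoodTriangulation n)

theorem isSubcomplex_cubicalFace (J : Fin n → Option Pole) :
    K.toTriangulation.IsSubcomplex (cubicalFace J) := by
  simpa using (K.full {J}).1

variable {K} in
/-- Admissibility of a chain in terms of the dimensions of the simplices in its support. -/
theorem isAdmissible_support_iff {p : ℕ} (c : chains K.complex p) :
    IsAdmissible (K.support c) ↔ ∀ v ∈ c.1.support, ∀ t ⊆ verts v, t.Nonempty →
      ∀ J : Fin n → Option Pole, K.simplexImg t ⊆ cubicalFace J → ¬ K.simplexImg t ⊆ divD n →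
        t.card - 1 + 2 * codim J ≤ p := by
  classical
  have hsimp : ∀ v ∈ c.1.support, IsSimplex K.complex v := fun v hv =>
    c.2.2 v (Finsupp.mem_support_iff.1 hv)
  constructor
  · intro h v hv t htv htne J hJ hD
    have ht : t ∈ K.complex.faces := K.complex.down_closed (hsimp v hv).2 htv htne
    have h1 : ((t.card - 1 : ℕ) : WithBot ℕ∞) ≤
        semialgDim (embed '' (K.support c ∩ (cubicalFace J \ divD n))) := by
      refine le_semialgDim (image_mono ?_) ((K.img_relInterior_nonempty ht).image _)
        (K.facewise t ht)
      intro q hq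
      refine ⟨mem_iUnion₂.2 ⟨v, hv, K.simplexImg_mono htv (K.img_relInterior_subset t hq)⟩,
        hJ (K.img_relInterior_subset t hq), fun hqD => hD ?_⟩
      exact K.divisor.simplexImg_subset ht hq hqD
    have h2 : semialgDim (embed '' (K.support c)) ≤ (p : WithBot ℕ∞) := by
      refine semialgDim_le_of_cover (F := {t | t ∈ K.complex.faces ∧ ∃ v ∈ c.1.support, t ⊆ verts v})
        (K.finite.subset fun _ h => h.1) (fun t => embed '' K.img (relInterior t)) ?_ ?_
      · rintro _ ⟨q, hq, rfl⟩
        obtain ⟨v, hv, hq⟩ := mem_iUnion₂.1 hq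
        obtain ⟨t, htv, htne, hqt⟩ := K.exists_mem_img_relInterior hq
        exact mem_iUnion₂.2 ⟨t, ⟨K.complex.down_closed (hsimp v hv).2 htv htne, v, hv, htv⟩,
          q, hqt, rfl⟩
      · rintro t ⟨ht, v, hv, htv⟩
        refine ⟨t.card - 1, ?_, K.facewise t ht⟩
        have := Finset.card_le_card htv
        rw [(hsimp v hv).card] at this
        omega
    have h3 := ((add_le_add_left h1 _).trans (h J)).trans h2
    exact_mod_cast h3
  · intro h J
    rcases (K.support c ∩ (cubicalFace J \ divD n)).eq_empty_or_nonempty with he | ⟨q, hq⟩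
    · rw [he, image_empty, semialgDim_empty, WithBot.bot_add]
      exact bot_le
    have key : ∀ q ∈ K.support c ∩ (cubicalFace J \ divD n), ∃ v ∈ c.1.support, ∃ t ⊆ verts v,
        t ∈ K.complex.faces ∧ q ∈ K.img (relInterior t) ∧ t.card - 1 + 2 * codim J ≤ p := by
      rintro q ⟨hq, hqJ, hqD⟩
      obtain ⟨v, hv, hq⟩ := mem_iUnion₂.1 hq
      obtain ⟨t, htv, htne, hqt⟩ := K.exists_mem_img_relInterior hq
      have ht := K.complex.down_closed (hsimp v hv).2 htv htne
      refine ⟨v, hv, t, htv, ht, hqt, h v hv t htv htne J ?_ ?_⟩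
      · exact (K.isSubcomplex_cubicalFace J).simplexImg_subset ht hqt hqJ
      · exact fun h' => hqD (h' (K.img_relInterior_subset t hqt))
    obtain ⟨v, hv, t₀, -, -, -, hle⟩ := key q hq
    have h1 : semialgDim (embed '' (K.support c ∩ (cubicalFace J \ divD n))) ≤
        ((p - 2 * codim J : ℕ) : WithBot ℕ∞) := by
      refine semialgDim_le_of_cover
        (F := {t | t ∈ K.complex.faces ∧ t.card - 1 + 2 * codim J ≤ p})
        (K.finite.subset fun _ h => h.1) (fun t => embed '' K.img (relInterior t)) ?_ ?_
      · rintro _ ⟨q, hq, rfl⟩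
        obtain ⟨v, hv, t, -, ht, hqt, hle⟩ := key q hq
        exact mem_iUnion₂.2 ⟨t, ⟨ht, hle⟩, q, hqt, rfl⟩
      · rintro t ⟨ht, hle⟩
        exact ⟨t.card - 1, by omega, K.facewise t ht⟩
    have h2 : (p : WithBot ℕ∞) ≤ semialgDim (embed '' (K.support c)) := by
      have h3 := K.facewise _ (hsimp v hv).2
      rw [(hsimp v hv).card, Nat.add_sub_cancel] at h3
      refine le_semialgDim (image_mono ?_) ((K.img_relInterior_nonempty (hsimp v hv).2).image _) h3
      intro q hq
      exact mem_iUnion₂.2 ⟨v, hv, K.img_relInterior_subset _ hq⟩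
    refine (add_le_add_left h1 _).trans (le_trans (le_of_eq ?_) h2)
    rw [← Nat.cast_add, Nat.sub_add_cancel (by omega)]

variable {K} in
/-- Admissibility does not depend on the representative. -/
theorem isAdmissibleChain_mk {p : ℕ} (c : chains K.complex p) :
    K.IsAdmissibleChain (K.relClass p c) ↔ IsAdmissible (K.support c) := by
  refine ⟨?_, fun h => ⟨c, rfl, h⟩⟩
  rintro ⟨c', hc', h⟩
  rw [isAdmissible_support_iff] at h ⊢
  intro v hv t htv htne J hJ hD
  refine h v ?_ t htv htne J hJ hD
  have h1 : c' - c ∈ (chains (K.restrict (divD n)) p).submoduleOf (chains K.complex p) :=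
    (Submodule.Quotient.eq _).1 hc'
  rw [Finsupp.mem_support_iff] at hv ⊢
  intro h0
  have h2 := (h1.2 v (by simpa [h0] using hv)).2.2
  exact hD ((K.simplexImg_mono htv).trans h2)

/-- The admissible relative chains form a subspace. -/
def admissible (p : ℕ) : Submodule ℚ (K.RelChain p) where
  carrier := {γ | K.IsAdmissibleChain γ}
  zero_mem' := by
    refine (isAdmissibleChain_mk (0 : chains K.complex p)).2 ((isAdmissible_support_iff _).2 ?_)
    intro v hv
    simp at hv
  add_mem' := by
    intro γ γ' h h'
    obtain ⟨c, rfl⟩ := Submodule.mkQ_surjective _ γ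
    obtain ⟨c', rfl⟩ := Submodule.mkQ_surjective _ γ'
    change K.IsAdmissibleChain (K.relClass p (c + c'))
    replace h := (isAdmissible_support_iff c).1 ((isAdmissibleChain_mk c).1 h)
    replace h' := (isAdmissible_support_iff c').1 ((isAdmissibleChain_mk c').1 h')
    rw [isAdmissibleChain_mk, isAdmissible_support_iff]
    intro v hv
    by_cases hc : c.1 v = 0
    · exact h' v (Finsupp.mem_support_iff.2 fun hc' =>
        Finsupp.mem_support_iff.1 hv (by simp [hc, hc']))
    · exact h v (Finsupp.mem_support_iff.2 hc)
  smul_mem' := by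
    intro r γ h
    obtain ⟨c, rfl⟩ := Submodule.mkQ_surjective _ γ
    change K.IsAdmissibleChain (K.relClass p (r • c))
    replace h := (isAdmissible_support_iff c).1 ((isAdmissibleChain_mk c).1 h)
    rw [isAdmissibleChain_mk, isAdmissible_support_iff]
    intro v hv
    exact h v (Finsupp.mem_support_iff.2 fun hc => Finsupp.mem_support_iff.1 hv (by simp [hc]))

/-- `AC_p(K, D^n; ℚ)`: the relative chains `γ` such that `γ` and `δγ` are admissible (`δγ = 0` if
`p = 0`). -/
def AC : (p : ℕ) → Submodule ℚ (K.RelChain p)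
  | 0 => K.admissible 0
  | p + 1 => K.admissible (p + 1) ⊓ (K.admissible p).comap (K.relBoundary p)

theorem AC_le_admissible (p : ℕ) : K.AC p ≤ K.admissible p := by
  cases p with
  | zero => exact le_rfl
  | succ p => exact inf_le_left

theorem relBoundary_mem_AC (p : ℕ) (γ : K.RelChain (p + 1)) (h : γ ∈ K.AC (p + 1)) :
    K.relBoundary p γ ∈ K.AC p := by
  cases p with
  | zero => exact h.2
  | succ p =>
    refine ⟨h.2, ?_⟩
    change K.relBoundary p (K.relBoundary (p + 1) γ) ∈ K.admissible p
    rw [K.relBoundary_relBoundary]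
    exact zero_mem _

/-- The differential `δ` of the complex `AC_•(K, D^n; ℚ)`. -/
def boundaryAC (p : ℕ) : K.AC (p + 1) →ₗ[ℚ] K.AC p :=
  (K.relBoundary p).restrict (K.relBoundary_mem_AC p)

end GoodTriangulation

/-! ### The subdivision operator -/

/-- `Λ` is a subdivision operator: an augmentation preserving chain map `C_•(K; ℚ) → C_•(K'; ℚ)`
such that the simplices of `Λ σ` are contained in `σ`. -/
structure IsSubdivisionOperator {n : ℕ} (K K' : Triangulation n)
    (Λ : ∀ p, chains K.complex p →ₗ[ℚ] chains K'.complex p) : Prop where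
  carried : ∀ p c v', (Λ p c).1 v' ≠ 0 →
    ∃ v, c.1 v ≠ 0 ∧ K'.simplexImg (verts v') ⊆ K.simplexImg (verts v)
  comm : ∀ p c, Λ p (boundary K.complex p c) = boundary K'.complex p (Λ (p + 1) c)
  augmentation : ∀ c, ((Λ 0 c).1.sum fun _ a => a) = c.1.sum fun _ a => a

open scoped Classical in
/-- The subdivision operator `λ : C_•(K; ℚ) → C_•(K'; ℚ)`, i.e. the unique map as above (it exists if
`K'` is a subdivision of `K`; the value is irrelevant otherwise). -/
def subdivision {n : ℕ} (K K' : Triangulation n) :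
    ∀ p, chains K.complex p →ₗ[ℚ] chains K'.complex p :=
  if h : ∃ Λ, IsSubdivisionOperator K K' Λ then h.choose else fun _ => 0

theorem subdivision_carried {n : ℕ} (K K' : Triangulation n) (p : ℕ) (c : chains K.complex p)
    (v' : Fin (p + 1) → K'.E) (h : (subdivision K K' p c).1 v' ≠ 0) :
    ∃ v, c.1 v ≠ 0 ∧ K'.simplexImg (verts v') ⊆ K.simplexImg (verts v) := by
  unfold subdivision at h
  split_ifs at h with h'
  · exact h'.choose_spec.carried p c v' h
  · exact absurd rfl h

theorem subdivision_comm {n : ℕ} (K K' : Triangulation n) (p : ℕ) (c : chains K.complex (p + 1)) :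
    subdivision K K' p (boundary K.complex p c) =
      boundary K'.complex p (subdivision K K' (p + 1) c) := by
  unfold subdivision
  split_ifs with h
  · exact h.choose_spec.comm p c
  · simp

/-- The subdivision operator `λ : C_p(K, D^n; ℚ) → C_p(K', D^n; ℚ)`. -/
def relSubdivision {n : ℕ} (K K' : Triangulation n) (p : ℕ) : K.RelChain p →ₗ[ℚ] K'.RelChain p :=
  Submodule.mapQ _ _ (subdivision K K' p) fun c hc => by
    refine ⟨(subdivision K K' p c).2.1, fun v' hv' => ?_⟩
    obtain ⟨v, hv, hvv'⟩ := subdivision_carried K K' p c v' hv'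
    have h := (subdivision K K' p c).2.2 v' hv'
    exact ⟨h.1, h.2, hvv'.trans (hc.2 v hv).2.2⟩

theorem relSubdivision_comm {n : ℕ} (K K' : Triangulation n) (p : ℕ) (γ : K.RelChain (p + 1)) :
    relSubdivision K K' p (K.relBoundary p γ) = K'.relBoundary p (relSubdivision K K' (p + 1) γ) := by
  obtain ⟨c, rfl⟩ := Submodule.mkQ_surjective _ γ
  exact congrArg (K'.relClass p) (subdivision_comm K K' p c)

theorem relSubdivision_mem_admissible {n : ℕ} (K K' : GoodTriangulation n) (p : ℕ)
    (γ : K.RelChain p) (hγ : γ ∈ K.admissible p) :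
    relSubdivision K.toTriangulation K'.toTriangulation p γ ∈ K'.admissible p := by
  obtain ⟨c, rfl⟩ := Submodule.mkQ_surjective _ γ
  have h := (GoodTriangulation.isAdmissible_support_iff c).1
    ((GoodTriangulation.isAdmissibleChain_mk c).1 hγ)
  refine (GoodTriangulation.isAdmissibleChain_mk (K := K')
    (subdivision K.toTriangulation K'.toTriangulation p c)).2
    ((GoodTriangulation.isAdmissible_support_iff _).2 ?_)
  intro v' hv' t' htv' htne' J hJ hD
  rw [Finsupp.mem_support_iff] at hv'
  obtain ⟨v, hv, hvv'⟩ := subdivision_carried _ _ p c v' hv'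
  have hs' := (subdivision K.toTriangulation K'.toTriangulation p c).2.2 v' hv'
  have ht' := K'.complex.down_closed hs'.2 htv' htne'
  have hs := c.2.2 v hv
  have key : ∀ q ∈ K'.img (relInterior t'), ∃ t ∈ K.complex.faces, q ∈ K.img (relInterior t) ∧
      t.card - 1 + 2 * codim J ≤ p := by
    intro q hq
    have hq1 := K'.img_relInterior_subset t' hq
    obtain ⟨t, htv, htne, hqt⟩ :=
      K.exists_mem_img_relInterior (hvv' (K'.simplexImg_mono htv' hq1))
    have ht := K.complex.down_closed hs.2 htv htne
    refine ⟨t, ht, hqt, h v (Finsupp.mem_support_iff.2 hv) t htv htne J ?_ ?_⟩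
    · exact (K.isSubcomplex_cubicalFace J).simplexImg_subset ht hqt (hJ hq1)
    · intro hD'
      exact hD (K'.divisor.simplexImg_subset ht' hq (hD' (K.img_relInterior_subset t hqt)))
  obtain ⟨q, hq⟩ := K'.img_relInterior_nonempty ht'
  obtain ⟨t₀, -, -, hle⟩ := key q hq
  have h1 : ((t'.card - 1 : ℕ) : WithBot ℕ∞) ≤ ((p - 2 * codim J : ℕ) : WithBot ℕ∞) := by
    refine (le_semialgDim subset_rfl ((K'.img_relInterior_nonempty ht').image _)
      (K'.facewise t' ht')).trans ?_
    refine semialgDim_le_of_cover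
      (F := {t | t ∈ K.complex.faces ∧ t.card - 1 + 2 * codim J ≤ p})
      (K.finite.subset fun _ h => h.1) (fun t => embed '' K.img (relInterior t)) ?_ ?_
    · rintro _ ⟨q, hq, rfl⟩
      obtain ⟨t, ht, hqt, hle⟩ := key q hq
      exact mem_iUnion₂.2 ⟨t, ⟨ht, hle⟩, q, hqt, rfl⟩
    · rintro t ⟨ht, hle⟩
      exact ⟨t.card - 1, by omega, K.facewise t ht⟩
  have h2 : t'.card - 1 ≤ p - 2 * codim J := by exact_mod_cast h1
  omega

theorem relSubdivision_mem_AC {n : ℕ} (K K' : GoodTriangulation n) (p : ℕ)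
    (γ : K.RelChain p) (hγ : γ ∈ K.AC p) :
    relSubdivision K.toTriangulation K'.toTriangulation p γ ∈ K'.AC p := by
  cases p with
  | zero => exact relSubdivision_mem_admissible K K' 0 γ hγ
  | succ p =>
    refine ⟨relSubdivision_mem_admissible K K' _ γ hγ.1, ?_⟩
    change K'.relBoundary p _ ∈ K'.admissible p
    rw [← relSubdivision_comm]
    exact relSubdivision_mem_admissible K K' _ _ hγ.2

/-- The subdivision operator `λ : AC_p(K, D^n; ℚ) → AC_p(K', D^n; ℚ)`. -/
def subdivisionAC {n : ℕ} (p : ℕ) (K K' : GoodTriangulation n) (_ : K ≤ K') :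
    K.AC p →ₗ[ℚ] K'.AC p :=
  (relSubdivision K.toTriangulation K'.toTriangulation p).restrict (relSubdivision_mem_AC K K' p)

open scoped Classical in
/-- `AC_p(P^n, D^n; ℚ)`: the direct limit of the `AC_p(K, D^n; ℚ)` over all good triangulations `K`
of `P^n`. -/
abbrev ACLim (n p : ℕ) : Type :=
  Module.DirectLimit (fun K : GoodTriangulation n => K.AC p) (subdivisionAC p)

open scoped Classical in
/-- The class in `AC_p(P^n, D^n; ℚ)` of an element of `AC_p(K, D^n; ℚ)`. -/
def ACLim.of {n : ℕ} (K : GoodTriangulation n) (p : ℕ) : K.AC p →ₗ[ℚ] ACLim n p :=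
  Module.DirectLimit.of ℚ (GoodTriangulation n) (fun K => K.AC p) (subdivisionAC p) K

open scoped Classical in
/-- The differential `δ` of the complex `AC_•(P^n, D^n; ℚ)`. -/
def ACLim.boundary (n p : ℕ) : ACLim n (p + 1) →ₗ[ℚ] ACLim n p :=
  Module.DirectLimit.map (fun K => K.boundaryAC p) fun K K' _ => by
    ext γ
    exact (relSubdivision_comm K.toTriangulation K'.toTriangulation p γ.1).symm

/-! ### The triangulation `K ∩ H_{i,α}` of `H_{i,α} = P^{n-1}` -/

theorem IsSemialgebraic.preimage {σ τ : Type} {A : Set (σ → ℝ)} (hA : IsSemialgebraic A)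
    (g : σ → MvPolynomial τ ℝ) :
    IsSemialgebraic {x : τ → ℝ | (fun a => MvPolynomial.eval x (g a)) ∈ A} := by
  induction hA with
  | pos f =>
    have h : ∀ x : τ → ℝ, MvPolynomial.eval x (MvPolynomial.bind₁ g f) =
        MvPolynomial.eval (fun a => MvPolynomial.eval x (g a)) f := by
      intro x
      simp only [MvPolynomial.eval, MvPolynomial.eval₂Hom_bind₁]
    convert IsSemialgebraic.pos (MvPolynomial.bind₁ g f) using 1
    ext x
    simp [h]
  | union _ _ h1 h2 => exact h1.union h2
  | inter _ _ h1 h2 => exact h1.inter h2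
  | compl _ h => exact h.compl

theorem eq_pole_of_sphere_eq {x : OnePoint ℂ} {α : Pole} (h : sphere x = sphere α.pt) :
    x = α.pt := by
  have h2 := congrFun h 2
  induction x using OnePoint.rec with
  | infty =>
    cases α with
    | zero =>
      simp only [sphere, Pole.pt, OnePoint.elim_some, OnePoint.elim_infty, Matrix.cons_val,
        norm_zero] at h2
      norm_num at h2
    | infty => rfl
  | coe z =>
    have hz : (0 : ℝ) < ‖z‖ ^ 2 + 1 := by positivity
    cases α with
    | zero =>
      simp only [sphere, Pole.pt, OnePoint.elim_some, Matrix.cons_val, norm_zero] at h2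
      rw [div_eq_iff hz.ne'] at h2
      have h3 : ‖z‖ ^ 2 = 0 := by norm_num at h2; linarith
      have h4 : z = 0 := by simpa using h3
      rw [h4]; rfl
    | infty =>
      simp only [sphere, Pole.pt, OnePoint.elim_some, OnePoint.elim_infty, Matrix.cons_val] at h2
      rw [div_eq_iff hz.ne'] at h2
      linarith

theorem IsRegularSubmanifold.of_section {E F : Type} [NormedAddCommGroup E] [NormedSpace ℝ E]
    [NormedAddCommGroup F] [NormedSpace ℝ F] (s : F → E) (π : E →L[ℝ] F)
    (hs : ContDiff ℝ 1 s) (hπ : ∀ x, π (s x) = x) {d : ℕ} {S : Set F}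
    (h : IsRegularSubmanifold d (s '' S)) : IsRegularSubmanifold d S := by
  intro p hp
  obtain ⟨U, V, φ, hU, hpU, hV, hφ, himm, himg, hemb⟩ := h (s p) ⟨p, hp, rfl⟩
  have hsec : ∀ x ∈ V, s (π (φ x)) = φ x := by
    intro x hx
    obtain ⟨⟨y, -, hy⟩, -⟩ : φ x ∈ s '' S ∩ U := himg ▸ ⟨x, hx, rfl⟩
    rw [← hy, hπ]
  refine ⟨s ⁻¹' U, V, π ∘ φ, hU.preimage hs.continuous, hpU, hV, π.contDiff.comp_contDiffOn hφ,
    ?_, ?_, ?_⟩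
  · intro x hx
    have hd : DifferentiableAt ℝ φ x :=
      (hφ.contDiffAt (hV.mem_nhds hx)).differentiableAt (by simp)
    have hd' : DifferentiableAt ℝ (π ∘ φ) x := π.differentiableAt.comp x hd
    have h1 : fderiv ℝ φ x = (fderiv ℝ s (π (φ x))).comp (fderiv ℝ (π ∘ φ) x) := by
      have h2 : φ =ᶠ[𝓝 x] s ∘ (π ∘ φ) :=
        Filter.eventuallyEq_of_mem (hV.mem_nhds hx) fun y hy => (hsec y hy).symm
      rw [h2.fderiv_eq]
      exact fderiv_comp x (hs.differentiable (by simp) _) hd'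
    have h3 := himm x hx
    rw [h1] at h3
    exact Function.Injective.of_comp (f := fderiv ℝ s (π (φ x))) h3
  · ext y
    constructor
    · rintro ⟨x, hx, rfl⟩
      obtain ⟨⟨z, hz, hzx⟩, hxU⟩ : φ x ∈ s '' S ∩ U := himg ▸ ⟨x, hx, rfl⟩
      refine ⟨?_, ?_⟩
      · rw [Function.comp_apply, ← hzx, hπ]; exact hz
      · rw [mem_preimage, Function.comp_apply, hsec x hx]; exact hxU
    · rintro ⟨hyS, hyU⟩
      obtain ⟨x, hx, hxy⟩ : s y ∈ φ '' V := himg ▸ ⟨⟨y, hyS, rfl⟩, hyU⟩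
      exact ⟨x, hx, by rw [Function.comp_apply, hxy, hπ]⟩
  · have hc : Continuous (V.domRestrict (π ∘ φ)) :=
      continuousOn_iff_continuous_domRestrict.1 (π.continuous.comp_continuousOn hφ.continuousOn)
    refine IsEmbedding.of_comp hc hs.continuous ?_
    convert hemb using 1
    ext x : 1
    exact hsec x.1 x.2

/-- The inclusion `P^{n-1} = H_{i,α} ⊆ P^n`. -/
def incl {n : ℕ} (i : Fin (n + 1)) (α : Pole) (p : PP n) : PP (n + 1) :=
  i.insertNth α.pt p

namespace GoodTriangulation

variable {n : ℕ} (K : GoodTriangulation (n + 1)) (i : Fin (n + 1)) (α : Pole)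

theorem incl_mem (p : PP n) : incl i α p ∈ divH i α := by simp [incl, divH]

theorem incl_removeNth {p : PP (n + 1)} (hp : p ∈ divH i α) : incl i α (i.removeNth p) = p := by
  have : α.pt = p i := hp.symm
  rw [incl, this, Fin.insertNth_self_removeNth]

theorem continuous_incl : Continuous (incl i α : PP n → PP (n + 1)) := by
  unfold incl
  fun_prop

theorem divH_eq : divH i α = cubicalFace (fun j => if j = i then some α else none) := by
  ext p
  simp only [divH, cubicalFace, mem_ofPred_eq]
  constructor
  · intro h j β hβ
    split_ifs at hβ with hj
    · simp only [Option.mem_def, Option.some.injEq] at hβ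
      subst hj hβ
      exact h
    · simp at hβ
  · intro h
    exact h i α (by simp)

theorem divH_full : K.toTriangulation.IsFullSubcomplex (divH i α) := by
  rw [divH_eq]
  simpa using K.full {fun j => if j = i then some α else none}

theorem homeo_mem {y : K.E} (hy : y ∈ (K.restrict (divH i α)).space) :
    ∃ h : y ∈ K.complex.space, K.homeo ⟨y, h⟩ ∈ divH i α := by
  obtain ⟨s, hs, hys⟩ := Geometry.SimplicialComplex.mem_space_iff.1 hy
  have h := K.complex.convexHull_subset_space hs.1 hys
  exact ⟨h, hs.2 ⟨⟨y, h⟩, hys, rfl⟩⟩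

theorem symm_mem {q : PP (n + 1)} (hq : q ∈ divH i α) :
    (K.homeo.symm q).1 ∈ (K.restrict (divH i α)).space := by
  obtain ⟨s, hs, ⟨y, hy, rfl⟩, hsH⟩ := (K.divH_full i α).1 q hq
  rw [Homeomorph.symm_apply_apply]
  exact Geometry.SimplicialComplex.mem_space_iff.2 ⟨s, ⟨hs, hsH⟩, hy⟩

/-- The restriction of `|K| → P^n` to a homeomorphism `|K ∩ H_{i,α}| → H_{i,α} = P^{n-1}`. -/
def faceHomeo : (K.restrict (divH i α)).space ≃ₜ PP n where
  toFun y := i.removeNth (K.homeo ⟨y.1, (K.homeo_mem i α y.2).1⟩)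
  invFun p := ⟨(K.homeo.symm (incl i α p)).1, K.symm_mem i α (incl_mem i α p)⟩
  left_inv y := by
    obtain ⟨h, hy⟩ := K.homeo_mem i α y.2
    ext1
    simp only [incl_removeNth i α hy, Homeomorph.symm_apply_apply]
  right_inv p := by
    simp [incl]
  continuous_toFun := by
    have h1 : Continuous fun y : (K.restrict (divH i α)).space =>
        K.homeo ⟨y.1, (K.homeo_mem i α y.2).1⟩ :=
      K.homeo.continuous.comp (continuous_subtype_val.subtype_mk _)
    exact continuous_pi fun j => (continuous_apply (i.succAbove j)).comp h1
  continuous_invFun :=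
    (continuous_subtype_val.comp (K.homeo.symm.continuous.comp (continuous_incl i α))).subtype_mk _

theorem incl_faceHomeo (y : (K.restrict (divH i α)).space) :
    incl i α (K.faceHomeo i α y) = K.homeo ⟨y.1, (K.homeo_mem i α y.2).1⟩ :=
  incl_removeNth i α (K.homeo_mem i α y.2).2

theorem embed_incl (p : PP n) : embed (incl i α p) = fun a : Fin (n + 1) × Fin 3 =>
    i.insertNth (α := fun _ => ℝ) (sphere α.pt a.2) (fun j => embed p (j, a.2)) a.1 := by
  ext ⟨j, b⟩
  simp only [embed, incl]
  refine Fin.succAboveCases i ?_ (fun j => ?_) j <;> simp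

/-- The triangulation `K ∩ H_{i,α}` of `P^{n-1} = H_{i,α}`. -/
def faceTriangulation : Triangulation n where
  m := K.m
  complex := K.restrict (divH i α)
  finite := K.finite.subset fun _ h => h.1
  homeo := K.faceHomeo i α
  semialgebraic := by
    let g : Fin K.m ⊕ (Fin (n + 1) × Fin 3) → MvPolynomial (Fin K.m ⊕ (Fin n × Fin 3)) ℝ :=
      Sum.elim (fun a => MvPolynomial.X (Sum.inl a)) fun a =>
        i.insertNth (α := fun _ => MvPolynomial (Fin K.m ⊕ (Fin n × Fin 3)) ℝ)
          (MvPolynomial.C (sphere α.pt a.2)) (fun j => MvPolynomial.X (Sum.inr (j, a.2))) a.1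
    convert K.semialgebraic.preimage g using 1
    ext x
    have hl : (fun a => MvPolynomial.eval x (g a)) ∘ Sum.inl = x ∘ Sum.inl := by
      ext a; simp [g]
    have hr : ∀ p : PP n, (fun a => MvPolynomial.eval x (g a)) ∘ Sum.inr = embed (incl i α p) ↔
        x ∘ Sum.inr = embed p := by
      intro p
      rw [embed_incl]
      constructor
      · intro h
        ext ⟨j, b⟩
        simpa [g] using congrFun h (i.succAbove j, b)
      · intro h
        ext ⟨j, b⟩
        refine Fin.succAboveCases i ?_ (fun j => ?_) j
        · simp [g]
        · simpa [g] using congrFun h (j, b)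
    simp only [mem_ofPred_eq, hl]
    constructor
    · rintro ⟨y, h1, h2⟩
      refine ⟨⟨y.1, (K.homeo_mem i α y.2).1⟩, h1, ?_⟩
      rw [← incl_faceHomeo]
      exact (hr _).2 h2
    · rintro ⟨y, h1, h2⟩
      have hy : K.homeo y ∈ divH i α := by
        refine eq_pole_of_sphere_eq ?_
        ext b
        simpa [g, embed] using (congrFun h2 (i, b)).symm
      have hy' := K.symm_mem i α hy
      rw [Homeomorph.symm_apply_apply] at hy'
      refine ⟨⟨y.1, hy'⟩, h1, ?_⟩
      rw [← hr, incl_faceHomeo]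
      exact h2

theorem mem_faceTriangulation_img {A : Set K.E} {p : PP n} :
    p ∈ (K.faceTriangulation i α).img A ↔ incl i α p ∈ K.img A := by
  constructor
  · rintro ⟨y, hy, rfl⟩
    exact ⟨⟨y.1, (K.homeo_mem i α y.2).1⟩, hy, (K.incl_faceHomeo i α y).symm⟩
  · rintro ⟨y, hy, h⟩
    have hy' := K.symm_mem i α (incl_mem i α p)
    rw [← h, Homeomorph.symm_apply_apply] at hy'
    refine ⟨⟨y.1, hy'⟩, hy, ?_⟩
    have h2 := K.incl_faceHomeo i α ⟨y.1, hy'⟩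
    change K.faceHomeo i α ⟨y.1, hy'⟩ = p
    have h3 : incl i α (K.faceHomeo i α ⟨y.1, hy'⟩) = incl i α p := h2.trans h
    simpa [incl] using congrArg i.removeNth h3

theorem incl_image_img {A : Set K.E} (hA : K.img A ⊆ divH i α) :
    incl i α '' (K.faceTriangulation i α).img A = K.img A := by
  ext q
  constructor
  · rintro ⟨p, hp, rfl⟩
    exact (K.mem_faceTriangulation_img i α).1 hp
  · intro hq
    have h := incl_removeNth i α (hA hq)
    exact ⟨i.removeNth q, (K.mem_faceTriangulation_img i α).2 (h.symm ▸ hq), h⟩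

/-- A subset of `H_{i,α} = P^{n-1}` is a subcomplex of `K ∩ H_{i,α}` if it is the intersection of
`H_{i,α}` with a subcomplex of `K`. -/
theorem isSubcomplex_face {S : Set (PP n)} {T : Set (PP (n + 1))}
    (hT : K.toTriangulation.IsSubcomplex T) (h : ∀ p, p ∈ S ↔ incl i α p ∈ T) :
    (K.faceTriangulation i α).IsSubcomplex S := by
  intro p hp
  obtain ⟨t, ht, hpt⟩ := K.exists_mem_img (incl i α p)
  have h1 := hT.simplexImg_subset ht hpt ((h p).1 hp)
  have h2 := (K.divH_full i α).1.simplexImg_subset ht hpt (incl_mem i α p)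
  refine ⟨t, ⟨ht, h2⟩, (K.mem_faceTriangulation_img i α).2 (K.img_relInterior_subset t hpt), ?_⟩
  intro q hq
  exact (h q).2 (h1 ((K.mem_faceTriangulation_img i α).1 hq))

theorem incl_mem_divD (p : PP n) : p ∈ divD n ↔ incl i α p ∈ divD (n + 1) := by
  constructor
  · rintro ⟨j, hj⟩
    exact ⟨i.succAbove j, by simpa [incl] using hj⟩
  · rintro ⟨j, hj⟩
    revert hj
    refine Fin.succAboveCases i ?_ (fun j => ?_) j
    · intro h
      exfalso
      cases α <;> simp [incl, Pole.pt] at h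
    · intro h
      exact ⟨j, by simpa [incl] using h⟩

theorem incl_mem_cubicalFace (J : Fin n → Option Pole) (p : PP n) :
    p ∈ cubicalFace J ↔ incl i α p ∈ cubicalFace (i.insertNth (some α) J) := by
  constructor
  · intro h j β hβ
    revert hβ
    refine Fin.succAboveCases i ?_ (fun j => ?_) j
    · intro hβ
      have : α = β := by simpa using hβ
      subst this
      simp [incl]
    · intro hβ
      simpa [incl] using h j β (by simpa using hβ)
  · intro h j β hβ
    simpa [incl] using h (i.succAbove j) β (by simpa using hβ)

/-- The good triangulation `K ∩ H_{i,α}` of `P^{n-1} = H_{i,α}`. -/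
def face : GoodTriangulation n where
  toTriangulation := K.faceTriangulation i α
  divisor := K.isSubcomplex_face i α K.divisor (incl_mem_divD i α)
  facewise s hs := by
    let sec : (Fin n × Fin 3 → ℝ) → (Fin (n + 1) × Fin 3 → ℝ) := fun y a =>
      i.insertNth (α := fun _ => ℝ) (sphere α.pt a.2) (fun j => y (j, a.2)) a.1
    let π : (Fin (n + 1) × Fin 3 → ℝ) →L[ℝ] (Fin n × Fin 3 → ℝ) :=
      ContinuousLinearMap.pi fun a => ContinuousLinearMap.proj (i.succAbove a.1, a.2)
    have hsec : ContDiff ℝ 1 sec := by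
      rw [contDiff_pi]
      rintro ⟨j, b⟩
      refine Fin.succAboveCases i ?_ (fun j => ?_) j
      · simpa [sec] using contDiff_const
      · simpa [sec] using contDiff_apply ℝ ℝ (j, b)
    refine IsRegularSubmanifold.of_section sec π hsec (fun y => by ext ⟨j, b⟩; simp [sec, π]) ?_
    have h1 : sec '' (embed '' (K.faceTriangulation i α).img (relInterior s)) =
        embed '' K.img (relInterior s) := by
      rw [← K.incl_image_img i α ((K.img_relInterior_subset s).trans hs.2), image_image,
        image_image]
      exact image_congr fun p _ => (embed_incl i α p).symm
    rw [h1]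
    exact K.facewise s hs.1
  full 𝒥 := by
    let 𝒥' : Set (Fin (n + 1) → Option Pole) := (fun J => i.insertNth (some α) J) '' 𝒥
    have h𝒥 : ∀ p, p ∈ ⋃ J ∈ 𝒥, cubicalFace J ↔ incl i α p ∈ ⋃ J ∈ 𝒥', cubicalFace J := by
      intro p
      simp only [𝒥', mem_iUnion, exists_prop, exists_mem_image, incl_mem_cubicalFace i α]
    refine ⟨K.isSubcomplex_face i α (K.full 𝒥').1 h𝒥, fun s hs hv => ?_⟩
    intro p hp
    rw [h𝒥]
    refine (K.full 𝒥').2 s hs.1 (fun v hvs => ?_) ((K.mem_faceTriangulation_img i α).1 hp)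
    have h1 : K.simplexImg {v} ⊆ divH i α :=
      (K.simplexImg_mono (Finset.singleton_subset_iff.2 hvs)).trans hs.2
    rw [Triangulation.simplexImg, ← K.incl_image_img i α h1]
    rintro _ ⟨q, hq, rfl⟩
    exact (h𝒥 q).1 (hv v hvs hq)
  disc j := by
    refine K.isSubcomplex_face i α (K.disc (i.succAbove j)) fun p => ?_
    simp [incl]

end GoodTriangulation

/-! ### Thom cocycles -/

/-- Singular `p`-simplices of `X`. -/
abbrev SingularSimplex (X : Type) [TopologicalSpace X] (p : ℕ) : Type :=
  C(stdSimplex ℝ (Fin (p + 1)), X)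

/-- The `j`-th face of a singular simplex. -/
def SingularSimplex.face {X : Type} [TopologicalSpace X] {p : ℕ} (σ : SingularSimplex X (p + 1))
    (j : Fin (p + 2)) : SingularSimplex X p :=
  σ.comp ⟨stdSimplex.map j.succAbove, stdSimplex.continuous_map _⟩

/-- The coboundary of a singular cochain with coefficients in `ℚ`. -/
def singularCoboundary {X : Type} [TopologicalSpace X] {p : ℕ} (u : SingularSimplex X p → ℚ) :
    SingularSimplex X (p + 1) → ℚ :=
  fun σ => ∑ j : Fin (p + 2), (-1) ^ (j : ℕ) * u (SingularSimplex.face σ j)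

/-- A singular `1`-simplex as a path parametrized by `[0, 1]` (constant outside `[0, 1]`). -/
def SingularSimplex.path {X : Type} [TopologicalSpace X] (σ : SingularSimplex X 1) (t : ℝ) : X :=
  σ (stdSimplexHomeomorphUnitInterval.symm (projIcc 0 1 zero_le_one t))

/-- The local coordinate of `ℙ¹` at a pole: `z` at `0`, `1 / z` at `∞`. (It is only used on the
disc where it has absolute value less than `1`.) -/
def localCoord (α : Pole) (x : OnePoint ℂ) : ℂ :=
  x.elim 0 fun z => match α with
    | .zero => z
    | .infty => z⁻¹

/-- The tubular neighbourhood `Δ` of `H_{i,α}`: `{|z_i| < 1}` if `α = 0`, `{|1 / z_i| < 1}` if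
`α = ∞`. -/
def tube {n : ℕ} (i : Fin n) : Pole → Set (PP n)
  | .zero => {p | ∃ z : ℂ, p i = (z : OnePoint ℂ) ∧ ‖z‖ < 1}
  | .infty => {p | p i = OnePoint.infty ∨ ∃ z : ℂ, p i = (z : OnePoint ℂ) ∧ 1 < ‖z‖}

/-- The integral of `(2πi)⁻¹ dζ / ζ` over a path, where `ζ` is the local coordinate at `H_{i,α}`. -/
def dlogIntegral {n : ℕ} (i : Fin n) (α : Pole) (σ : SingularSimplex (PP n) 1) : ℂ :=
  (2 * Real.pi * Complex.I)⁻¹ * ∫ t in (0 : ℝ)..1,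
    deriv (fun s => localCoord α (σ.path s i)) t / localCoord α (σ.path t i)

/-- The singular `1`-simplex `σ` of `P^n` is smooth. -/
def IsSmooth {n : ℕ} (σ : SingularSimplex (PP n) 1) : Prop :=
  ContDiffOn ℝ ∞ (fun t => embed (σ.path t)) (Icc 0 1)

/-- On `Δ - H_{i,α}` the rational singular `1`-cochain `b` represents the de Rham class
`[dζ / (2πi ζ)]`: on smooth singular simplices of `Δ - H_{i,α}` it differs from integration of
`dζ / (2πi ζ)` by the coboundary of a complex `0`-cochain. -/
def RepresentsDlog {n : ℕ} (i : Fin n) (α : Pole) (b : SingularSimplex (PP n) 1 → ℚ) : Prop :=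
  ∃ f : PP n → ℂ, ∀ σ : SingularSimplex (PP n) 1, range σ ⊆ tube i α \ divH i α → IsSmooth σ →
    (b σ : ℂ) - dlogIntegral i α σ = f (σ.path 1) - f (σ.path 0)

/-- `u` is a relative singular cocycle of `(P^n, P^n - H_{i,α})` whose restriction to
`(Δ, Δ - H_{i,α})` represents the image of `[dζ / (2πi ζ)]` under the connecting homomorphism
`H^1(Δ - H_{i,α}; ℚ) → H^2(Δ, Δ - H_{i,α}; ℚ)`. -/
structure RepresentsThomClass {n : ℕ} (i : Fin n) (α : Pole)
    (u : SingularSimplex (PP n) 2 → ℚ) : Prop where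
  relative : ∀ σ : SingularSimplex (PP n) 2, range σ ⊆ (divH i α)ᶜ → u σ = 0
  cocycle : ∀ σ : SingularSimplex (PP n) 3, singularCoboundary u σ = 0
  restriction : ∃ b : SingularSimplex (PP n) 1 → ℚ, RepresentsDlog i α b ∧
    ∀ σ : SingularSimplex (PP n) 2, range σ ⊆ tube i α → u σ = singularCoboundary b σ

/-- The coboundary of a simplicial cochain. -/
def coboundary {E : Type} {p : ℕ} (u : (Fin (p + 1) → E) → ℚ) : (Fin (p + 2) → E) → ℚ :=
  fun v => ∑ j : Fin (p + 2), (-1) ^ (j : ℕ) * u (v ∘ j.succAbove)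

/-- An ordering of a simplicial complex: a partial ordering of its vertices that is total on the
vertices of every simplex. -/
structure VertexOrder {E : Type} [AddCommGroup E] [Module ℝ E]
    (C : Geometry.SimplicialComplex ℝ E) : Type where
  /-- the order relation -/
  le : E → E → Prop
  refl : ∀ v ∈ C.vertices, le v v
  antisymm : ∀ v ∈ C.vertices, ∀ w ∈ C.vertices, le v w → le w v → v = w
  trans : ∀ u ∈ C.vertices, ∀ v ∈ C.vertices, ∀ w ∈ C.vertices, le u v → le v w → le u w
  total : ∀ s ∈ C.faces, ∀ v ∈ s, ∀ w ∈ s, le v w ∨ le w v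

/-- `v_0 < v_1 < … < v_p`. -/
def VertexOrder.Increasing {E : Type} [AddCommGroup E] [Module ℝ E]
    {C : Geometry.SimplicialComplex ℝ E} (O : VertexOrder C) {p : ℕ} (v : Fin (p + 1) → E) : Prop :=
  ∀ a b, a < b → O.le (v a) (v b) ∧ v a ≠ v b

namespace Triangulation

variable {n : ℕ} (K : Triangulation n)

/-- The singular simplex of `P^n` defined by an ordered simplex `(v_0, …, v_p)` of `K`. -/
def singular {p : ℕ} (v : Fin (p + 1) → K.E) (hv : IsSimplex K.complex v) :
    SingularSimplex (PP n) p where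
  toFun t := K.homeo ⟨∑ j, t j • v j, K.complex.convexHull_subset_space hv.2
    (mem_convexHull_of_exists_fintype _ v t.2.1 t.2.2
      (fun j => Finset.mem_coe.2 (mem_verts.2 ⟨j, rfl⟩)) rfl)⟩
  continuous_toFun := by
    refine K.homeo.continuous.comp (Continuous.subtype_mk ?_ _)
    exact continuous_finsetSum _ fun j _ =>
      ((continuous_apply j).comp continuous_subtype_val).smul continuous_const

/-- `C^p(K, W; ℚ)`, where `W` is the union of the simplices of `K` that do not meet `H_{i,α}`: the
alternating functions on the ordered `p`-simplices of `K` that vanish on the simplices in `W`. (They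
are extended by zero to tuples that are not ordered simplices.) -/
def relCochains (i : Fin n) (α : Pole) (p : ℕ) : Submodule ℚ ((Fin (p + 1) → K.E) → ℚ) where
  carrier := {u | (∀ v (π : Equiv.Perm (Fin (p + 1))),
    u (v ∘ π) = (Equiv.Perm.sign π : ℤ) * u v) ∧
      ∀ v, u v ≠ 0 → IsSimplex K.complex v ∧ (K.simplexImg (verts v) ∩ divH i α).Nonempty}
  zero_mem' := by simp
  add_mem' := by
    rintro a b ⟨ha, ha'⟩ ⟨hb, hb'⟩
    refine ⟨fun v π => by simp [ha, hb, mul_add], fun v hv => ?_⟩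
    by_cases h : a v = 0
    · exact hb' v fun h' => hv (by simp [h, h'])
    · exact ha' v h
  smul_mem' := by
    rintro r a ⟨ha, ha'⟩
    refine ⟨fun v π => ?_, fun v hv => ha' v fun h => hv (by simp [h])⟩
    simp only [Pi.smul_apply, ha, smul_eq_mul]
    ring

/-- `T ∈ C^2(K, W; ℚ)` is a Thom cocycle of `H_{i,α}`: it is a cocycle, and its class in
`H^2(K, W; ℚ)` is the image of a class in `H^2(P^n, P^n - H_{i,α}; ℚ)` (singular cohomology) whose
restriction to `(Δ, Δ - H_{i,α})` is the image of `[dζ / (2πi ζ)]` under the connecting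
homomorphism. Singular and simplicial cochains are compared, as usual, by means of an ordering of
`K`. -/
structure IsThomCocycle (i : Fin n) (α : Pole) (T : (Fin 3 → K.E) → ℚ) : Prop where
  mem : T ∈ K.relCochains i α 2
  cocycle : ∀ v : Fin 4 → K.E, IsSimplex K.complex v → coboundary T v = 0
  thomClass : ∃ u, RepresentsThomClass i α u ∧ ∃ (O : VertexOrder K.complex),
    ∃ w ∈ K.relCochains i α 1, ∀ (v : Fin 3 → K.E) (hv : IsSimplex K.complex v),
      O.Increasing v → T v = u (K.singular v hv) + coboundary w v

/-- The Thom cocycles of `H_{i,α}` in `C^2(K, W; ℚ)`. -/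
def ThomCocycle (i : Fin n) (α : Pole) : Type := {T : (Fin 3 → K.E) → ℚ // K.IsThomCocycle i α T}

/-- An ordering of `K` is good with respect to `H_{i,α}` if `v ∈ H_{i,α}` and `v ≤ w` imply
`w ∈ H_{i,α}`, for vertices `v`, `w`. -/
structure GoodOrder (i : Fin n) (α : Pole) : Type extends VertexOrder K.complex where
  good : ∀ v ∈ K.complex.vertices, ∀ w ∈ K.complex.vertices,
    K.simplexImg {v} ⊆ divH i α → le v w → K.simplexImg {w} ⊆ divH i α

end Triangulation

/-! ### The cap product with a Thom cocycle -/

section cap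

variable {n : ℕ} (K : GoodTriangulation (n + 1)) {i : Fin (n + 1)} {α : Pole}

open scoped Classical in
/-- The cap product on chains: `[v_0, …, v_{k+2}] ↦ T([v_0, v_1, v_2]) [v_2, …, v_{k+2}]` if
`v_0 < … < v_{k+2}`. -/
def capAux (T : K.ThomCocycle i α) (O : K.GoodOrder i α) (k : ℕ) :
    ((Fin (k + 3) → K.E) →₀ ℚ) →ₗ[ℚ] ((Fin (k + 1) → K.E) →₀ ℚ) :=
  Finsupp.linearCombination ℚ fun v =>
    if O.Increasing v then
      T.1 (fun j : Fin 3 => v (j.castLE (by omega))) • oriented fun j : Fin (k + 1) => v j.succ.succ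
    else 0

variable {K}

theorem isSimplex_back (T : K.ThomCocycle i α) (O : K.GoodOrder i α) {k : ℕ}
    {v : Fin (k + 3) → K.E} (hv : IsSimplex K.complex v) (hO : O.Increasing v)
    (hT : T.1 (fun j : Fin 3 => v (j.castLE (by omega))) ≠ 0) :
    IsSimplex (K.restrict (divH i α)) fun j : Fin (k + 1) => v j.succ.succ := by
  obtain ⟨hf, q, hq, hqH⟩ := T.2.mem.2 _ hT
  obtain ⟨t, ht, ⟨x, hx⟩, hqt⟩ := K.exists_mem_img_relInterior hq
  have htf := K.complex.down_closed hf.2 ht ⟨x, hx⟩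
  have htH := (K.divH_full i α).1.simplexImg_subset htf hqt hqH
  obtain ⟨a, rfl⟩ := mem_verts.1 (ht hx)
  have hvert : ∀ b, v b ∈ K.complex.vertices := fun b =>
    K.complex.down_closed hv.2 (Finset.singleton_subset_iff.2 (mem_verts.2 ⟨b, rfl⟩))
      (Finset.singleton_nonempty _)
  have hb : IsSimplex K.complex fun j : Fin (k + 1) => v j.succ.succ :=
    hv.comp ((Fin.succ_injective _).comp (Fin.succ_injective _))
  refine ⟨hb.1, hb.2, (K.divH_full i α).2 _ hb.2 fun w hw => ?_⟩
  obtain ⟨j, rfl⟩ := mem_verts.1 hw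
  have haH := (K.simplexImg_mono (Finset.singleton_subset_iff.2 hx)).trans htH
  have hle : a.castLE (by omega) ≤ j.succ.succ := by
    rw [Fin.le_def]
    simp only [Fin.val_castLE, Fin.val_succ]
    omega
  rcases hle.lt_or_eq with hlt | heq
  · exact O.good _ (hvert _) _ (hvert _) haH (hO _ _ hlt).1
  · rw [← heq]
    exact haH

theorem capAux_mem (T : K.ThomCocycle i α) (O : K.GoodOrder i α) (k : ℕ)
    (c : (Fin (k + 3) → K.E) →₀ ℚ) (hc : c ∈ chains K.complex (k + 2)) :
    capAux K T O k c ∈ chains (K.face i α).complex k := by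
  classical
  rw [capAux, Finsupp.linearCombination_apply]
  refine Submodule.sum_mem _ fun v hv => Submodule.smul_mem _ _ ?_
  split_ifs with hO
  · by_cases hT : T.1 (fun j : Fin 3 => v (j.castLE (by omega))) = 0
    · rw [hT, zero_smul]
      exact Submodule.zero_mem _
    · exact Submodule.smul_mem _ _ (oriented_mem
        (isSimplex_back T O (hc.2 v (Finsupp.mem_support_iff.1 hv)) hO hT))
  · exact Submodule.zero_mem _

theorem capAux_mem_divisor (T : K.ThomCocycle i α) (O : K.GoodOrder i α) (k : ℕ)
    (c : (Fin (k + 3) → K.E) →₀ ℚ) (hc : c ∈ chains (K.restrict (divD (n + 1))) (k + 2)) :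
    capAux K T O k c ∈ chains ((K.face i α).restrict (divD n)) k := by
  classical
  rw [capAux, Finsupp.linearCombination_apply]
  refine Submodule.sum_mem _ fun v hv => Submodule.smul_mem _ _ ?_
  split_ifs with hO
  · by_cases hT : T.1 (fun j : Fin 3 => v (j.castLE (by omega))) = 0
    · rw [hT, zero_smul]
      exact Submodule.zero_mem _
    · have hs := hc.2 v (Finsupp.mem_support_iff.1 hv)
      have hb := isSimplex_back T O ⟨hs.1, hs.2.1⟩ hO hT
      refine Submodule.smul_mem _ _ (oriented_mem ⟨hb.1, hb.2, fun p hp => ?_⟩)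
      refine (GoodTriangulation.incl_mem_divD i α p).2 (hs.2.2 ?_)
      refine K.simplexImg_mono ?_ ((K.mem_faceTriangulation_img i α).1 hp)
      intro x hx
      obtain ⟨j, rfl⟩ := mem_verts.1 hx
      exact mem_verts.2 ⟨_, rfl⟩
  · exact Submodule.zero_mem _

/-- The cap product `T ∩ : C_{k+2}(K, D^n; ℚ) → C_k(K ∩ H_{i,α}, D^{n-1}; ℚ)` with respect to a
good ordering. -/
def cap (T : K.ThomCocycle i α) (O : K.GoodOrder i α) (k : ℕ) :
    K.RelChain (k + 2) →ₗ[ℚ] (K.face i α).RelChain k :=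
  Submodule.mapQ _ _ ((capAux K T O k).restrict (capAux_mem T O k)) fun c hc =>
    capAux_mem_divisor T O k c.1 hc

end cap


end CubicalChain

end

open CubicalChain

/-!
The residue of an admissible chain along `H = H_{i,α}` is the cap product with a Thom cocycle, and
the point is that on chains which are admissible together with their boundary this cap product is
determined on the level of chains, although the Thom cocycle and the ordering of the vertices are
only determined up to coboundaries.

Let `K'` be a subdivision of `K`. Both `γ ↦ λ(T ∩ γ)` and `γ ↦ T' ∩ λ(γ)` are chain maps of degree
`-2` that carry a simplex `σ` to the part of the subdivision that lies in `σ ∩ H`. As `H` is a full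
subcomplex, `σ ∩ H` is empty or a face of `σ`, hence acyclic, also after subdivision
(`Triangulation.IsSubdivision.exists_tailBoundary_eq`). The augmentations of the two chain maps are
the cocycles `T` and `λ^* T'`, which differ by the coboundary of a cochain that vanishes on the
simplices not meeting `H` (`exists_coboundary_eq_thomCocycle`). By the method of acyclic carriers
(`exists_carried`), the two chain maps are homotopic by a homotopy `h` with the same carrier, that
is, `λ(T ∩ γ) - T' ∩ λ(γ) = ∂hγ + h∂γ`. If `γ` is a `k`-chain, then `hγ` is a `(k - 1)`-chain in
`γ ∩ H`; but for admissible `γ` the dimension of `γ ∩ H` outside `D^n` is at most `k - 2`, so `hγ`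
is a chain in `D^n`, and so is `h∂γ` (`mem_chains_divD_of_carried`). Thus the two chain maps are equal
modulo `D^n` (`subdivision_cap_sub_cap_subdivision_mem`). For `K' = K` this is the independence of
the Thom cocycle and the ordering, and in general it is the compatibility with subdivisions, by
which the maps pass to the limit (`exists_faceMap`).

The subdivision operator and the acyclicity of subdivided simplices come from a simplicial
approximation of the identity. In a convex set, cycles of tuples of close points bound chains of
tuples of close points, and every chain of tuples has a subdivision consisting of close tuples
(`exists_small_subdivision`). A vertex map `|K| → K'` that sends a point to a vertex of its carrier
carries tuples of close points to simplices of `K'`.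

The comparison of Thom cocycles rests on the shrinking of the coordinate at the pole, by which every
simplex is moved into the tube around `H`, where two representatives of the Thom class differ by the
coboundary of a cochain that is closed outside `H`; as both primitives represent `dζ / (2πi ζ)`, it
has no periods and is the coboundary of a potential (`exists_potential`,
`RepresentsThomClass.exists_coboundary_eq`).

The limit maps are unique only because every good triangulation has a Thom cocycle and a good
ordering. A representative of the Thom class is the Euler cochain of the tautological line bundle on
`ℙ¹`, relative to a section over the complement of the pole: its value on a triangle is the winding
of a lift of the triangle to `ℂ² - {0}` relative to chosen lifts of its edges, which is integral
(`eulerCochain`, `representsThomClass_eulerCochain`, `nonempty_thomCocycle`).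
-/

noncomputable section

namespace CubicalChain

/-! ### Augmented chains on tuples of points -/

section tuples

variable {X Y : Type}

/-- The free vector space on the tuples of length `p` of points of `X`. These are the ordered chains
of dimension `p - 1`; the empty tuple, in length `0`, makes the complex augmented. -/
abbrev TupleChain (X : Type) (p : ℕ) : Type := (Fin p → X) →₀ ℚ

/-- The boundary `(x_0, …, x_p) ↦ ∑ j, (-1)^j (x_0, …, x̂_j, …, x_p)`. -/
def tupleBoundary (X : Type) (p : ℕ) : TupleChain X (p + 1) →ₗ[ℚ] TupleChain X p :=
  Finsupp.linearCombination ℚ fun v =>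
    ∑ j : Fin (p + 1), Finsupp.single (v ∘ j.succAbove) ((-1 : ℚ) ^ (j : ℕ))

/-- The cone `(x_1, …, x_p) ↦ (x, x_1, …, x_p)`. -/
def tupleCone (x : X) (p : ℕ) : TupleChain X p →ₗ[ℚ] TupleChain X (p + 1) :=
  Finsupp.lmapDomain ℚ ℚ fun v => (Fin.cons x v : Fin (p + 1) → X)

/-- The map of tuple chains induced by a map of points. -/
def tupleMap (f : X → Y) (p : ℕ) : TupleChain X p →ₗ[ℚ] TupleChain Y p :=
  Finsupp.lmapDomain ℚ ℚ fun v => f ∘ v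

/-- Antisymmetrization of tuple chains. -/
def tupleAlt (X : Type) (p : ℕ) : TupleChain X p →ₗ[ℚ] TupleChain X p :=
  Finsupp.linearCombination ℚ fun v =>
    ∑ π : Equiv.Perm (Fin p), Finsupp.single (v ∘ π) ((Equiv.Perm.sign π : ℤ) : ℚ)

/-- The boundary of antisymmetric chains: deletion of the first point. -/
def tailBoundary (X : Type) (p : ℕ) : TupleChain X (p + 1) →ₗ[ℚ] TupleChain X p :=
  Finsupp.lmapDomain ℚ ℚ Fin.tail

theorem tupleBoundary_single (p : ℕ) (v : Fin (p + 1) → X) :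
    tupleBoundary X p (Finsupp.single v 1) =
      ∑ j : Fin (p + 1), Finsupp.single (v ∘ j.succAbove) ((-1 : ℚ) ^ (j : ℕ)) := by
  simp [tupleBoundary]

theorem tupleCone_single (x : X) (p : ℕ) (v : Fin p → X) :
    tupleCone x p (Finsupp.single v 1) = Finsupp.single (Fin.cons x v : Fin (p + 1) → X) 1 := by
  simp [tupleCone]

theorem tupleMap_single (f : X → Y) (p : ℕ) (v : Fin p → X) :
    tupleMap f p (Finsupp.single v 1) = Finsupp.single (f ∘ v) 1 := by
  simp [tupleMap]

theorem tupleAlt_single (p : ℕ) (v : Fin p → X) :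
    tupleAlt X p (Finsupp.single v 1) =
      ∑ π : Equiv.Perm (Fin p), Finsupp.single (v ∘ π) ((Equiv.Perm.sign π : ℤ) : ℚ) := by
  simp [tupleAlt]

theorem tupleAlt_single_eq_oriented (p : ℕ) (v : Fin (p + 1) → X) :
    tupleAlt X (p + 1) (Finsupp.single v 1) = oriented v :=
  tupleAlt_single _ v

/-- Two linear maps out of a space of tuple chains agree if they agree on tuples. -/
theorem tupleChain_hom_ext {M : Type} [AddCommGroup M] [Module ℚ M] {p : ℕ}
    {f g : TupleChain X p →ₗ[ℚ] M}
    (h : ∀ v, f (Finsupp.single v 1) = g (Finsupp.single v 1)) : f = g := by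
  refine Finsupp.lhom_ext' fun v => LinearMap.ext_ring ?_
  simpa using h v

theorem tupleBoundary_tupleCone (x : X) (p : ℕ) (z : TupleChain X (p + 1)) :
    tupleBoundary X (p + 1) (tupleCone x (p + 1) z) = z - tupleCone x p (tupleBoundary X p z) := by
  suffices h : tupleBoundary X (p + 1) ∘ₗ tupleCone x (p + 1) =
      LinearMap.id - tupleCone x p ∘ₗ tupleBoundary X p from LinearMap.congr_fun h z
  refine tupleChain_hom_ext fun v => ?_
  simp only [LinearMap.comp_apply, LinearMap.sub_apply, LinearMap.id_apply, tupleCone_single,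
    tupleBoundary_single, map_sum]
  rw [Fin.sum_univ_succ, sub_eq_add_neg, ← Finset.sum_neg_distrib]
  refine congrArg₂ _ ?_ ?_
  · simp [Function.comp_def]
  · refine Finset.sum_congr rfl fun j _ => ?_
    have h1 : (Fin.cons x v : Fin (p + 2) → X) ∘ (j.succ).succAbove =
        (Fin.cons x (v ∘ j.succAbove) : Fin (p + 1) → X) := by
      ext k
      refine Fin.cases ?_ (fun k => ?_) k <;> simp
    rw [h1, tupleCone, Finsupp.lmapDomain_apply, Finsupp.mapDomain_single, ← Finsupp.single_neg]
    congr 1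
    simp [pow_succ]

theorem tupleBoundary_tupleCone_zero (x : X) (z : TupleChain X 0) :
    tupleBoundary X 0 (tupleCone x 0 z) = z := by
  suffices h : tupleBoundary X 0 ∘ₗ tupleCone x 0 = LinearMap.id from LinearMap.congr_fun h z
  refine tupleChain_hom_ext fun v => ?_
  simp only [LinearMap.comp_apply, LinearMap.id_apply, tupleCone_single, tupleBoundary_single]
  simp [Subsingleton.elim _ v]

theorem single_eq_tupleCone (p : ℕ) (v : Fin (p + 1) → X) :
    Finsupp.single v (1 : ℚ) = tupleCone (v 0) p (Finsupp.single (Fin.tail v) 1) := by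
  rw [tupleCone_single, Fin.cons_self_tail]

theorem tupleBoundary_tupleBoundary (p : ℕ) (z : TupleChain X (p + 2)) :
    tupleBoundary X p (tupleBoundary X (p + 1) z) = 0 := by
  induction p with
  | zero =>
    suffices h : tupleBoundary X 0 ∘ₗ tupleBoundary X 1 = 0 from LinearMap.congr_fun h z
    refine tupleChain_hom_ext fun v => ?_
    rw [single_eq_tupleCone, LinearMap.comp_apply, tupleBoundary_tupleCone, map_sub,
      tupleBoundary_tupleCone_zero, sub_self, LinearMap.zero_apply]
  | succ p ih =>
    suffices h : tupleBoundary X (p + 1) ∘ₗ tupleBoundary X (p + 2) = 0 from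
      LinearMap.congr_fun h z
    refine tupleChain_hom_ext fun v => ?_
    rw [single_eq_tupleCone, LinearMap.comp_apply, tupleBoundary_tupleCone, map_sub,
      tupleBoundary_tupleCone, ih, map_zero, sub_zero, sub_self, LinearMap.zero_apply]

theorem tupleBoundary_tupleMap (f : X → Y) (p : ℕ) (z : TupleChain X (p + 1)) :
    tupleBoundary Y p (tupleMap f (p + 1) z) = tupleMap f p (tupleBoundary X p z) := by
  suffices h : tupleBoundary Y p ∘ₗ tupleMap f (p + 1) = tupleMap f p ∘ₗ tupleBoundary X p from
    LinearMap.congr_fun h z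
  refine tupleChain_hom_ext fun v => ?_
  simp only [LinearMap.comp_apply, tupleMap_single, tupleBoundary_single, map_sum]
  refine Finset.sum_congr rfl fun j _ => ?_
  rw [tupleMap, Finsupp.lmapDomain_apply, Finsupp.mapDomain_single]
  rfl

theorem tupleMap_tupleCone (f : X → Y) (x : X) (p : ℕ) (z : TupleChain X p) :
    tupleMap f (p + 1) (tupleCone x p z) = tupleCone (f x) p (tupleMap f p z) := by
  suffices h : tupleMap f (p + 1) ∘ₗ tupleCone x p = tupleCone (f x) p ∘ₗ tupleMap f p from
    LinearMap.congr_fun h z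
  refine tupleChain_hom_ext fun v => ?_
  simp only [LinearMap.comp_apply, tupleMap_single, tupleCone_single]
  congr 1
  ext k
  refine Fin.cases ?_ (fun k => ?_) k <;> simp

/-- Antisymmetrization turns the alternating sum of faces into the deletion of the first point: a
permutation of `p + 1` points is the choice of the first point and a permutation of the others. -/
theorem tailBoundary_tupleAlt (p : ℕ) (z : TupleChain X (p + 1)) :
    tailBoundary X p (tupleAlt X (p + 1) z) = tupleAlt X p (tupleBoundary X p z) := by
  suffices h : tailBoundary X p ∘ₗ tupleAlt X (p + 1) = tupleAlt X p ∘ₗ tupleBoundary X p from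
    LinearMap.congr_fun h z
  refine tupleChain_hom_ext fun v => ?_
  simp only [LinearMap.comp_apply, tupleAlt_single, tupleBoundary_single, map_sum]
  have h1 : ∀ j : Fin (p + 1),
      tupleAlt X p (Finsupp.single (v ∘ j.succAbove) ((-1 : ℚ) ^ (j : ℕ))) =
      ∑ e : Equiv.Perm (Fin p), Finsupp.single ((v ∘ j.succAbove) ∘ e)
        ((-1 : ℚ) ^ (j : ℕ) * ((Equiv.Perm.sign e : ℤ) : ℚ)) := by
    intro j
    rw [tupleAlt, Finsupp.linearCombination_single, Finset.smul_sum]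
    simp
  simp only [h1]
  rw [← Fintype.sum_prod_type' fun (j : Fin (p + 1)) (e : Equiv.Perm (Fin p)) =>
    Finsupp.single ((v ∘ j.succAbove) ∘ e) ((-1 : ℚ) ^ (j : ℕ) * ((Equiv.Perm.sign e : ℤ) : ℚ))]
  symm
  refine Finset.sum_bij
    (fun (a : Fin (p + 1) × Equiv.Perm (Fin p)) _ =>
      (a.1.cycleRange.symm * Equiv.Perm.decomposeFin.symm (0, a.2) : Equiv.Perm (Fin (p + 1))))
    (fun _ _ => Finset.mem_univ _) ?_ ?_ ?_
  · rintro ⟨j, e⟩ - ⟨j', e'⟩ - h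
    have h0 : j = j' := by
      have := Equiv.congr_fun h 0
      simpa using this
    subst h0
    have h2 := mul_left_cancel h
    have h3 := Equiv.Perm.decomposeFin.symm.injective h2
    simpa using h3
  · intro π _
    let τ : Equiv.Perm (Fin (p + 1)) := (π 0).cycleRange * π
    have hτ : τ 0 = 0 := by simp [τ]
    have hτ' : Equiv.Perm.decomposeFin.symm (0, (Equiv.Perm.decomposeFin τ).2) = τ := by
      have h2 : (Equiv.Perm.decomposeFin τ).1 = 0 := by
        have h3 : Equiv.Perm.decomposeFin.symm (Equiv.Perm.decomposeFin τ) 0 = 0 := by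
          rw [Equiv.symm_apply_apply]; exact hτ
        generalize Equiv.Perm.decomposeFin τ = q at h3 ⊢
        obtain ⟨a, b⟩ := q
        simpa using h3
      conv_rhs => rw [← Equiv.symm_apply_apply Equiv.Perm.decomposeFin τ]
      rw [← h2]
    refine ⟨(π 0, (Equiv.Perm.decomposeFin τ).2), Finset.mem_univ _, ?_⟩
    simp only [hτ']
    ext k
    simp [τ]
  · rintro ⟨j, e⟩ -
    rw [tailBoundary, Finsupp.lmapDomain_apply, Finsupp.mapDomain_single]
    congr 1
    · ext k
      simp [Fin.tail, Fin.cycleRange_symm_succ]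
    · rw [Equiv.Perm.sign_mul, Equiv.Perm.sign_symm, Fin.sign_cycleRange,
        Equiv.Perm.decomposeFin.symm_sign]
      simp

theorem tupleAlt_comp_perm (p : ℕ) (v : Fin p → X) (π : Equiv.Perm (Fin p)) :
    tupleAlt X p (Finsupp.single (v ∘ π) 1) =
      ((Equiv.Perm.sign π : ℤ) : ℚ) • tupleAlt X p (Finsupp.single v 1) := by
  rw [tupleAlt_single, tupleAlt_single, Finset.smul_sum]
  refine Fintype.sum_equiv (Equiv.mulLeft π) _ _ fun τ => ?_
  rw [Finsupp.smul_single, Equiv.coe_mulLeft, Equiv.Perm.sign_mul]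
  congr 1
  rw [smul_eq_mul, ← Int.cast_mul, ← Units.val_mul, ← mul_assoc, Int.units_mul_self, one_mul]

/-- Tuples with a repeated point are killed by antisymmetrization. -/
theorem tupleAlt_eq_zero {p : ℕ} {v : Fin p → X} (hv : ¬ Function.Injective v) :
    tupleAlt X p (Finsupp.single v 1) = 0 := by
  simp only [Function.Injective, not_forall] at hv
  obtain ⟨a, b, hab, hne⟩ := hv
  have h1 : v ∘ Equiv.swap a b = v := by
    ext k
    simp only [Function.comp_apply, Equiv.swap_apply_def]
    split_ifs with h1 h2
    · rw [h1, hab]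
    · rw [h2, hab]
    · rfl
  have h2 := tupleAlt_comp_perm p v (Equiv.swap a b)
  rw [h1, Equiv.Perm.sign_swap hne] at h2
  have h3 : (2 : ℚ) • tupleAlt X p (Finsupp.single v 1) = 0 := by
    rw [two_smul]
    nth_rewrite 1 [h2]
    simp
  exact (smul_eq_zero.1 h3).resolve_left two_ne_zero

/-- The prism between two maps of points: a chain homotopy whose tuples consist of points
`f x` and `g x`. -/
theorem exists_prism (f g : X → Y) :
    ∃ P : ∀ p, TupleChain X p →ₗ[ℚ] TupleChain Y (p + 1),
      (∀ z, tupleBoundary Y 0 (P 0 z) = tupleMap g 0 z - tupleMap f 0 z) ∧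
      (∀ p z, tupleBoundary Y (p + 1) (P (p + 1) z) + P p (tupleBoundary X p z) =
        tupleMap g (p + 1) z - tupleMap f (p + 1) z) ∧
      ∀ p v, P p (Finsupp.single v 1) ∈ Finsupp.supported ℚ ℚ
        {w : Fin (p + 1) → Y | ∀ j, ∃ k, w j = f (v k) ∨ w j = g (v k)} := by
  let step (p : ℕ) (Q : TupleChain X p →ₗ[ℚ] TupleChain Y (p + 1)) :
      TupleChain X (p + 1) →ₗ[ℚ] TupleChain Y (p + 2) :=
    Finsupp.linearCombination ℚ fun v => tupleCone (f (v 0)) (p + 1)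
      (tupleCone (g (v 0)) p (tupleMap g p (Finsupp.single (Fin.tail v) 1)) -
        Q (Finsupp.single (Fin.tail v) 1))
  let P : ∀ p, TupleChain X p →ₗ[ℚ] TupleChain Y (p + 1) := fun p => Nat.rec 0 step p
  have hP : ∀ p x z, P (p + 1) (tupleCone x p z) =
      tupleCone (f x) (p + 1) (tupleCone (g x) p (tupleMap g p z) - P p z) := by
    intro p x z
    suffices h : P (p + 1) ∘ₗ tupleCone x p =
        tupleCone (f x) (p + 1) ∘ₗ (tupleCone (g x) p ∘ₗ tupleMap g p - P p) from
      LinearMap.congr_fun h z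
    refine tupleChain_hom_ext fun v => ?_
    rw [LinearMap.comp_apply, tupleCone_single]
    change step p (P p) _ = _
    simp only [step, Finsupp.linearCombination_single, one_smul, Fin.cons_zero, Fin.tail_cons]
    rfl
  have h0 : ∀ z, P 0 z = 0 := fun z => rfl
  refine ⟨P, ?_, ?_, ?_⟩
  · intro z
    rw [h0, map_zero, eq_comm, sub_eq_zero]
    unfold tupleMap
    congr 2
    ext v k
    exact k.elim0
  · intro p
    induction p with
    | zero =>
      intro z
      suffices h : tupleBoundary Y 1 ∘ₗ P 1 + P 0 ∘ₗ tupleBoundary X 0 =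
          tupleMap g 1 - tupleMap f 1 from LinearMap.congr_fun h z
      refine tupleChain_hom_ext fun v => ?_
      rw [single_eq_tupleCone]
      simp only [LinearMap.add_apply, LinearMap.comp_apply, LinearMap.sub_apply, hP, h0, sub_zero,
        add_zero, tupleBoundary_tupleCone, tupleBoundary_tupleCone_zero, tupleMap_tupleCone]
      congr 2
      unfold tupleMap
      congr 2
      ext v k
      exact k.elim0
    | succ p ih =>
      intro z
      suffices h : tupleBoundary Y (p + 2) ∘ₗ P (p + 2) + P (p + 1) ∘ₗ tupleBoundary X (p + 1) =
          tupleMap g (p + 2) - tupleMap f (p + 2) from LinearMap.congr_fun h z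
      refine tupleChain_hom_ext fun v => ?_
      rw [single_eq_tupleCone]
      generalize (Finsupp.single (Fin.tail v) 1 : TupleChain X (p + 1)) = y
      have hy := eq_sub_of_add_eq (ih y)
      simp only [LinearMap.add_apply, LinearMap.comp_apply, LinearMap.sub_apply, hP,
        tupleBoundary_tupleCone, map_sub, hy, tupleMap_tupleCone, tupleBoundary_tupleMap]
      abel
  · intro p
    induction p with
    | zero =>
      intro v
      rw [h0]
      exact zero_mem _
    | succ p ih =>
      intro v
      rw [single_eq_tupleCone, hP, tupleMap_single, tupleCone_single, map_sub]
      refine Submodule.sub_mem _ ?_ ?_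
      · rw [tupleCone_single]
        refine Finsupp.single_mem_supported ℚ _ fun j => ?_
        refine Fin.cases ⟨0, Or.inl rfl⟩ (fun j => ?_) j
        refine Fin.cases ⟨0, Or.inr (by simp)⟩ (fun j => ?_) j
        exact ⟨j.succ, Or.inr (by simp [Fin.tail])⟩
      · have h1 := ih (Fin.tail v)
        rw [Finsupp.mem_supported] at h1 ⊢
        intro w hw
        classical
        rw [Finset.mem_coe, tupleCone, Finsupp.lmapDomain_apply] at hw
        obtain ⟨w', hw', rfl⟩ := Finset.mem_image.1 (Finsupp.mapDomain_support hw)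
        intro j
        refine Fin.cases ⟨0, Or.inl rfl⟩ (fun j => ?_) j
        obtain ⟨k, hk⟩ := h1 hw' j
        exact ⟨k.succ, by simpa [Fin.tail] using hk⟩

end tuples

/-! ### Acyclic carriers -/

/-- Construction of linear maps `H p : S_p → A_p` with `d H = g + ε H ∂`, simplex by simplex, from a
carrier in which cycles bound. The case `g = 0`, `ε = 1` gives chain maps, the case `ε = -1` gives
chain homotopies. -/
theorem exists_carried {B : ℕ → Type} {A : ℕ → Type} [∀ p, AddCommGroup (A p)]
    [∀ p, Module ℚ (A p)] (D : ∀ p, (B (p + 1) →₀ ℚ) →ₗ[ℚ] (B p →₀ ℚ))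
    (hDD : ∀ p z, D p (D (p + 1) z) = 0) (d : ∀ p, A (p + 1) →ₗ[ℚ] A p)
    (good : ∀ p, B p → Prop)
    (hgood : ∀ p b, good (p + 1) b → ∀ b' ∈ (D p (Finsupp.single b 1)).support, good p b')
    (C : ∀ p, B p → ∀ q, Submodule ℚ (A q))
    (hC : ∀ p b, good (p + 1) b → ∀ b' ∈ (D p (Finsupp.single b 1)).support, ∀ q,
      C p b' q ≤ C (p + 1) b q)
    (ε : ℚ) (g : ∀ p, (B (p + 1) →₀ ℚ) →ₗ[ℚ] A p)
    (hg : ∀ p b, good (p + 1) b → g p (Finsupp.single b 1) ∈ C (p + 1) b p)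
    (hdg : ∀ p b, good (p + 2) b →
      d p (g (p + 1) (Finsupp.single b 1)) + ε • g p (D (p + 1) (Finsupp.single b 1)) = 0)
    (H₀ : (B 0 →₀ ℚ) →ₗ[ℚ] A 0) (hH₀ : ∀ b, good 0 b → H₀ (Finsupp.single b 1) ∈ C 0 b 0)
    (fill₀ : ∀ b, good 1 b → ∀ a ∈ C 1 b 0, ∃ a' ∈ C 1 b 1, d 0 a' = a)
    (fill : ∀ p b, good (p + 2) b → ∀ a ∈ C (p + 2) b (p + 1), d p a = 0 →
      ∃ a' ∈ C (p + 2) b (p + 2), d (p + 1) a' = a) :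
    ∃ H : ∀ p, (B p →₀ ℚ) →ₗ[ℚ] A p, H 0 = H₀ ∧
      (∀ p b, good p b → H p (Finsupp.single b 1) ∈ C p b p) ∧
      ∀ p b, good (p + 1) b → d p (H (p + 1) (Finsupp.single b 1)) =
        g p (Finsupp.single b 1) + ε • H p (D p (Finsupp.single b 1)) := by
  classical
  let step (p : ℕ) (Q : (B p →₀ ℚ) →ₗ[ℚ] A p) : (B (p + 1) →₀ ℚ) →ₗ[ℚ] A (p + 1) :=
    Finsupp.linearCombination ℚ fun b =>
      if h : ∃ a' ∈ C (p + 1) b (p + 1), d p a' =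
        g p (Finsupp.single b 1) + ε • Q (D p (Finsupp.single b 1)) then h.choose else 0
  let H : ∀ p, (B p →₀ ℚ) →ₗ[ℚ] A p := fun p => Nat.rec H₀ step p
  have key : ∀ p b, (∃ a' ∈ C (p + 1) b (p + 1), d p a' =
      g p (Finsupp.single b 1) + ε • H p (D p (Finsupp.single b 1))) →
      H (p + 1) (Finsupp.single b 1) ∈ C (p + 1) b (p + 1) ∧
        d p (H (p + 1) (Finsupp.single b 1)) =
          g p (Finsupp.single b 1) + ε • H p (D p (Finsupp.single b 1)) := by
    intro p b h
    have h1 : H (p + 1) (Finsupp.single b 1) = h.choose := by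
      change step p (H p) _ = _
      simp only [step, Finsupp.linearCombination_single, one_smul, dif_pos h]
    rw [h1]
    exact h.choose_spec
  have hcar : ∀ p b, good (p + 1) b → (∀ b, good p b → H p (Finsupp.single b 1) ∈ C p b p) →
      g p (Finsupp.single b 1) + ε • H p (D p (Finsupp.single b 1)) ∈ C (p + 1) b p := by
    intro p b hb ih
    refine Submodule.add_mem _ (hg p b hb) (Submodule.smul_mem _ _ ?_)
    rw [← Finsupp.sum_single (D p (Finsupp.single b 1)), Finsupp.sum, map_sum]
    refine Submodule.sum_mem _ fun b' hb' => ?_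
    have h2 : Finsupp.single b' ((D p (Finsupp.single b 1)) b') =
        ((D p (Finsupp.single b 1)) b') • Finsupp.single b' (1 : ℚ) := by simp
    rw [h2, map_smul]
    exact Submodule.smul_mem _ _ (hC p b hb b' hb' p (ih b' (hgood p b hb b' hb')))
  have main : ∀ p, (∀ b, good p b → H p (Finsupp.single b 1) ∈ C p b p) ∧
      ∀ b, good (p + 1) b → ∃ a' ∈ C (p + 1) b (p + 1), d p a' =
        g p (Finsupp.single b 1) + ε • H p (D p (Finsupp.single b 1)) := by
    intro p
    induction p with
    | zero => exact ⟨hH₀, fun b hb => fill₀ b hb _ (hcar 0 b hb hH₀)⟩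
    | succ p ih =>
      have h1 : ∀ b, good (p + 1) b → H (p + 1) (Finsupp.single b 1) ∈ C (p + 1) b (p + 1) :=
        fun b hb => (key p b (ih.2 b hb)).1
      refine ⟨h1, fun b hb => fill p b hb _ (hcar (p + 1) b hb h1) ?_⟩
      have h2 : d p (H (p + 1) (D (p + 1) (Finsupp.single b 1))) =
          g p (D (p + 1) (Finsupp.single b 1)) := by
        have h3 : d p (H (p + 1) (D (p + 1) (Finsupp.single b 1))) =
            g p (D (p + 1) (Finsupp.single b 1)) +
              ε • H p (D p (D (p + 1) (Finsupp.single b 1))) := by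
          have hg' := hgood (p + 1) b hb
          generalize D (p + 1) (Finsupp.single b 1) = y at hg'
          rw [← Finsupp.sum_single y, Finsupp.sum]
          simp only [map_sum, Finset.smul_sum]
          rw [← Finset.sum_add_distrib]
          refine Finset.sum_congr rfl fun b' hb' => ?_
          have h4 : Finsupp.single b' (y b') = y b' • Finsupp.single b' (1 : ℚ) := by simp
          rw [h4]
          simp only [map_smul]
          rw [(key p b' (ih.2 b' (hg' b' hb'))).2, smul_add, smul_comm]
        rw [h3, hDD, map_zero, smul_zero, add_zero]
      rw [map_add, map_smul, h2]
      exact hdg p b hb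
  exact ⟨H, rfl, fun p => (main p).1, fun p b hb => (key p b ((main p).2 b hb)).2⟩

/-! ### Small tuples in a convex set -/

section small

variable {E : Type} [NormedAddCommGroup E]

/-- The tuples of points of `S` with mutual distances less than `δ`. -/
def smallTuples (δ : ℝ) (S : Set E) (p : ℕ) : Set (Fin p → E) :=
  {v | (∀ j, v j ∈ S) ∧ ∀ j k, dist (v j) (v k) < δ}

theorem smallTuples_mono {δ : ℝ} {S T : Set E} (h : S ⊆ T) (p : ℕ) :
    smallTuples δ S p ⊆ smallTuples δ T p := fun _ hv => ⟨fun j => h (hv.1 j), hv.2⟩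

/-- A property of a linear map on a space of tuple chains can be checked on tuples. -/
theorem map_mem_of_mem_supported {X M : Type} [AddCommGroup M] [Module ℚ M] {p : ℕ}
    {f : TupleChain X p →ₗ[ℚ] M} {S : Set (Fin p → X)} {N : Submodule ℚ M}
    (h : ∀ v ∈ S, f (Finsupp.single v 1) ∈ N) {z : TupleChain X p}
    (hz : z ∈ Finsupp.supported ℚ ℚ S) : f z ∈ N := by
  rw [Finsupp.supported_eq_span_single] at hz
  have : Submodule.span ℚ ((fun i => Finsupp.single i (1 : ℚ)) '' S) ≤ N.comap f := by
    rw [Submodule.span_le]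
    rintro _ ⟨v, hv, rfl⟩
    exact h v hv
  exact this hz

theorem tupleMap_mem_supported {X Y : Type} (f : X → Y) {p : ℕ} {S : Set (Fin p → X)}
    {T : Set (Fin p → Y)} (h : ∀ v ∈ S, f ∘ v ∈ T) {z : TupleChain X p}
    (hz : z ∈ Finsupp.supported ℚ ℚ S) : tupleMap f p z ∈ Finsupp.supported ℚ ℚ T := by
  refine map_mem_of_mem_supported (fun v hv => ?_) hz
  rw [tupleMap_single]
  exact Finsupp.single_mem_supported ℚ _ (h v hv)

theorem tupleMap_id {X : Type} (p : ℕ) (z : TupleChain X p) : tupleMap id p z = z := by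
  suffices h : tupleMap id p = LinearMap.id from LinearMap.congr_fun h z
  refine tupleChain_hom_ext fun v => ?_
  rw [tupleMap_single, LinearMap.id_apply, Function.id_comp]

variable [NormedSpace ℝ E]

/-- The complex of small tuples of points of a convex set is acyclic: contract to a point `q` by
homotheties of ratio `k / N`; the prisms between consecutive ones consist of small tuples if `N` is
large. -/
theorem exists_boundary_eq_of_smallTuples {δ : ℝ} (hδ : 0 < δ) {S : Set E} (hS : Convex ℝ S)
    (hne : S.Nonempty) {p : ℕ} {z : TupleChain E p}
    (hz : z ∈ Finsupp.supported ℚ ℚ (smallTuples δ S p))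
    (hdz : ∀ q (h : p = q + 1), tupleBoundary E q (h ▸ z) = 0) :
    ∃ y ∈ Finsupp.supported ℚ ℚ (smallTuples δ S (p + 1)), tupleBoundary E p y = z := by
  classical
  obtain ⟨q, hq⟩ := hne
  have hcone : ∀ f : E → E, (∀ x, f x = q) →
      ∃ y ∈ Finsupp.supported ℚ ℚ (smallTuples δ S (p + 1)),
        tupleBoundary E p y = tupleMap f p z := by
    intro f hf
    refine ⟨tupleCone q p (tupleMap f p z), ?_, ?_⟩
    · suffices h : (tupleCone q p ∘ₗ tupleMap f p) z ∈ _ from h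
      refine map_mem_of_mem_supported (S := univ) (fun v _ => ?_) (by simp)
      rw [LinearMap.comp_apply, tupleMap_single, tupleCone_single]
      refine Finsupp.single_mem_supported ℚ _ ?_
      have : ∀ j, (Fin.cons q (f ∘ v) : Fin (p + 1) → E) j = q := fun j => by
        refine Fin.cases rfl (fun j => ?_) j
        simp [hf]
      exact ⟨fun j => by rw [this]; exact hq, fun j k => by rw [this, this, dist_self]; exact hδ⟩
    · cases p with
      | zero => rw [tupleBoundary_tupleCone_zero]
      | succ p =>
        have h1 : tupleBoundary E p z = 0 := hdz p rfl
        rw [tupleBoundary_tupleCone, tupleBoundary_tupleMap, h1, map_zero, map_zero, sub_zero]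
  -- Finitely many tuples occur, so they are uniformly smaller than `δ` and bounded.
  obtain ⟨δ', hδ', hsm⟩ : ∃ δ' < δ, ∀ v ∈ z.support, ∀ j k, dist (v j) (v k) < δ' := by
    have h1 : ∀ v : Fin p → E, ∃ δ' < δ, v ∈ z.support → ∀ j k, dist (v j) (v k) < δ' := by
      intro v
      by_cases hv : v ∈ z.support
      · have h2 := (hz hv).2
        rcases isEmpty_or_nonempty (Fin p) with he | he
        · exact ⟨δ - 1, by linarith, fun _ j => he.elim j⟩
        · obtain ⟨m, hm⟩ := Finite.exists_max fun jk : Fin p × Fin p => dist (v jk.1) (v jk.2)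
          obtain ⟨c, hc, hc'⟩ := exists_between (h2 m.1 m.2)
          exact ⟨c, hc', fun _ j k => (hm (j, k)).trans_lt hc⟩
      · exact ⟨δ - 1, by linarith, fun h => absurd h hv⟩
    choose c hc hc' using h1
    rcases z.support.eq_empty_or_nonempty with he | he
    · exact ⟨δ - 1, by linarith, fun v hv => by simp [he] at hv⟩
    · obtain ⟨m, hm, hm'⟩ := Finset.exists_max_image z.support c he
      exact ⟨c m, hc m, fun v hv j k => (hc' v hv j k).trans_le (hm' v hv)⟩
  obtain ⟨M, hM0, hM⟩ : ∃ M : ℝ, 0 ≤ M ∧ ∀ v ∈ z.support, ∀ j, ‖v j - q‖ ≤ M := by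
    refine ⟨∑ v ∈ z.support, ∑ j, ‖v j - q‖, by positivity, fun v hv j => ?_⟩
    refine le_trans ?_ (Finset.single_le_sum (f := fun v : Fin p → E => ∑ j, ‖v j - q‖)
      (fun _ _ => by positivity) hv)
    exact Finset.single_le_sum (f := fun j => ‖v j - q‖) (fun _ _ => by positivity)
      (Finset.mem_univ j)
  obtain ⟨N, hN⟩ := exists_nat_gt (M / (δ - δ'))
  have hδδ : 0 < δ - δ' := by linarith
  have hN0 : (0 : ℝ) < N := (div_nonneg hM0 hδδ.le).trans_lt hN
  let G : ℕ → E → E := fun k x => q + ((k : ℝ) / N) • (x - q)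
  suffices h : ∀ k ≤ N, ∃ y ∈ Finsupp.supported ℚ ℚ (smallTuples δ S (p + 1)),
      tupleBoundary E p y = tupleMap (G k) p z by
    obtain ⟨y, hy, h1⟩ := h N le_rfl
    refine ⟨y, hy, h1.trans ?_⟩
    have h2 : G N = id := by
      ext1 x
      simp [G, div_self hN0.ne']
    rw [h2, tupleMap_id]
  intro k
  induction k with
  | zero =>
    intro _
    exact hcone _ fun x => by simp [G]
  | succ k ih =>
    intro hk
    obtain ⟨y, hy, h1⟩ := ih (by omega)
    obtain ⟨P, hP0, hP, hPs⟩ := exists_prism (G k) (G (k + 1))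
    refine ⟨y + P p z, Submodule.add_mem _ hy ?_, ?_⟩
    · refine map_mem_of_mem_supported (S := z.support) (fun v hv => ?_)
        ((Finsupp.mem_supported ℚ z).2 subset_rfl)
      refine Finsupp.supported_mono ?_ (hPs p v)
      have hk0 : (0 : ℝ) ≤ (k : ℝ) / N := by positivity
      have hk1 : ((k + 1 : ℕ) : ℝ) / N ≤ 1 := (div_le_one hN0).2 (by exact_mod_cast hk)
      have hk2 : (k : ℝ) / N ≤ 1 :=
        (div_le_one hN0).2 (by exact_mod_cast (Nat.le_succ k).trans hk)
      have hmem : ∀ k : ℕ, (k : ℝ) / N ≤ 1 → ∀ j, G k (v j) ∈ S := by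
        intro k hk j
        exact hS.add_smul_sub_mem hq ((hz hv).1 j) ⟨by positivity, hk⟩
      have hd : ∀ k : ℕ, (k : ℝ) / N ≤ 1 → ∀ j l, dist (G k (v j)) (G k (v l)) < δ' := by
        intro k hk j l
        have h2 : G k (v j) - G k (v l) = ((k : ℝ) / N) • (v j - v l) := by
          simp only [G, add_sub_add_left_eq_sub, ← smul_sub, sub_sub_sub_cancel_right]
        rw [dist_eq_norm, h2, norm_smul, Real.norm_of_nonneg (by positivity)]
        refine lt_of_le_of_lt (mul_le_of_le_one_left (norm_nonneg _) hk) ?_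
        rw [← dist_eq_norm]
        exact hsm v hv j l
      have hs : ∀ j, dist (G k (v j)) (G (k + 1) (v j)) < δ - δ' := by
        intro j
        have h2 : G k (v j) - G (k + 1) (v j) = -((1 / N : ℝ) • (v j - q)) := by
          simp only [G, add_sub_add_left_eq_sub, ← sub_smul, ← neg_smul]
          congr 1
          push_cast
          ring
        rw [dist_eq_norm, h2, norm_neg, norm_smul, Real.norm_of_nonneg (by positivity)]
        have h3 : M < (δ - δ') * N := by rwa [div_lt_iff₀' hδδ] at hN
        rw [one_div, inv_mul_lt_iff₀ hN0]
        nlinarith [hM v hv j]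
      have hd' : ∀ j l, dist (G k (v j)) (G (k + 1) (v l)) < δ := by
        intro j l
        have := dist_triangle (G k (v j)) (G k (v l)) (G (k + 1) (v l))
        linarith [hd k hk2 j l, hs l]
      intro w hw
      refine ⟨fun j => ?_, fun j l => ?_⟩
      · obtain ⟨a, ha | ha⟩ := hw j <;> rw [ha]
        exacts [hmem k hk2 a, hmem (k + 1) hk1 a]
      · obtain ⟨a, ha | ha⟩ := hw j <;> obtain ⟨b, hb | hb⟩ := hw l <;> rw [ha, hb]
        exacts [(hd k hk2 a b).trans hδ', hd' a b, dist_comm _ (G k (v b)) ▸ hd' b a,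
          (hd (k + 1) hk1 a b).trans hδ']
    · rw [map_add, h1]
      cases p with
      | zero => rw [hP0, add_sub_cancel]
      | succ p =>
        have h2 := hP p z
        have h3 : tupleBoundary E p z = 0 := hdz p rfl
        rw [h3, map_zero, add_zero] at h2
        rw [h2, add_sub_cancel]

/-- Iterated subdivision: a chain map that carries a tuple to a chain of small tuples in its convex
hull. -/
theorem exists_small_subdivision (E : Type) [NormedAddCommGroup E] [NormedSpace ℝ E] {δ : ℝ}
    (hδ : 0 < δ) :
    ∃ σ : ∀ p, TupleChain E p →ₗ[ℚ] TupleChain E p, σ 0 = LinearMap.id ∧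
      (∀ p v, σ p (Finsupp.single v 1) ∈
        Finsupp.supported ℚ ℚ (smallTuples δ (convexHull ℝ (range v)) p)) ∧
      ∀ p z, tupleBoundary E p (σ (p + 1) z) = σ p (tupleBoundary E p z) := by
  classical
  have hsub : ∀ p (b : Fin (p + 1) → E),
      ∀ b' ∈ (tupleBoundary E p (Finsupp.single b 1)).support, range b' ⊆ range b := by
    intro p b b' hb'
    rw [tupleBoundary_single] at hb'
    obtain ⟨j, -, hj⟩ := Finset.mem_biUnion.1 (Finsupp.support_finsetSum hb')
    have := Finsupp.support_single_subset hj
    rw [Finset.mem_singleton] at this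
    rw [this]
    exact range_comp_subset_range _ _
  have hne : ∀ p (b : Fin (p + 1) → E), (convexHull ℝ (range b)).Nonempty := fun p b =>
    convexHull_nonempty_iff.2 (range_nonempty b)
  obtain ⟨H, h0, h1, h2⟩ := exists_carried (B := fun p => Fin p → E)
    (A := fun p => TupleChain E p) (tupleBoundary E) tupleBoundary_tupleBoundary (tupleBoundary E)
    (fun _ _ => True) (fun _ _ _ _ _ => trivial)
    (fun _ b q => Finsupp.supported ℚ ℚ (smallTuples δ (convexHull ℝ (range b)) q))
    (fun p b _ b' hb' q => Finsupp.supported_mono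
      (smallTuples_mono (convexHull_mono (hsub p b b' hb')) q)) 1 0
    (fun _ _ _ => zero_mem _) (fun _ _ _ => by simp) LinearMap.id
    (fun b _ => Finsupp.single_mem_supported ℚ _ ⟨fun j => j.elim0, fun j => j.elim0⟩)
    (fun b _ a ha => exists_boundary_eq_of_smallTuples hδ (convex_convexHull ℝ _) (hne _ b) ha
      fun q h => by omega)
    (fun p b _ a ha hda => exists_boundary_eq_of_smallTuples hδ (convex_convexHull ℝ _) (hne _ b) ha
      fun q h => by obtain rfl : p = q := by omega
                    exact hda)
  refine ⟨H, h0, fun p v => h1 p v trivial, fun p z => ?_⟩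
  suffices h : tupleBoundary E p ∘ₗ H (p + 1) = H p ∘ₗ tupleBoundary E p from
    LinearMap.congr_fun h z
  refine tupleChain_hom_ext fun v => ?_
  simpa using h2 p v trivial

end small

/-! ### Increasing simplices -/

section increasing

variable {E : Type} [AddCommGroup E] [Module ℝ E] {C : Geometry.SimplicialComplex ℝ E}

theorem mem_vertices_of_mem_verts {p : ℕ} {v : Fin (p + 1) → E} (hv : verts v ∈ C.faces)
    (j : Fin (p + 1)) : v j ∈ C.vertices :=
  C.down_closed hv (Finset.singleton_subset_iff.2 (mem_verts.2 ⟨j, rfl⟩))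
    (Finset.singleton_nonempty _)

/-- The vertices of a simplex can be put into increasing order in exactly one way. -/
theorem VertexOrder.existsUnique_increasing (O : VertexOrder C) {p : ℕ} {v : Fin (p + 1) → E}
    (hv : IsSimplex C v) : ∃! π : Equiv.Perm (Fin (p + 1)), O.Increasing (v ∘ π) := by
  classical
  have hvx := mem_vertices_of_mem_verts hv.2
  -- The number of smaller vertices of the simplex.
  let r : Fin (p + 1) → ℕ := fun j => (Finset.univ.filter fun k => O.le (v k) (v j) ∧ k ≠ j).card
  have hr : ∀ j k, O.le (v j) (v k) → j ≠ k → r j < r k := by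
    intro j k hjk hne
    refine Finset.card_lt_card ⟨fun l hl => ?_, fun h => ?_⟩
    · simp only [Finset.mem_filter, Finset.mem_univ, true_and] at hl ⊢
      refine ⟨O.trans _ (hvx l) _ (hvx j) _ (hvx k) hl.1 hjk, ?_⟩
      rintro rfl
      exact hne (hv.1 (O.antisymm _ (hvx j) _ (hvx l) hjk hl.1))
    · have := h (Finset.mem_filter.2 ⟨Finset.mem_univ j, hjk, hne⟩)
      simp at this
  have hinc : ∀ π : Equiv.Perm (Fin (p + 1)), O.Increasing (v ∘ π) ↔ Monotone (r ∘ π) := by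
    intro π
    constructor
    · intro h
      refine monotone_iff_forall_lt.2 fun a b hab => (hr _ _ (h a b hab).1 ?_).le
      exact fun h' => hab.ne (π.injective h')
    · intro h a b hab
      have hne : π a ≠ π b := fun h' => hab.ne (π.injective h')
      refine ⟨?_, fun h' => hne (hv.1 h')⟩
      rcases O.total _ hv.2 _ (mem_verts.2 ⟨π a, rfl⟩) _ (mem_verts.2 ⟨π b, rfl⟩) with h' | h'
      · exact h'
      · exact absurd (hr _ _ h' hne.symm) (not_lt.2 (h hab.le))
  have hrinj : Function.Injective r := by
    intro j k hjk
    by_contra hne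
    rcases O.total _ hv.2 _ (mem_verts.2 ⟨j, rfl⟩) _ (mem_verts.2 ⟨k, rfl⟩) with h' | h'
    · exact (hr _ _ h' hne).ne hjk
    · exact (hr _ _ h' (Ne.symm hne)).ne hjk.symm
  refine ⟨Tuple.sort r, (hinc _).2 (Tuple.monotone_sort r), fun π hπ => ?_⟩
  have h1 := Tuple.unique_monotone ((hinc π).1 hπ) (Tuple.monotone_sort r)
  ext1 k
  exact hrinj (congrFun h1 k)

theorem VertexOrder.Increasing.comp_succAbove {O : VertexOrder C} {p : ℕ} {v : Fin (p + 2) → E}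
    (h : O.Increasing v) (j : Fin (p + 2)) : O.Increasing (v ∘ j.succAbove) := fun _ _ hab =>
  h _ _ (Fin.strictMono_succAbove j hab)

open scoped Classical in
/-- The part of a chain supported by increasing tuples. -/
def VertexOrder.incPart (O : VertexOrder C) (p : ℕ) :
    TupleChain E (p + 1) →ₗ[ℚ] TupleChain E (p + 1) :=
  Finsupp.linearCombination ℚ fun v => if O.Increasing v then Finsupp.single v 1 else 0

theorem VertexOrder.incPart_apply (O : VertexOrder C) {p : ℕ} (c : TupleChain E (p + 1))
    (v : Fin (p + 1) → E) [Decidable (O.Increasing v)] :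
    O.incPart p c v = if O.Increasing v then c v else 0 := by
  classical
  rw [incPart, Finsupp.linearCombination_apply, Finsupp.sum, Finsupp.finsetSum_apply]
  rw [Finset.sum_eq_single v]
  · split_ifs <;> simp
  · intro w _ hw
    split_ifs
    · simp [hw]
    · simp
  · intro h
    simp [Finsupp.notMem_support_iff.1 h]

theorem VertexOrder.incPart_mem (O : VertexOrder C) {p : ℕ} {c : TupleChain E (p + 1)}
    (hc : c ∈ chains C p) :
    O.incPart p c ∈ Finsupp.supported ℚ ℚ {v | IsSimplex C v ∧ O.Increasing v} := by
  classical
  intro v hv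
  rw [Finset.mem_coe, Finsupp.mem_support_iff, O.incPart_apply] at hv
  split_ifs at hv with h
  · exact ⟨hc.2 v hv, h⟩
  · exact absurd rfl hv

/-- A chain is determined by its coefficients at increasing simplices. -/
theorem VertexOrder.tupleAlt_incPart (O : VertexOrder C) {p : ℕ} {c : TupleChain E (p + 1)}
    (hc : c ∈ chains C p) : tupleAlt E (p + 1) (O.incPart p c) = c := by
  classical
  have h0 : ∀ z : TupleChain E (p + 1), ∀ w, tupleAlt E (p + 1) z w =
      ∑ π : Equiv.Perm (Fin (p + 1)), ((Equiv.Perm.sign π : ℤ) : ℚ) * z (w ∘ π) := by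
    intro z w
    let L : TupleChain E (p + 1) →ₗ[ℚ] ℚ :=
      ∑ π : Equiv.Perm (Fin (p + 1)), ((Equiv.Perm.sign π : ℤ) : ℚ) • Finsupp.lapply (w ∘ π)
    suffices h : Finsupp.lapply w ∘ₗ tupleAlt E (p + 1) = L by
      have := LinearMap.congr_fun h z
      simpa [L] using this
    refine tupleChain_hom_ext fun v => ?_
    rw [LinearMap.comp_apply, tupleAlt_single]
    simp only [L, map_sum, LinearMap.sum_apply, LinearMap.smul_apply, Finsupp.lapply_apply]
    refine Fintype.sum_equiv (Equiv.inv _) _ _ fun π => ?_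
    have h1 : (v ∘ π = w) ↔ v = w ∘ (π⁻¹ : Equiv.Perm _) := by
      constructor
      · rintro rfl; ext i; simp
      · rintro rfl; ext i; simp
    simp only [Finsupp.single_apply, h1, Equiv.inv_apply, Equiv.Perm.sign_inv, smul_eq_mul]
    split_ifs <;> simp
  ext w
  rw [h0]
  have h1 : ∀ π : Equiv.Perm (Fin (p + 1)),
      ((Equiv.Perm.sign π : ℤ) : ℚ) * O.incPart p c (w ∘ π) =
        if O.Increasing (w ∘ π) then c w else 0 := by
    intro π
    rw [O.incPart_apply]
    split_ifs
    · rw [hc.1, ← mul_assoc, ← Int.cast_mul, ← Units.val_mul, Int.units_mul_self]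
      simp
    · simp
  simp only [h1]
  by_cases hw : c w = 0
  · simp [hw]
  · obtain ⟨π, hπ, huniq⟩ := O.existsUnique_increasing (hc.2 w hw)
    rw [Finset.sum_eq_single π (fun τ _ hτ => if_neg fun h => hτ (huniq τ h)) (by simp), if_pos hπ]

theorem tupleAlt_mem_chains {p : ℕ} {v : Fin (p + 1) → E} {s : Finset E} (hs : s ∈ C.faces)
    (hv : ∀ j, v j ∈ s) : tupleAlt E (p + 1) (Finsupp.single v 1) ∈ chains C p := by
  by_cases hi : Function.Injective v
  · rw [tupleAlt_single_eq_oriented]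
    refine oriented_mem ⟨hi, C.down_closed hs (fun x hx => ?_) (verts_nonempty v)⟩
    obtain ⟨j, rfl⟩ := mem_verts.1 hx
    exact hv j
  · rw [tupleAlt_eq_zero hi]
    exact zero_mem _

theorem VertexOrder.incPart_tupleAlt (O : VertexOrder C) {p : ℕ} {z : TupleChain E (p + 1)}
    (hz : z ∈ Finsupp.supported ℚ ℚ {v | IsSimplex C v ∧ O.Increasing v}) :
    O.incPart p (tupleAlt E (p + 1) z) = z := by
  classical
  have h1 : (O.incPart p ∘ₗ tupleAlt E (p + 1) - LinearMap.id :
      TupleChain E (p + 1) →ₗ[ℚ] TupleChain E (p + 1)) z ∈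
      (⊥ : Submodule ℚ (TupleChain E (p + 1))) := by
    refine map_mem_of_mem_supported (fun v hv => ?_) hz
    rw [Submodule.mem_bot, LinearMap.sub_apply, sub_eq_zero, LinearMap.comp_apply,
      tupleAlt_single, map_sum, LinearMap.id_apply]
    obtain ⟨π, hπ, huniq⟩ := O.existsUnique_increasing hv.1
    obtain rfl : 1 = π := huniq 1 hv.2
    rw [Finset.sum_eq_single 1]
    · rw [incPart, Finsupp.linearCombination_single]
      simp [hv.2]
    · intro τ _ hτ
      rw [incPart, Finsupp.linearCombination_single, if_neg fun h => hτ (huniq τ h), smul_zero]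
    · simp
  rw [Submodule.mem_bot, LinearMap.sub_apply, sub_eq_zero] at h1
  exact h1

theorem VertexOrder.tupleBoundary_mem (O : VertexOrder C) {p : ℕ} {z : TupleChain E (p + 2)}
    (hz : z ∈ Finsupp.supported ℚ ℚ {v | IsSimplex C v ∧ O.Increasing v}) :
    tupleBoundary E (p + 1) z ∈ Finsupp.supported ℚ ℚ {v | IsSimplex C v ∧ O.Increasing v} := by
  refine map_mem_of_mem_supported (fun v hv => ?_) hz
  rw [tupleBoundary_single]
  refine Submodule.sum_mem _ fun j _ => Finsupp.single_mem_supported ℚ _ ?_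
  exact ⟨hv.1.comp Fin.succAbove_right_injective, hv.2.comp_succAbove j⟩

theorem VertexOrder.tupleBoundary_incPart (O : VertexOrder C) {p : ℕ} {c : TupleChain E (p + 2)}
    (hc : c ∈ chains C (p + 1)) :
    tupleBoundary E (p + 1) (O.incPart (p + 1) c) = O.incPart p (tailBoundary E (p + 1) c) := by
  conv_rhs => rw [← O.tupleAlt_incPart hc, tailBoundary_tupleAlt]
  rw [O.incPart_tupleAlt (O.tupleBoundary_mem (O.incPart_mem hc))]

/-- Linear maps on chains can be compared on increasing simplices. -/
theorem VertexOrder.induction_chains (O : VertexOrder C) {p : ℕ} {M : Type} [AddCommGroup M]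
    [Module ℚ M] {f g : TupleChain E (p + 1) →ₗ[ℚ] M}
    (h : ∀ v, IsSimplex C v → O.Increasing v → f (oriented v) = g (oriented v))
    {c : TupleChain E (p + 1)} (hc : c ∈ chains C p) : f c = g c := by
  have h1 : ((f - g) ∘ₗ tupleAlt E (p + 1)) (O.incPart p c) ∈ (⊥ : Submodule ℚ M) := by
    refine map_mem_of_mem_supported (fun v hv => ?_) (O.incPart_mem hc)
    rw [Submodule.mem_bot, LinearMap.comp_apply, tupleAlt_single_eq_oriented, LinearMap.sub_apply,
      h v hv.1 hv.2, sub_self]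
  rw [Submodule.mem_bot, LinearMap.comp_apply, O.tupleAlt_incPart hc, LinearMap.sub_apply,
    sub_eq_zero] at h1
  exact h1

end increasing

/-! ### Vertex orders and augmentations -/

/-- An ordering of a simplicial complex in which the vertices with the property `P` come last. -/
def separatingOrder {E : Type} [AddCommGroup E] [Module ℝ E]
    (C : Geometry.SimplicialComplex ℝ E) (P : E → Prop) : VertexOrder C where
  le v w := (¬ P v ∧ P w) ∨ ((P v ↔ P w) ∧ (v = w ∨ WellOrderingRel v w))
  refl v _ := Or.inr ⟨Iff.rfl, Or.inl rfl⟩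
  antisymm v _ w _ h h' := by
    rcases h with h | ⟨h, rfl | h1⟩
    · rcases h' with h' | h' <;> tauto
    · rfl
    · rcases h' with h' | ⟨h', rfl | h2⟩
      · tauto
      · rfl
      · exact absurd (_root_.trans h1 h2) (irrefl v)
  trans u _ v _ w _ h h' := by
    rcases h with h | ⟨h, rfl | h1⟩
    · rcases h' with h' | h' <;> tauto
    · exact h'
    · rcases h' with h' | ⟨h', rfl | h2⟩
      · tauto
      · exact Or.inr ⟨h, Or.inr h1⟩
      · exact Or.inr ⟨h.trans h', Or.inr (_root_.trans h1 h2)⟩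
  total s _ v _ w _ := by
    rcases trichotomous_of WellOrderingRel v w with h | h | h <;> tauto

section augmentation

variable {X Y : Type}

/-- The sum of the coefficients of a chain. -/
def coeffSum (X : Type) (p : ℕ) : TupleChain X p →ₗ[ℚ] ℚ :=
  Finsupp.linearCombination ℚ fun _ => 1

theorem coeffSum_eq_sum {p : ℕ} (z : TupleChain X p) : coeffSum X p z = z.sum fun _ a => a := by
  simp [coeffSum, Finsupp.linearCombination_apply]

theorem coeffSum_tailBoundary (p : ℕ) (z : TupleChain X (p + 1)) :
    coeffSum X p (tailBoundary X p z) = coeffSum X (p + 1) z := by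
  suffices h : coeffSum X p ∘ₗ tailBoundary X p = coeffSum X (p + 1) from LinearMap.congr_fun h z
  refine tupleChain_hom_ext fun v => ?_
  simp [coeffSum, tailBoundary]

theorem coeffSum_tupleMap (f : X → Y) (p : ℕ) (z : TupleChain X p) :
    coeffSum Y p (tupleMap f p z) = coeffSum X p z := by
  suffices h : coeffSum Y p ∘ₗ tupleMap f p = coeffSum X p from LinearMap.congr_fun h z
  refine tupleChain_hom_ext fun v => ?_
  simp [coeffSum, tupleMap]

theorem tupleAlt_zero (z : TupleChain X 0) : tupleAlt X 0 z = z := by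
  suffices h : tupleAlt X 0 = LinearMap.id from LinearMap.congr_fun h z
  refine tupleChain_hom_ext fun v => ?_
  rw [tupleAlt_single]
  simp [Subsingleton.elim _ v]

theorem coeffSum_injective : Function.Injective (coeffSum X 0) := by
  intro a b h
  have : ∀ z : TupleChain X 0, coeffSum X 0 z = z default := by
    intro z
    suffices h : coeffSum X 0 = Finsupp.lapply default from LinearMap.congr_fun h z
    refine tupleChain_hom_ext fun v => ?_
    simp [coeffSum, Subsingleton.elim v default]
  refine Finsupp.ext fun v => ?_
  rw [Subsingleton.elim v default, ← this, ← this, h]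

theorem exists_of_map_apply_ne_zero {p q : ℕ} (f : TupleChain X p →ₗ[ℚ] TupleChain Y q)
    {z : TupleChain X p} {w : Fin q → Y} (h : f z w ≠ 0) :
    ∃ v ∈ z.support, f (Finsupp.single v 1) w ≠ 0 := by
  by_contra! hc
  refine h ?_
  have h1 : (Finsupp.lapply w ∘ₗ f) z ∈ (⊥ : Submodule ℚ ℚ) :=
    map_mem_of_mem_supported (S := z.support) (fun v hv => by simpa using hc v hv)
      ((Finsupp.mem_supported ℚ z).2 subset_rfl)
  simpa using h1

/-- A chain map that carries every simplex to a chain of permutations of it is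
antisymmetrization. -/
theorem eq_tupleAlt_of_carried (f : ∀ p, TupleChain X p →ₗ[ℚ] TupleChain X p)
    (h0 : f 0 = LinearMap.id) (good : ∀ p, (Fin p → X) → Prop)
    (hgood : ∀ p v, good (p + 1) v → ∀ j : Fin (p + 1), good p (v ∘ j.succAbove))
    (hinj : ∀ p v, good p v → Function.Injective v)
    (hf : ∀ p v, good p v → ∀ w, f p (Finsupp.single v 1) w ≠ 0 →
      Function.Injective w ∧ range w ⊆ range v)
    (hcomm : ∀ p v, good (p + 1) v → tailBoundary X p (f (p + 1) (Finsupp.single v 1)) =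
      f p (tupleBoundary X p (Finsupp.single v 1))) (p : ℕ) :
    ∀ v, good p v → f p (Finsupp.single v 1) = tupleAlt X p (Finsupp.single v 1) := by
  classical
  induction p with
  | zero =>
    intro v _
    rw [h0, tupleAlt_zero, LinearMap.id_apply]
  | succ p ih =>
    intro v hv
    have hI : InjOn Fin.tail {w : Fin (p + 1) → X | Function.Injective w ∧ range w ⊆ range v} := by
      rintro w ⟨hw, hwv⟩ w' ⟨hw', hwv'⟩ h
      have hs : range w = range v := by
        refine (Set.eq_of_subset_of_ncard_le hwv ?_ (finite_range v))
        rw [← Set.image_univ, ← Set.image_univ, Set.ncard_image_of_injective _ hw,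
          Set.ncard_image_of_injective _ (hinj _ _ hv)]
      obtain ⟨j, hj⟩ : w' 0 ∈ range w := hs ▸ hwv' ⟨0, rfl⟩
      have hsucc : ∀ k : Fin p, w k.succ = w' k.succ := fun k => congrFun h k
      refine Fin.cases (fun hj => ?_) (fun k hk => ?_) j hj
      · ext k
        exact Fin.cases hj hsucc k
      · rw [hsucc] at hk
        exact absurd (hw' hk) (Fin.succ_ne_zero k)
    refine Finsupp.mapDomain_injOn _ hI ?_ ?_ ?_
    · intro w hw
      exact hf _ v hv w (Finsupp.mem_support_iff.1 hw)
    · intro w hw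
      rw [Finset.mem_coe, tupleAlt_single] at hw
      obtain ⟨π, -, hπ⟩ := Finset.mem_biUnion.1 (Finsupp.support_finsetSum hw)
      have := Finsupp.support_single_subset hπ
      rw [Finset.mem_singleton] at this
      subst this
      exact ⟨(hinj _ _ hv).comp π.injective, range_comp_subset_range _ _⟩
    · change tailBoundary X p _ = tailBoundary X p _
      rw [hcomm p v hv, tailBoundary_tupleAlt, tupleBoundary_single, map_sum, map_sum]
      refine Finset.sum_congr rfl fun j _ => ?_
      have h2 : Finsupp.single (v ∘ j.succAbove) ((-1 : ℚ) ^ (j : ℕ)) =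
          ((-1 : ℚ) ^ (j : ℕ)) • Finsupp.single (v ∘ j.succAbove) (1 : ℚ) := by simp
      rw [h2, map_smul, map_smul, ih _ (hgood _ _ hv j)]

end augmentation

/-! ### Carriers and simplicial approximation -/

namespace Triangulation

variable {n : ℕ} (K K' : Triangulation n)

/-- The simplex of `K` whose relative interior contains `p`. -/
def carrier (p : PP n) : Finset K.E := (K.exists_mem_img p).choose

theorem carrier_mem (p : PP n) : K.carrier p ∈ K.complex.faces :=
  (K.exists_mem_img p).choose_spec.1

theorem mem_img_carrier (p : PP n) : p ∈ K.img (relInterior (K.carrier p)) :=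
  (K.exists_mem_img p).choose_spec.2

theorem mem_simplexImg_iff {s : Finset K.E} (hs : s ∈ K.complex.faces) {p : PP n} :
    p ∈ K.simplexImg s ↔ K.carrier p ⊆ s :=
  ⟨fun h => K.subset_of_mem_img hs (K.carrier_mem p) (K.mem_img_carrier p) h, fun h =>
    K.simplexImg_mono h (K.img_relInterior_subset _ (K.mem_img_carrier p))⟩

theorem homeo_mem_simplexImg {s : Finset K.E} {y : K.complex.space} :
    K.homeo y ∈ K.simplexImg s ↔ y.1 ∈ convexHull ℝ (s : Set K.E) := by
  constructor
  · rintro ⟨y', hy', h⟩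
    rwa [← K.homeo.injective h]
  · exact fun h => ⟨y, h, rfl⟩

variable {K} in
theorem IsSubcomplex.simplexImg_carrier_subset {S : Set (PP n)} (hS : K.IsSubcomplex S)
    {p : PP n} (hp : p ∈ S) : K.simplexImg (K.carrier p) ⊆ S :=
  hS.simplexImg_subset (K.carrier_mem p) (K.mem_img_carrier p) hp

theorem isClosed_simplexImg (s : Finset K.E) : IsClosed (K.simplexImg s) := by
  have h : K.simplexImg s = K.homeo '' {y | y.1 ∈ convexHull ℝ (s : Set K.E)} := by
    ext p
    rfl
  rw [h, K.homeo.isClosed_image]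
  exact (s.finite_toSet.isClosed_convexHull (𝕜 := ℝ)).preimage continuous_subtype_val

/-- Open stars are open. -/
theorem isOpen_setOf_mem_carrier (v : K.E) : IsOpen {p | v ∈ K.carrier p} := by
  have h : {p | v ∈ K.carrier p}ᶜ =
      ⋃ t ∈ {t ∈ K.complex.faces | v ∉ t}, K.simplexImg t := by
    ext p
    simp only [mem_compl_iff, mem_ofPred_eq, mem_iUnion, exists_prop]
    constructor
    · intro hv
      exact ⟨K.carrier p, ⟨K.carrier_mem p, hv⟩,
        (K.mem_simplexImg_iff (K.carrier_mem p)).2 subset_rfl⟩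
    · rintro ⟨t, ⟨ht, hv⟩, hp⟩ hv'
      exact hv ((K.mem_simplexImg_iff ht).1 hp hv')
  rw [← isClosed_compl_iff, h]
  exact (K.finite.subset fun _ h => h.1).isClosed_biUnion fun t _ => K.isClosed_simplexImg t

theorem compactSpace_space : CompactSpace K.complex.space := K.homeo.symm.compactSpace

/-- Simplicial approximation of the identity: a map `ν` from points of `|K|` to vertices of `K'` such
that the vertices assigned to points near `y` are vertices of the carrier of `y`. -/
theorem exists_vertexMap : ∃ δ > 0, ∃ ν : K.E → K'.E, ∀ y y' : K.complex.space,
    dist y.1 y'.1 < δ → ν y'.1 ∈ K'.carrier (K.homeo y) := by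
  classical
  have := K.compactSpace_space
  obtain ⟨δ, hδ, h⟩ := lebesgue_number_lemma_of_metric (s := (univ : Set K.complex.space))
    isCompact_univ (c := fun v : K'.E => K.homeo ⁻¹' {p | v ∈ K'.carrier p})
    (fun v => (K'.isOpen_setOf_mem_carrier v).preimage K.homeo.continuous) (by
      intro y _
      obtain ⟨v, hv⟩ := K'.complex.nonempty_of_mem_faces (K'.carrier_mem (K.homeo y))
      exact mem_iUnion.2 ⟨v, hv⟩)
  choose ν hν using fun y => h y (mem_univ y)
  refine ⟨δ, hδ, fun x => if hx : x ∈ K.complex.space then ν ⟨x, hx⟩ else 0, fun y y' hy => ?_⟩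
  have h1 : ν y' ∈ K'.carrier (K.homeo y) := hν y' (show dist y y' < δ from hy)
  simpa using h1

variable {K K'} in
theorem IsSubdivision.isSubcomplex (h : K.IsSubdivision K') {s : Finset K.E}
    (hs : s ∈ K.complex.faces) : K'.IsSubcomplex (K.simplexImg s) := by
  intro p hp
  obtain ⟨F, hF, h1⟩ := h.2 s hs
  rw [h1] at hp
  obtain ⟨s', hs', hp⟩ := mem_iUnion₂.1 hp
  refine ⟨s', hF hs', hp, ?_⟩
  rw [h1]
  exact subset_biUnion_of_mem (u := fun s' => K'.simplexImg s') hs'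

variable {K K'} in
/-- A vertex map as in `exists_vertexMap` carries small tuples in a subcomplex of `K'` to simplices of
this subcomplex. -/
theorem tupleAlt_vertexMap_mem {δ : ℝ} {ν : K.E → K'.E}
    (hν : ∀ y y' : K.complex.space, dist y.1 y'.1 < δ → ν y'.1 ∈ K'.carrier (K.homeo y))
    {S : Set (PP n)} (hS : K'.IsSubcomplex S) {A : Set K.E}
    (hA : ∀ x ∈ A, ∃ h : x ∈ K.complex.space, K.homeo ⟨x, h⟩ ∈ S) {p : ℕ} {z : TupleChain K.E (p + 1)}
    (hz : z ∈ Finsupp.supported ℚ ℚ (smallTuples δ A (p + 1))) :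
    tupleAlt K'.E (p + 1) (tupleMap ν (p + 1) z) ∈ chains (K'.restrict S) p := by
  suffices h : (tupleAlt K'.E (p + 1) ∘ₗ tupleMap ν (p + 1)) z ∈ _ from h
  refine map_mem_of_mem_supported (fun w hw => ?_) hz
  rw [LinearMap.comp_apply, tupleMap_single]
  obtain ⟨h0, h0S⟩ := hA _ (hw.1 0)
  refine tupleAlt_mem_chains (s := K'.carrier (K.homeo ⟨w 0, h0⟩))
    ⟨K'.carrier_mem _, hS.simplexImg_carrier_subset h0S⟩ fun j => ?_
  obtain ⟨hj, -⟩ := hA _ (hw.1 j)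
  exact hν ⟨w 0, h0⟩ ⟨w j, hj⟩ (hw.2 0 j)

theorem convexHull_range {p : ℕ} (v : Fin (p + 1) → K.E) :
    convexHull ℝ (range v) = convexHull ℝ (verts v : Set K.E) := by
  congr 1
  ext x
  simp [mem_verts]

variable {K} in
theorem mem_simplexImg_of_mem_convexHull {s : Finset K.E} (hs : s ∈ K.complex.faces) {x : K.E}
    (hx : x ∈ convexHull ℝ (s : Set K.E)) :
    ∃ h : x ∈ K.complex.space, K.homeo ⟨x, h⟩ ∈ K.simplexImg s :=
  ⟨K.complex.convexHull_subset_space hs hx, ⟨x, _⟩, hx, rfl⟩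

/-- The subdivision operator exists: subdivide simplices into small tuples and apply a simplicial
approximation of the identity. -/
theorem IsSubdivision.exists_isSubdivisionOperator {K K' : Triangulation n}
    (h : K.IsSubdivision K') : ∃ Λ, IsSubdivisionOperator K K' Λ := by
  classical
  obtain ⟨δ, hδ, ν, hν⟩ := K.exists_vertexMap K'
  obtain ⟨σ, hσ0, hσ, hσd⟩ := exists_small_subdivision K.E hδ
  let O : VertexOrder K.complex := separatingOrder _ fun _ => False
  let Φ : ∀ p, TupleChain K.E p →ₗ[ℚ] TupleChain K'.E p := fun p =>
    tupleAlt K'.E p ∘ₗ tupleMap ν p ∘ₗ σ p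
  have hΦd : ∀ p z, tailBoundary K'.E p (Φ (p + 1) z) = Φ p (tupleBoundary K.E p z) := by
    intro p z
    simp only [Φ, LinearMap.comp_apply]
    rw [tailBoundary_tupleAlt, tupleBoundary_tupleMap, hσd]
  have hΦ : ∀ p (v : Fin (p + 1) → K.E), IsSimplex K.complex v →
      Φ (p + 1) (Finsupp.single v 1) ∈ chains (K'.restrict (K.simplexImg (verts v))) p := by
    intro p v hv
    refine tupleAlt_vertexMap_mem hν (h.isSubcomplex hv.2) (A := convexHull ℝ (range v))
      (fun x hx => ?_) (hσ _ v)
    rw [K.convexHull_range] at hx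
    exact mem_simplexImg_of_mem_convexHull hv.2 hx
  have hmem : ∀ p (c : chains K.complex p), Φ (p + 1) (O.incPart p c.1) ∈ chains K'.complex p := by
    intro p c
    refine map_mem_of_mem_supported (fun v hv => ?_) (O.incPart_mem c.2)
    refine ⟨(hΦ p v hv.1).1, fun w hw => ?_⟩
    have := (hΦ p v hv.1).2 w hw
    exact ⟨this.1, this.2.1⟩
  refine ⟨fun p => (Φ (p + 1) ∘ₗ O.incPart p ∘ₗ (chains K.complex p).subtype).codRestrict _ (hmem p),
    ?_, ?_, ?_⟩
  · intro p c v' hv'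
    obtain ⟨v, hv, hv1⟩ := exists_of_map_apply_ne_zero (Φ (p + 1)) hv'
    have hvO := O.incPart_mem c.2 hv
    refine ⟨v, ?_, ((hΦ p v hvO.1).2 v' hv1).2.2⟩
    have h2 := Finsupp.mem_support_iff.1 hv
    rw [LinearMap.coe_comp, Function.comp_apply] at h2
    intro h3
    rw [O.incPart_apply] at h2
    split_ifs at h2
    · exact h2 h3
    · exact h2 rfl
  · intro p c
    ext1
    change Φ (p + 1) (O.incPart p (tailBoundary K.E (p + 1) c.1)) =
      tailBoundary K'.E (p + 1) (Φ (p + 2) (O.incPart (p + 1) c.1))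
    rw [hΦd, O.tupleBoundary_incPart c.2]
  · intro c
    rw [← coeffSum_eq_sum, ← coeffSum_eq_sum]
    change coeffSum K'.E 1 (Φ 1 (O.incPart 0 c.1)) = _
    conv_rhs => rw [← O.tupleAlt_incPart c.2]
    rw [← coeffSum_tailBoundary, ← coeffSum_tailBoundary, hΦd, tailBoundary_tupleAlt, tupleAlt_zero]
    simp only [Φ, LinearMap.comp_apply, tupleAlt_zero, coeffSum_tupleMap, hσ0, LinearMap.id_apply]

/-! ### Acyclicity of subdivided simplices -/

open scoped Classical in
/-- The augmented chain complex, indexed by the number of vertices, of the subcomplex of the simplices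
contained in `S`. -/
def augChains (S : Set (PP n)) : ∀ q, Submodule ℚ (TupleChain K.E q)
  | 0 => if S.Nonempty then ⊤ else ⊥
  | q + 1 => chains (K.restrict S) q

theorem chains_restrict_mono {S T : Set (PP n)} (h : S ⊆ T) (p : ℕ) :
    chains (K.restrict S) p ≤ chains (K.restrict T) p := fun _ hc =>
  ⟨hc.1, fun v hv => ⟨(hc.2 v hv).1, (hc.2 v hv).2.1, (hc.2 v hv).2.2.trans h⟩⟩

theorem chains_restrict_le (S : Set (PP n)) (p : ℕ) :
    chains (K.restrict S) p ≤ chains K.complex p := fun _ hc =>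
  ⟨hc.1, fun v hv => ⟨(hc.2 v hv).1, (hc.2 v hv).2.1⟩⟩

theorem augChains_mono {S T : Set (PP n)} (h : S ⊆ T) (q : ℕ) :
    K.augChains S q ≤ K.augChains T q := by
  cases q with
  | zero =>
    simp only [augChains]
    split_ifs with h1 h2
    · exact le_rfl
    · exact absurd (h1.mono h) h2
    · exact bot_le
    · exact le_rfl
  | succ q => exact K.chains_restrict_mono h q

theorem augChains_empty (q : ℕ) : K.augChains ∅ q = ⊥ := by
  cases q with
  | zero => simp [augChains]
  | succ q =>
    refine (Submodule.eq_bot_iff _).2 fun c hc => ?_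
    ext v
    by_contra hv
    have h := (hc.2 v hv).2
    obtain ⟨p, hp⟩ := K.simplexImg_nonempty h.1
    exact h.2 hp

theorem exists_tailBoundary_eq_zero {S : Set (PP n)} (hS : K.IsSubcomplex S) {z : TupleChain K.E 0}
    (hz : z ∈ K.augChains S 0) : ∃ y ∈ K.augChains S 1, tailBoundary K.E 0 y = z := by
  by_cases hne : S.Nonempty
  · obtain ⟨p, hp⟩ := hne
    obtain ⟨v, hv⟩ := K.complex.nonempty_of_mem_faces (K.carrier_mem p)
    refine ⟨tupleAlt K.E 1 (tupleCone v 0 z), ?_, ?_⟩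
    · suffices h : (tupleAlt K.E 1 ∘ₗ tupleCone v 0) z ∈ _ from h
      refine map_mem_of_mem_supported (S := univ) (fun w _ => ?_) (by simp)
      rw [LinearMap.comp_apply, tupleCone_single]
      refine tupleAlt_mem_chains (s := K.carrier p)
        ⟨K.carrier_mem p, hS.simplexImg_carrier_subset hp⟩ fun j => ?_
      obtain rfl := Fin.fin_one_eq_zero j
      exact hv
    · rw [tailBoundary_tupleAlt, tupleBoundary_tupleCone_zero, tupleAlt_zero]
  · simp only [augChains, if_neg hne, Submodule.mem_bot] at hz
    exact ⟨0, zero_mem _, by rw [hz, map_zero]⟩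

/-- The part of a subdivision `K'` in a simplex of `K` is acyclic. A cycle is subdivided into tuples
that are small in the affine coordinates of `K`, where they bound by convexity; a simplicial
approximation of the identity carries the resulting chain back to `K'` and undoes the
subdivision. -/
theorem IsSubdivision.exists_tailBoundary_eq {K K' : Triangulation n} (h : K.IsSubdivision K')
    {s : Finset K.E} (hs : s ∈ K.complex.faces) {q : ℕ} {z : TupleChain K'.E (q + 1)}
    (hz : z ∈ K'.augChains (K.simplexImg s) (q + 1)) (hdz : tailBoundary K'.E q z = 0) :
    ∃ y ∈ K'.augChains (K.simplexImg s) (q + 2), tailBoundary K'.E (q + 1) y = z := by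
  classical
  have hS := h.isSubcomplex hs
  have hcpt := K'.compactSpace_space
  obtain ⟨δ, hδ, ν, hν⟩ := K.exists_vertexMap K'
  let θ' : K'.complex.space → K.complex.space := fun y => K.homeo.symm (K'.homeo y)
  have hθ' : ∀ y, K.homeo (θ' y) = K'.homeo y := fun y => K.homeo.apply_symm_apply _
  obtain ⟨δ', hδ', huc⟩ := Metric.uniformContinuous_iff.1
    (CompactSpace.uniformContinuous_of_continuous
      (K.homeo.symm.continuous.comp K'.homeo.continuous)) δ hδ
  let θ : K'.E → K.E := fun x => if hx : x ∈ K'.complex.space then (θ' ⟨x, hx⟩).1 else 0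
  have hθ : ∀ y : K'.complex.space, θ y.1 = (θ' y).1 := fun y => by simp [θ]
  obtain ⟨σ, hσ0, hσ, hσd⟩ := exists_small_subdivision K'.E hδ'
  let O : VertexOrder K'.complex := separatingOrder _ fun _ => False
  have hzc : z ∈ chains K'.complex q := K'.chains_restrict_le _ _ hz
  set a := O.incPart q z with ha
  have haz : tupleAlt K'.E (q + 1) a = z := O.tupleAlt_incPart hzc
  have hasupp : a ∈ Finsupp.supported ℚ ℚ {v | IsSimplex (K'.restrict (K.simplexImg s)) v ∧
      O.Increasing v} := by
    intro v hv
    rw [Finset.mem_coe, Finsupp.mem_support_iff, ha, O.incPart_apply] at hv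
    split_ifs at hv with h1
    · exact ⟨hz.2 v hv, h1⟩
    · exact absurd rfl hv
  have hda : tupleBoundary K'.E q a = 0 := by
    cases q with
    | zero => rw [← tupleAlt_zero (tupleBoundary K'.E 0 a), ← tailBoundary_tupleAlt, haz, hdz]
    | succ q => rw [ha, O.tupleBoundary_incPart hzc, hdz, map_zero]
  -- The image in `K` of the subdivided cycle bounds.
  have hb : tupleMap θ (q + 1) (σ (q + 1) a) ∈
      Finsupp.supported ℚ ℚ (smallTuples δ (convexHull ℝ (s : Set K.E)) (q + 1)) := by
    suffices h : (tupleMap θ (q + 1) ∘ₗ σ (q + 1)) a ∈ _ from h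
    refine map_mem_of_mem_supported (fun v hv => ?_) hasupp
    refine tupleMap_mem_supported θ (fun w hw => ?_) (hσ _ v)
    have hwK : ∀ j, ∃ h : w j ∈ K'.complex.space,
        K'.homeo ⟨w j, h⟩ ∈ K'.simplexImg (verts v) := fun j => by
      have := hw.1 j
      rw [K'.convexHull_range] at this
      exact mem_simplexImg_of_mem_convexHull hv.1.2.1 this
    choose hw1 hw2 using hwK
    have hθw : ∀ j, θ (w j) = (θ' ⟨w j, hw1 j⟩).1 := fun j => hθ ⟨w j, hw1 j⟩
    refine ⟨fun j => ?_, fun j k => ?_⟩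
    · rw [Function.comp_apply, hθw, ← K.homeo_mem_simplexImg, hθ']
      exact hv.1.2.2 (hw2 j)
    · rw [Function.comp_apply, Function.comp_apply, hθw, hθw]
      exact huc (show dist (⟨w j, hw1 j⟩ : K'.complex.space) ⟨w k, hw1 k⟩ < δ' from hw.2 j k)
  obtain ⟨y, hy, hdy⟩ := exists_boundary_eq_of_smallTuples hδ (convex_convexHull ℝ _)
    (convexHull_nonempty_iff.2 (Finset.coe_nonempty.2 (K.complex.nonempty_of_mem_faces hs))) hb
    (fun r hr => by
      obtain rfl : q = r := by omega
      change tupleBoundary K.E q (tupleMap θ (q + 1) (σ (q + 1) a)) = 0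
      rw [tupleBoundary_tupleMap, hσd, hda, map_zero, map_zero])
  refine ⟨tupleAlt K'.E (q + 2) (tupleMap ν (q + 2) y), ?_, ?_⟩
  · exact tupleAlt_vertexMap_mem hν hS (fun x hx => mem_simplexImg_of_mem_convexHull hs hx) hy
  · rw [tailBoundary_tupleAlt, tupleBoundary_tupleMap, hdy]
    -- Subdivision followed by the approximation is the identity, simplex by simplex.
    let Φ : ∀ p, TupleChain K'.E p →ₗ[ℚ] TupleChain K'.E p := fun p =>
      tupleAlt K'.E p ∘ₗ tupleMap ν p ∘ₗ tupleMap θ p ∘ₗ σ p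
    have hΦ : ∀ p v, (Function.Injective v ∧ ∃ t ∈ K'.complex.faces, range v ⊆ t) →
        Φ p (Finsupp.single v 1) = tupleAlt K'.E p (Finsupp.single v 1) := by
      intro p
      refine eq_tupleAlt_of_carried Φ ?_
        (fun p v => Function.Injective v ∧ ∃ t ∈ K'.complex.faces, range v ⊆ t) ?_ ?_ ?_ ?_ p
      · refine tupleChain_hom_ext fun v => ?_
        simp only [Φ, LinearMap.comp_apply, hσ0, LinearMap.id_apply, tupleMap_single, tupleAlt_zero]
        rw [Subsingleton.elim (ν ∘ θ ∘ v) v]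
      · rintro p v ⟨hv, t, ht, hvt⟩ j
        exact ⟨hv.comp Fin.succAbove_right_injective, t, ht, (range_comp_subset_range _ _).trans hvt⟩
      · exact fun p v hv => hv.1
      · rintro p v ⟨hv, t, ht, hvt⟩ w hw
        cases p with
        | zero => exact ⟨fun j => j.elim0, by rintro _ ⟨j, -⟩; exact j.elim0⟩
        | succ p =>
          have hvf : verts v ∈ K'.complex.faces := by
            refine K'.complex.down_closed ht (fun x hx => ?_) (verts_nonempty v)
            obtain ⟨j, rfl⟩ := mem_verts.1 hx
            exact hvt ⟨j, rfl⟩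
          have h1 : tupleMap θ (p + 1) (σ (p + 1) (Finsupp.single v 1)) ∈
              Finsupp.supported ℚ ℚ (smallTuples δ (θ '' convexHull ℝ (range v)) (p + 1)) := by
            refine tupleMap_mem_supported θ (fun w hw => ?_) (hσ _ v)
            refine ⟨fun j => ⟨w j, hw.1 j, rfl⟩, fun j k => ?_⟩
            have hw1 : ∀ j, w j ∈ K'.complex.space := fun j => by
              have := hw.1 j
              rw [K'.convexHull_range] at this
              exact K'.complex.convexHull_subset_space hvf this
            rw [Function.comp_apply, Function.comp_apply, hθ ⟨_, hw1 j⟩, hθ ⟨_, hw1 k⟩]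
            exact huc (show dist (⟨w j, hw1 j⟩ : K'.complex.space) ⟨w k, hw1 k⟩ < δ' from hw.2 j k)
          have h2 : Φ (p + 1) (Finsupp.single v 1) ∈
              chains (K'.restrict (K'.simplexImg (verts v))) p := by
            refine tupleAlt_vertexMap_mem hν ?_ ?_ h1
            · exact fun q hq => ⟨verts v, hvf, hq, subset_rfl⟩
            · rintro _ ⟨x, hx, rfl⟩
              rw [K'.convexHull_range] at hx
              have hx' := K'.complex.convexHull_subset_space hvf hx
              rw [hθ ⟨x, hx'⟩]
              refine ⟨(θ' ⟨x, hx'⟩).2, ?_⟩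
              change K.homeo (θ' ⟨x, hx'⟩) ∈ _
              rw [hθ', K'.homeo_mem_simplexImg]
              exact hx
          obtain ⟨hwi, hwf, hwv⟩ := h2.2 w hw
          refine ⟨hwi, ?_⟩
          rintro _ ⟨j, rfl⟩
          obtain ⟨x, hx⟩ := K'.img_relInterior_nonempty hwf
          have h3 := K'.subset_of_mem_img hvf hwf hx (hwv (K'.img_relInterior_subset _ hx))
          exact mem_verts.1 (h3 (mem_verts.2 ⟨j, rfl⟩))
      · intro p v _
        simp only [Φ, LinearMap.comp_apply]
        rw [tailBoundary_tupleAlt, tupleBoundary_tupleMap, tupleBoundary_tupleMap, hσd]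
    have h4 : (Φ (q + 1) - tupleAlt K'.E (q + 1)) a ∈ (⊥ : Submodule ℚ _) := by
      refine map_mem_of_mem_supported (fun v hv => ?_) hasupp
      rw [Submodule.mem_bot, LinearMap.sub_apply, sub_eq_zero]
      refine hΦ _ v ⟨hv.1.1, verts v, hv.1.2.1, ?_⟩
      rintro _ ⟨j, rfl⟩
      exact mem_verts.2 ⟨j, rfl⟩
    rw [Submodule.mem_bot, LinearMap.sub_apply, sub_eq_zero, haz] at h4
    exact h4

end Triangulation

/-! ### Dimensions of simplices and subdivisions of faces -/

namespace GoodTriangulation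

variable {n : ℕ}

/-- Simplices in a simplex have at most its dimension, as open simplices are regular submanifolds. -/
theorem card_le_of_simplexImg_subset {K K' : GoodTriangulation n} {s : Finset K.E}
    (hs : s ∈ K.complex.faces) {s' : Finset K'.E} (hs' : s' ∈ K'.complex.faces)
    (h : K'.simplexImg s' ⊆ K.simplexImg s) : s'.card ≤ s.card := by
  have h1 : ((s'.card - 1 : ℕ) : WithBot ℕ∞) ≤ ((s.card - 1 : ℕ) : WithBot ℕ∞) := by
    refine (le_semialgDim subset_rfl ((K'.img_relInterior_nonempty hs').image _)
      (K'.facewise s' hs')).trans ?_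
    refine semialgDim_le_of_cover (F := {t | t ∈ K.complex.faces ∧ t ⊆ s})
      (K.finite.subset fun _ h => h.1) (fun t => embed '' K.img (relInterior t)) ?_ ?_
    · rintro _ ⟨q, hq, rfl⟩
      obtain ⟨t, hts, htne, hqt⟩ :=
        K.exists_mem_img_relInterior (h (K'.img_relInterior_subset s' hq))
      exact mem_iUnion₂.2 ⟨t, ⟨K.complex.down_closed hs hts htne, hts⟩, q, hqt, rfl⟩
    · rintro t ⟨ht, hts⟩
      exact ⟨t.card - 1, Nat.sub_le_sub_right (Finset.card_le_card hts) 1, K.facewise t ht⟩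
  have h2 : s'.card - 1 ≤ s.card - 1 := by exact_mod_cast h1
  have := (K.complex.nonempty_of_mem_faces hs).card_pos
  omega

variable (K K' : GoodTriangulation (n + 1)) (i : Fin (n + 1)) (α : Pole)

open scoped Classical in
/-- The face of the simplex `s` spanned by its vertices in `H_{i,α}`. -/
def polarFace (s : Finset K.E) : Finset K.E := s.filter fun v => K.simplexImg {v} ⊆ divH i α

theorem polarFace_subset (s : Finset K.E) : K.polarFace i α s ⊆ s := by
  classical
  exact Finset.filter_subset _ _

theorem simplexImg_polarFace_subset {s : Finset K.E} (hs : s ∈ K.complex.faces)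
    (hne : (K.polarFace i α s).Nonempty) : K.simplexImg (K.polarFace i α s) ⊆ divH i α := by
  classical
  refine (K.divH_full i α).2 _ (K.complex.down_closed hs (K.polarFace_subset i α s) hne) ?_
  intro v hv
  exact (Finset.mem_filter.1 hv).2

theorem carrier_subset_polarFace {s : Finset K.E} (hs : s ∈ K.complex.faces) {p : PP (n + 1)}
    (hp : p ∈ K.simplexImg s) (hpH : p ∈ divH i α) : K.carrier p ⊆ K.polarFace i α s := by
  classical
  intro v hv
  refine Finset.mem_filter.2 ⟨(K.mem_simplexImg_iff hs).1 hp hv, ?_⟩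
  exact (K.simplexImg_mono (Finset.singleton_subset_iff.2 hv)).trans
    ((K.divH_full i α).1.simplexImg_carrier_subset hpH)

/-- A simplex meets `H_{i,α}` in a face. -/
theorem simplexImg_inter_divH {s : Finset K.E} (hs : s ∈ K.complex.faces)
    (hne : (K.polarFace i α s).Nonempty) :
    K.simplexImg s ∩ divH i α = K.simplexImg (K.polarFace i α s) := by
  have hf := K.complex.down_closed hs (K.polarFace_subset i α s) hne
  ext p
  constructor
  · rintro ⟨hp, hpH⟩
    exact (K.mem_simplexImg_iff hf).2 (K.carrier_subset_polarFace i α hs hp hpH)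
  · intro hp
    exact ⟨K.simplexImg_mono (K.polarFace_subset i α s) hp,
      K.simplexImg_polarFace_subset i α hs hne hp⟩

theorem simplexImg_inter_divH_eq_empty {s : Finset K.E} (hs : s ∈ K.complex.faces)
    (hne : ¬ (K.polarFace i α s).Nonempty) : K.simplexImg s ∩ divH i α = ∅ := by
  refine eq_empty_of_forall_notMem fun p hp => hne ?_
  exact (K.complex.nonempty_of_mem_faces (K.carrier_mem p)).mono
    (K.carrier_subset_polarFace i α hs hp.1 hp.2)

theorem face_simplexImg (s : Finset K.E) :
    (K.face i α).simplexImg s = incl i α ⁻¹' K.simplexImg s := by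
  ext p
  exact K.mem_faceTriangulation_img i α

variable {K K'} in
theorem face_le (h : K ≤ K') : K.face i α ≤ K'.face i α := by
  constructor
  · rintro s' ⟨hs', hs'H⟩
    obtain ⟨s, hs, hss'⟩ := h.1 s' hs'
    obtain ⟨p, hp⟩ := K'.simplexImg_nonempty hs'
    have hne : (K.polarFace i α s).Nonempty :=
      (K.complex.nonempty_of_mem_faces (K.carrier_mem p)).mono
        (K.carrier_subset_polarFace i α hs (hss' hp) (hs'H hp))
    refine ⟨K.polarFace i α s, ⟨K.complex.down_closed hs (K.polarFace_subset i α s) hne,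
      K.simplexImg_polarFace_subset i α hs hne⟩, ?_⟩
    refine (K'.face_simplexImg i α s').subset.trans
      (Subset.trans ?_ (K.face_simplexImg i α _).symm.subset)
    rw [← K.simplexImg_inter_divH i α hs hne]
    exact preimage_mono (subset_inter hss' hs'H)
  · rintro s ⟨hs, hsH⟩
    obtain ⟨F, hF, h1⟩ := h.2 s hs
    refine ⟨F, fun s' hs' => ⟨hF hs', ?_⟩, ?_⟩
    · exact (h1 ▸ subset_biUnion_of_mem (u := fun s' => K'.simplexImg s') hs').trans hsH
    · refine (K.face_simplexImg i α s).trans ?_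
      rw [h1, preimage_iUnion₂]
      exact iUnion₂_congr fun s' _ => (K'.face_simplexImg i α s').symm

end GoodTriangulation

/-! ### The cap product is a chain map and preserves admissibility -/

theorem coboundary_apply {E : Type} {p : ℕ} (u : (Fin (p + 1) → E) → ℚ) (v : Fin (p + 2) → E) :
    coboundary u v = ∑ j : Fin (p + 2), (-1) ^ (j : ℕ) * u (v ∘ j.succAbove) := rfl

theorem oriented_apply_ne_zero {E : Type} {p : ℕ} {v w : Fin (p + 1) → E} (h : oriented v w ≠ 0) :
    ∃ π : Equiv.Perm (Fin (p + 1)), w = v ∘ π := by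
  classical
  rw [← Finsupp.mem_support_iff] at h
  obtain ⟨π, -, hπ⟩ := Finset.mem_biUnion.1 (Finsupp.support_finsetSum h)
  have := Finsupp.support_single_subset hπ
  rw [Finset.mem_singleton] at this
  exact ⟨π, this⟩

theorem tailBoundary_oriented {E : Type} {p : ℕ} (v : Fin (p + 2) → E) :
    tailBoundary E (p + 1) (oriented v) =
      ∑ j : Fin (p + 2), ((-1 : ℚ) ^ (j : ℕ)) • oriented (v ∘ j.succAbove) := by
  rw [← tupleAlt_single_eq_oriented, tailBoundary_tupleAlt, tupleBoundary_single, map_sum]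
  refine Finset.sum_congr rfl fun j _ => ?_
  rw [← tupleAlt_single_eq_oriented, ← map_smul, Finsupp.smul_single, smul_eq_mul, mul_one]

section cap

variable {n : ℕ} {K : GoodTriangulation (n + 1)} {i : Fin (n + 1)} {α : Pole}

theorem capAux_oriented (T : K.ThomCocycle i α) (O : K.GoodOrder i α) {k : ℕ}
    {v : Fin (k + 3) → K.E} (hv : IsSimplex K.complex v) (hO : O.Increasing v) :
    capAux K T O k (oriented v) =
      T.1 (fun j : Fin 3 => v (j.castLE (by omega))) • 
        oriented fun j : Fin (k + 1) => v j.succ.succ := by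
  classical
  obtain ⟨π, hπ, huniq⟩ := O.existsUnique_increasing hv
  obtain rfl : 1 = π := huniq 1 hO
  rw [oriented, map_sum, Finset.sum_eq_single 1]
  · rw [capAux, Finsupp.linearCombination_single]
    simp [hO]
  · intro τ _ hτ
    rw [capAux, Finsupp.linearCombination_single, if_neg fun h => hτ (huniq τ h), smul_zero]
  · simp

theorem capAux_apply_ne_zero (T : K.ThomCocycle i α) (O : K.GoodOrder i α) {k : ℕ}
    {c : TupleChain K.E (k + 3)} {w : Fin (k + 1) → K.E} (h : capAux K T O k c w ≠ 0) :
    ∃ v, c v ≠ 0 ∧ verts w ⊆ verts v := by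
  classical
  obtain ⟨v, hv, hw⟩ := exists_of_map_apply_ne_zero (capAux K T O k) h
  refine ⟨v, Finsupp.mem_support_iff.1 hv, ?_⟩
  rw [capAux, Finsupp.linearCombination_single, one_smul] at hw
  split_ifs at hw
  · rw [Finsupp.smul_apply] at hw
    obtain ⟨π, rfl⟩ := oriented_apply_ne_zero (right_ne_zero_of_smul hw)
    intro x hx
    obtain ⟨j, rfl⟩ := mem_verts.1 hx
    exact mem_verts.2 ⟨_, rfl⟩
  · exact absurd rfl hw

/-- The cap product with a cocycle of even degree commutes with the boundary. -/
theorem capAux_tailBoundary (T : K.ThomCocycle i α) (O : K.GoodOrder i α) (k : ℕ)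
    {c : TupleChain K.E (k + 4)} (hc : c ∈ chains K.complex (k + 3)) :
    capAux K T O k (tailBoundary K.E (k + 3) c) =
      tailBoundary K.E (k + 1) (capAux K T O (k + 1) c) := by
  refine O.induction_chains (f := capAux K T O k ∘ₗ tailBoundary K.E (k + 3))
    (g := tailBoundary K.E (k + 1) ∘ₗ capAux K T O (k + 1)) (fun v hv hO => ?_) hc
  simp only [LinearMap.comp_apply]
  rw [capAux_oriented T O hv hO, tailBoundary_oriented, map_sum, map_smul, tailBoundary_oriented]
  have h1 : ∀ j : Fin (k + 4),
      capAux K T O k (((-1 : ℚ) ^ (j : ℕ)) • oriented (v ∘ j.succAbove)) =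
      ((-1 : ℚ) ^ (j : ℕ) * T.1 fun a : Fin 3 => v (j.succAbove (a.castLE (by omega)))) •
        oriented fun a : Fin (k + 1) => v (j.succAbove a.succ.succ) := by
    intro j
    rw [map_smul, capAux_oriented T O (hv.comp Fin.succAbove_right_injective)
      (hO.comp_succAbove j), smul_smul]
    rfl
  simp only [h1]
  have hcoc := T.2.cocycle (fun j : Fin 4 => v (j.castLE (by omega)))
    (hv.comp (Fin.castLE_injective (by omega)))
  rw [coboundary_apply, Fin.sum_univ_four] at hcoc
  rw [Fin.sum_univ_succ, Fin.sum_univ_succ, Fin.sum_univ_succ (n := k + 1),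
    Fin.sum_univ_succ (n := k + 1), smul_add, Finset.smul_sum]
  have hb0 : (fun a : Fin (k + 1) => v ((0 : Fin (k + 4)).succAbove a.succ.succ)) =
      fun a => v a.succ.succ.succ := by
    ext a; simp
  have hb1 : (fun a : Fin (k + 1) => v ((Fin.succ (0 : Fin (k + 3))).succAbove a.succ.succ)) =
      fun a => v a.succ.succ.succ := by
    ext1 a; rw [Fin.succ_succAbove_succ, Fin.succAbove_zero]
  have hb2 : (fun a : Fin (k + 1) => v ((Fin.succ (Fin.succ (0 : Fin (k + 2)))).succAbove
      a.succ.succ)) = fun a => v a.succ.succ.succ := by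
    ext1 a; rw [Fin.succ_succAbove_succ, Fin.succ_succAbove_succ, Fin.succAbove_zero]
  have hb2' : (fun j : Fin (k + 2) => v j.succ.succ) ∘ (0 : Fin (k + 2)).succAbove =
      fun a : Fin (k + 1) => v a.succ.succ.succ := by
    ext1 a; simp
  rw [hb0, hb1, hb2, hb2', ← add_assoc, ← add_assoc, ← add_smul, ← add_smul]
  refine congrArg₂ _ ?_ ?_
  · rw [smul_smul]
    congr 1
    have e0 : (fun a : Fin 3 => v ((0 : Fin (k + 4)).succAbove (a.castLE (by omega)))) =
        (fun j : Fin 4 => v (j.castLE (by omega))) ∘ (0 : Fin 4).succAbove := by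
      ext1 a
      fin_cases a <;> rfl
    have e1 : (fun a : Fin 3 => v ((Fin.succ (0 : Fin (k + 3))).succAbove (a.castLE (by omega)))) =
        (fun j : Fin 4 => v (j.castLE (by omega))) ∘ (1 : Fin 4).succAbove := by
      ext1 a
      fin_cases a <;> rfl
    have e2 : (fun a : Fin 3 => v ((Fin.succ (Fin.succ (0 : Fin (k + 2)))).succAbove
        (a.castLE (by omega)))) =
        (fun j : Fin 4 => v (j.castLE (by omega))) ∘ (2 : Fin 4).succAbove := by
      ext1 a
      fin_cases a <;> rfl
    have e3 : (fun a : Fin 3 => v (a.castLE (by omega))) =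
        (fun j : Fin 4 => v (j.castLE (by omega))) ∘ (3 : Fin 4).succAbove := by
      ext1 a
      fin_cases a <;> rfl
    rw [e0, e1, e2, e3]
    simp only [Fin.val_zero, Fin.val_succ, pow_zero, one_mul, zero_add, pow_one, Fin.val_one,
      Fin.val_two, mul_one] at hcoc ⊢
    have h3 : ((3 : Fin 4) : ℕ) = 3 := rfl
    rw [h3] at hcoc
    have h4 : ∀ a b c d : ℚ, a + -1 * b + (-1) ^ 2 * c + (-1) ^ 3 * d = 0 →
        a + -1 * b + (-1) ^ (1 + 1) * c = d := fun a b c d h => by norm_num at h ⊢; linarith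
    exact h4 _ _ _ _ hcoc
  · refine Finset.sum_congr rfl fun j _ => ?_
    rw [smul_smul]
    congr 1
    · rw [mul_comm]
      refine congrArg₂ _ (congrArg T.1 (funext fun a => ?_)) ?_
      · fin_cases a
        · rfl
        · rfl
        · change v (j.succ.succ.succ.succAbove (Fin.succ (Fin.succ 0))) = v (Fin.succ (Fin.succ 0))
          rw [Fin.succ_succAbove_succ, Fin.succ_succAbove_succ, Fin.succ_succAbove_zero]
      · simp only [Fin.val_succ]
        ring
    · congr 1
      ext1 a
      simp only [Function.comp_apply]
      rw [Fin.succ_succAbove_succ, Fin.succ_succAbove_succ]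

theorem coeffSum_oriented_zero {E : Type} (v : Fin 1 → E) : coeffSum E 1 (oriented v) = 1 := by
  rw [← tupleAlt_single_eq_oriented, ← coeffSum_tailBoundary, tailBoundary_tupleAlt, tupleAlt_zero,
    tupleBoundary_single]
  simp [coeffSum]

/-- The augmentation of the cap product is the evaluation of the cocycle, which does not depend on
the ordering. -/
theorem coeffSum_capAux_oriented (T : K.ThomCocycle i α) (O : K.GoodOrder i α)
    {v : Fin 3 → K.E} (hv : IsSimplex K.complex v) :
    coeffSum K.E 1 (capAux K T O 0 (oriented v)) = T.1 v := by
  obtain ⟨π, hπ, -⟩ := O.existsUnique_increasing hv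
  have h1 : oriented v = ((Equiv.Perm.sign π : ℤ) : ℚ) • oriented (v ∘ π) := by
    rw [← tupleAlt_single_eq_oriented, ← tupleAlt_single_eq_oriented, tupleAlt_comp_perm, smul_smul,
      ← Int.cast_mul, ← Units.val_mul, Int.units_mul_self]
    simp
  rw [h1, map_smul, map_smul, capAux_oriented T O (hv.comp π.injective) hπ, map_smul,
    coeffSum_oriented_zero]
  have h2 := T.2.mem.1 v π
  have h3 : (fun j : Fin 3 => (v ∘ π) (j.castLE (by omega))) = v ∘ π := by
    ext1 j
    rfl
  rw [h3, h2, smul_eq_mul, smul_eq_mul, mul_one, ← mul_assoc, ← Int.cast_mul, ← Units.val_mul,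
    Int.units_mul_self]
  simp

theorem codim_insertNth (J : Fin n → Option Pole) :
    codim (i.insertNth (some α) J : Fin (n + 1) → Option Pole) = codim J + 1 := by
  classical
  rw [codim, codim, Finset.card_filter, Finset.card_filter, Fin.sum_univ_succAbove _ i]
  simp [add_comm]

theorem cap_mem_admissible (T : K.ThomCocycle i α) (O : K.GoodOrder i α) (k : ℕ)
    {γ : K.RelChain (k + 2)} (hγ : γ ∈ K.admissible (k + 2)) :
    cap T O k γ ∈ (K.face i α).admissible k := by
  obtain ⟨c, rfl⟩ := Submodule.mkQ_surjective _ γ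
  have h := (GoodTriangulation.isAdmissible_support_iff c).1
    ((GoodTriangulation.isAdmissibleChain_mk c).1 hγ)
  refine (GoodTriangulation.isAdmissibleChain_mk (K := K.face i α)
    ⟨capAux K T O k c.1, capAux_mem T O k c.1 c.2⟩).2
    ((GoodTriangulation.isAdmissible_support_iff _).2 ?_)
  intro w hw t htw htne J hJ hD
  rw [Finsupp.mem_support_iff] at hw
  obtain ⟨v, hv, hwv⟩ := capAux_apply_ne_zero T O hw
  have hwH := ((capAux_mem T O k c.1 c.2).2 w hw).2.2
  have htH : K.simplexImg t ⊆ divH i α := (K.simplexImg_mono htw).trans hwH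
  have h1 := h v (Finsupp.mem_support_iff.2 hv) t (htw.trans hwv) htne
    (i.insertNth (some α) J) ?_ ?_
  · rw [codim_insertNth] at h1
    have h2 : ∀ a b : ℕ, a + 2 * (b + 1) ≤ k + 2 → a + 2 * b ≤ k := fun a b h => by omega
    exact h2 _ _ h1
  · intro q hq
    have h2 := GoodTriangulation.incl_removeNth i α (htH hq)
    rw [← h2] at hq ⊢
    refine (GoodTriangulation.incl_mem_cubicalFace i α J _).1 (hJ ?_)
    exact (K.mem_faceTriangulation_img i α).2 hq
  · intro hD'
    refine hD fun p hp => (GoodTriangulation.incl_mem_divD i α p).2 (hD' ?_)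
    exact (K.mem_faceTriangulation_img i α).1 hp

theorem relBoundary_cap (T : K.ThomCocycle i α) (O : K.GoodOrder i α) (k : ℕ)
    (γ : K.RelChain (k + 3)) :
    (K.face i α).relBoundary k (cap T O (k + 1) γ) = cap T O k (K.relBoundary (k + 2) γ) := by
  obtain ⟨c, rfl⟩ := Submodule.mkQ_surjective _ γ
  refine congrArg ((K.face i α).relClass k) (Subtype.ext ?_)
  exact (capAux_tailBoundary T O k c.2).symm

theorem cap_mem_AC (T : K.ThomCocycle i α) (O : K.GoodOrder i α) (k : ℕ)
    {γ : K.RelChain (k + 2)} (hγ : γ ∈ K.AC (k + 2)) : cap T O k γ ∈ (K.face i α).AC k := by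
  cases k with
  | zero => exact cap_mem_admissible T O 0 hγ.1
  | succ k =>
    refine ⟨cap_mem_admissible T O _ hγ.1, ?_⟩
    change (K.face i α).relBoundary k _ ∈ (K.face i α).admissible k
    rw [relBoundary_cap]
    exact cap_mem_admissible T O k hγ.2

end cap

/-! ### Uniqueness of the cap product on admissible chains -/

section uniqueness

variable {n : ℕ} {K K' : GoodTriangulation (n + 1)} {i : Fin (n + 1)} {α : Pole}

theorem GoodTriangulation.simplexImg_subset_of_face {s' : Finset K'.E}
    (hs' : K'.simplexImg s' ⊆ divH i α) {s : Finset K.E}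
    (h : (K'.face i α).simplexImg s' ⊆ (K.face i α).simplexImg s) :
    K'.simplexImg s' ⊆ K.simplexImg s := by
  intro q hq
  have h1 := GoodTriangulation.incl_removeNth i α (hs' hq)
  rw [← h1] at hq ⊢
  exact (K.mem_faceTriangulation_img i α).1 (h ((K'.mem_faceTriangulation_img i α).2 hq))

variable (K i α) in
/-- The inclusion of the chains of `K ∩ H_{i,α}` into the tuple chains of the ambient space of `K`. -/
def faceIncl (p : ℕ) : chains (K.face i α).complex p →ₗ[ℚ] TupleChain K.E (p + 1) :=
  (chains (K.face i α).complex p).subtype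

/-- A chain carried by the intersections of the simplices of an admissible chain with `H_{i,α}`
vanishes modulo `D^n`, if its dimension is only one less than that of the admissible chain. -/
theorem mem_chains_divD_of_carried {p : ℕ} {c : TupleChain K.E (p + 2)}
    (hc : c ∈ chains K.complex (p + 1)) (hadm : IsAdmissible (K.support ⟨c, hc⟩))
    (H : TupleChain K.E (p + 2) →ₗ[ℚ] TupleChain K'.E (p + 1)) {z : TupleChain K.E (p + 2)}
    (hz : ∀ v ∈ z.support, c v ≠ 0)
    (hH : ∀ v ∈ z.support, H (Finsupp.single v 1) ∈
      K'.augChains (K.simplexImg (verts v) ∩ divH i α) (p + 1)) :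
    H z ∈ chains (K'.restrict (divD (n + 1))) p := by
  refine map_mem_of_mem_supported (S := z.support) (fun v hv => ?_)
    ((Finsupp.mem_supported ℚ z).2 subset_rfl)
  have hvs := hc.2 v (hz v hv)
  have h1 := hH v hv
  by_cases hne : (K.polarFace i α (verts v)).Nonempty
  · rw [K.simplexImg_inter_divH i α hvs.2 hne] at h1
    by_cases hD : K.simplexImg (K.polarFace i α (verts v)) ⊆ divD (n + 1)
    · exact K'.chains_restrict_mono hD p h1
    · have h2 := (GoodTriangulation.isAdmissible_support_iff _).1 hadm v
        (Finsupp.mem_support_iff.2 (hz v hv)) _ (K.polarFace_subset i α _) hne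
        (fun j => if j = i then some α else none) (by
          rw [← GoodTriangulation.divH_eq]
          exact K.simplexImg_polarFace_subset i α hvs.2 hne) hD
      have h3 : codim (fun j => if j = i then some α else none) = 1 := by
        simp [codim, Finset.filter_eq']
      have h4 : H (Finsupp.single v 1) = 0 := by
        ext w
        by_contra hw
        have h5 := h1.2 w hw
        have h6 : IsSimplex K'.complex w := ⟨h5.1, h5.2.1⟩
        have h7 := GoodTriangulation.card_le_of_simplexImg_subset
          (K.complex.down_closed hvs.2 (K.polarFace_subset i α _) hne) h5.2.1 h5.2.2
        rw [h6.card] at h7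
        omega
      rw [h4]
      exact zero_mem _
  · rw [K.simplexImg_inter_divH_eq_empty i α hvs.2 hne, K'.augChains_empty,
      Submodule.mem_bot] at h1
    rw [h1]
    exact zero_mem _

/-- Both sides of the comparison are chain maps of degree `-2` that carry a simplex `σ` to the part of
the subdivision in the simplex `σ ∩ H_{i,α}`, which is acyclic. As the augmentations differ by the
coboundary of `η`, there is a chain homotopy with the same carrier. On an admissible chain with
admissible boundary it vanishes modulo `D^n` for dimension reasons. -/
theorem subdivision_cap_sub_cap_subdivision_mem (hKK' : K ≤ K')
    {Λ : ∀ p, chains K.complex p →ₗ[ℚ] chains K'.complex p}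
    (hΛ : IsSubdivisionOperator K.toTriangulation K'.toTriangulation Λ)
    {Λ' : ∀ p, chains (K.face i α).complex p →ₗ[ℚ] chains (K'.face i α).complex p}
    (hΛ' : IsSubdivisionOperator (K.face i α).toTriangulation (K'.face i α).toTriangulation Λ')
    (T : K.ThomCocycle i α) (O : K.GoodOrder i α) (T' : K'.ThomCocycle i α)
    (O' : K'.GoodOrder i α) (P : VertexOrder K.complex) (η : (Fin 2 → K.E) → ℚ)
    (hη : ∀ v, IsSimplex K.complex v → P.Increasing v → η v ≠ 0 →
      (K.simplexImg (verts v) ∩ divH i α).Nonempty)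
    (hTη : ∀ (v : Fin 3 → K.E) (hv : IsSimplex K.complex v), P.Increasing v →
      T.1 v - coeffSum K'.E 1 (capAux K' T' O' 0 (Λ 2 ⟨oriented v, oriented_mem hv⟩).1) =
        coboundary η v)
    {k : ℕ} (c : chains K.complex (k + 2)) (hc : IsAdmissible (K.support c))
    (hdc : IsAdmissible (K.support (boundary K.complex (k + 1) c))) :
    faceIncl K' i α k (Λ' k ⟨capAux K T O k c.1, capAux_mem T O k c.1 c.2⟩) -
      capAux K' T' O' k (Λ (k + 2) c).1 ∈ chains ((K'.face i α).restrict (divD n)) k := by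
  classical
  let Ψ : ∀ p, chains K.complex (p + 2) →ₗ[ℚ] TupleChain K'.E (p + 1) := fun p =>
    faceIncl K' i α p ∘ₗ Λ' p ∘ₗ (capAux K T O p).restrict (capAux_mem T O p) -
    capAux K' T' O' p ∘ₗ (chains K'.complex (p + 2)).subtype ∘ₗ Λ (p + 2)
  have hΨ : ∀ p c, Ψ p c =
      faceIncl K' i α p (Λ' p ⟨capAux K T O p c.1, capAux_mem T O p c.1 c.2⟩) -
      capAux K' T' O' p (Λ (p + 2) c).1 := fun p c => rfl
  have hΨmem : ∀ p c, Ψ p c ∈ chains (K'.face i α).complex p := fun p c =>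
    Submodule.sub_mem _ (Λ' p _).2 (capAux_mem T' O' p _ (Λ (p + 2) c).2)
  have hΨcar : ∀ p (v : Fin (p + 3) → K.E) (hv : IsSimplex K.complex v),
      Ψ p ⟨oriented v, oriented_mem hv⟩ ∈
        K'.augChains (K.simplexImg (verts v) ∩ divH i α) (p + 1) := by
    intro p v hv
    have horv : ∀ w, (oriented v) w ≠ 0 → verts w ⊆ verts v := by
      intro w hw
      obtain ⟨π, rfl⟩ := oriented_apply_ne_zero hw
      rw [verts_comp_perm]
    refine ⟨(hΨmem p _).1, fun w hw => ?_⟩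
    have h1 := (hΨmem p _).2 w hw
    refine ⟨h1.1, h1.2.1, subset_inter ?_ h1.2.2⟩
    rw [hΨ, Finsupp.sub_apply] at hw
    by_cases h2 : faceIncl K' i α p
        (Λ' p ⟨capAux K T O p (oriented v), capAux_mem T O p _ (oriented_mem hv)⟩) w = 0
    · rw [h2, zero_sub, neg_ne_zero] at hw
      obtain ⟨u, hu, hwu⟩ := capAux_apply_ne_zero T' O' hw
      obtain ⟨v', hv', huv⟩ := hΛ.carried _ _ u hu
      exact (K'.simplexImg_mono hwu).trans (huv.trans (K.simplexImg_mono (horv v' hv')))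
    · obtain ⟨u, hu, hwu⟩ := hΛ'.carried _ _ w h2
      obtain ⟨v', hv', huv⟩ := capAux_apply_ne_zero T O hu
      refine (GoodTriangulation.simplexImg_subset_of_face h1.2.2 hwu).trans ?_
      exact K.simplexImg_mono (huv.trans (horv v' hv'))
  have hΨd : ∀ p c, tailBoundary K'.E (p + 1) (Ψ (p + 1) c) = Ψ p (boundary K.complex (p + 2) c) := by
    intro p c
    rw [hΨ, hΨ, map_sub, ← capAux_tailBoundary T' O' p (Λ (p + 3) c).2]
    congr 1
    · have h1 := hΛ'.comm p ⟨capAux K T O (p + 1) c.1, capAux_mem T O (p + 1) c.1 c.2⟩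
      refine Eq.trans (congrArg Subtype.val h1.symm) ?_
      congr 2
      exact Subtype.ext (capAux_tailBoundary T O p c.2).symm
    · rw [hΛ.comm (p + 2) c]
      rfl
  -- `Ψ` is extended to all tuple chains, as the homotopy is built on the free module of tuples.
  choose Ψe hΨe using fun p => (Ψ p).exists_extend
  have hΨe' : ∀ p c, Ψe p c.1 = Ψ p c := fun p c => LinearMap.congr_fun (hΨe p) c
  -- In degree `-1` of the augmented complex the term `η` accounts for the difference of the
  -- augmentations.
  let g : ∀ p, TupleChain K.E (p + 2) →ₗ[ℚ] TupleChain K'.E p := fun p => match p with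
    | 0 => Finsupp.linearCombination ℚ fun v => Finsupp.single default (η v)
    | p + 1 => Ψe p ∘ₗ tupleAlt K.E (p + 3)
  have hg : ∀ p v (hv : IsSimplex K.complex v),
      g (p + 1) (Finsupp.single v 1) = Ψ p ⟨oriented v, oriented_mem hv⟩ := by
    intro p v hv
    change Ψe p (tupleAlt K.E (p + 3) (Finsupp.single v 1)) = _
    rw [tupleAlt_single_eq_oriented]
    exact hΨe' p ⟨oriented v, oriented_mem hv⟩
  let good : ∀ p, (Fin (p + 1) → K.E) → Prop := fun p v => IsSimplex K.complex v ∧ P.Increasing v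
  have hsupp : ∀ p (v : Fin (p + 2) → K.E), good (p + 1) v →
      ∀ w ∈ (tupleBoundary K.E (p + 1) (Finsupp.single v 1)).support,
        good p w ∧ verts w ⊆ verts v := by
    intro p v hv w hw
    rw [tupleBoundary_single] at hw
    obtain ⟨j, -, hj⟩ := Finset.mem_biUnion.1 (Finsupp.support_finsetSum hw)
    have := Finsupp.support_single_subset hj
    rw [Finset.mem_singleton] at this
    subst this
    refine ⟨⟨hv.1.comp Fin.succAbove_right_injective, hv.2.comp_succAbove j⟩, fun x hx => ?_⟩
    obtain ⟨l, rfl⟩ := mem_verts.1 hx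
    exact mem_verts.2 ⟨_, rfl⟩
  obtain ⟨H, hH0, hH1, hH2⟩ := exists_carried (B := fun p => Fin (p + 1) → K.E)
    (A := fun p => TupleChain K'.E p) (fun p => tupleBoundary K.E (p + 1))
    (fun p => tupleBoundary_tupleBoundary (p + 1)) (tailBoundary K'.E) good
    (fun p v hv w hw => (hsupp p v hv w hw).1)
    (fun p v q => K'.augChains (K.simplexImg (verts v) ∩ divH i α) q)
    (fun p v hv w hw q => K'.augChains_mono
      (inter_subset_inter_left _ (K.simplexImg_mono (hsupp p v hv w hw).2)) q)
    (-1) g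
    (by
      rintro (_ | p) v hv
      · change Finsupp.linearCombination ℚ _ _ ∈ _
        rw [Finsupp.linearCombination_single, one_smul]
        by_cases h0 : η v = 0
        · rw [h0, Finsupp.single_zero]
          exact zero_mem _
        · simp [Triangulation.augChains, hη v hv.1 hv.2 h0]
      · rw [hg p v hv.1]
        exact hΨcar p v hv.1)
    (by
      rintro (_ | p) v hv
      · rw [neg_one_smul, add_neg_eq_zero, hg 0 v hv.1]
        refine coeffSum_injective ?_
        rw [coeffSum_tailBoundary, hΨ, map_sub]
        have h1 := hΛ'.augmentation
          ⟨capAux K T O 0 (oriented v), capAux_mem T O 0 _ (oriented_mem hv.1)⟩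
        rw [← coeffSum_eq_sum, ← coeffSum_eq_sum] at h1
        have h2 := coeffSum_capAux_oriented T O hv.1
        refine (congrArg₂ _ (h1.trans h2) rfl).trans ((hTη v hv.1 hv.2).trans ?_)
        rw [tupleBoundary_single, map_sum, map_sum, coboundary_apply]
        refine Finset.sum_congr rfl fun j _ => ?_
        change _ = coeffSum K'.E 0 (Finsupp.linearCombination ℚ _ _)
        rw [Finsupp.linearCombination_single, map_smul, coeffSum, Finsupp.linearCombination_single,
          smul_eq_mul, smul_eq_mul, mul_one]
      · rw [neg_one_smul, add_neg_eq_zero, hg (p + 1) v hv.1, hΨd]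
        change _ = Ψe p (tupleAlt K.E (p + 3) _)
        rw [← tailBoundary_tupleAlt, tupleAlt_single_eq_oriented]
        exact (hΨe' p _).symm)
    0 (fun _ _ => zero_mem _)
    (by
      intro v hv a ha
      by_cases hne : (K.polarFace i α (verts v)).Nonempty
      · rw [K.simplexImg_inter_divH i α hv.1.2 hne] at ha ⊢
        exact K'.exists_tailBoundary_eq_zero (hKK'.isSubcomplex
          (K.complex.down_closed hv.1.2 (K.polarFace_subset i α _) hne)) ha
      · rw [K.simplexImg_inter_divH_eq_empty i α hv.1.2 hne, K'.augChains_empty,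
          Submodule.mem_bot] at ha
        exact ⟨0, zero_mem _, by rw [map_zero, ha]⟩)
    (by
      intro p v hv a ha hda
      by_cases hne : (K.polarFace i α (verts v)).Nonempty
      · rw [K.simplexImg_inter_divH i α hv.1.2 hne] at ha ⊢
        exact hKK'.exists_tailBoundary_eq
          (K.complex.down_closed hv.1.2 (K.polarFace_subset i α _) hne) ha hda
      · rw [K.simplexImg_inter_divH_eq_empty i α hv.1.2 hne, K'.augChains_empty,
          Submodule.mem_bot] at ha
        exact ⟨0, zero_mem _, by rw [map_zero, ha]⟩)
  have hinc : ∀ p (c : TupleChain K.E (p + 1)), ∀ v ∈ (P.incPart p c).support, c v ≠ 0 := by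
    intro p c v hv h0
    rw [Finsupp.mem_support_iff, P.incPart_apply] at hv
    split_ifs at hv
    · exact hv h0
    · exact hv rfl
  -- The homotopy identity, evaluated on the increasing simplices of `c`.
  have hkey : Ψ k c = tailBoundary K'.E (k + 1) (H (k + 2) (P.incPart (k + 2) c.1)) +
      H (k + 1) (P.incPart (k + 1) (tailBoundary K.E (k + 2) c.1)) := by
    have h1 : (tailBoundary K'.E (k + 1) ∘ₗ H (k + 2) + H (k + 1) ∘ₗ tupleBoundary K.E (k + 2) -
        g (k + 1) : TupleChain K.E (k + 3) →ₗ[ℚ] TupleChain K'.E (k + 1)) (P.incPart (k + 2) c.1) ∈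
        (⊥ : Submodule ℚ (TupleChain K'.E (k + 1))) := by
      refine map_mem_of_mem_supported (fun v hv => ?_) (P.incPart_mem c.2)
      rw [Submodule.mem_bot, LinearMap.sub_apply, LinearMap.add_apply, LinearMap.comp_apply,
        LinearMap.comp_apply]
      have := hH2 (k + 1) v hv
      rw [neg_one_smul] at this
      rw [this]
      abel
    rw [Submodule.mem_bot, LinearMap.sub_apply, sub_eq_zero, LinearMap.add_apply,
      LinearMap.comp_apply, LinearMap.comp_apply, P.tupleBoundary_incPart c.2] at h1
    rw [h1]
    change _ = Ψe k (tupleAlt K.E (k + 3) _)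
    rw [P.tupleAlt_incPart c.2, hΨe']
  -- By the dimension count both terms of the homotopy identity are chains in `D^n`.
  have hD : Ψ k c ∈ chains (K'.restrict (divD (n + 1))) k := by
    rw [hkey]
    refine Submodule.add_mem _ ?_ ?_
    · refine boundaryAux_mem (K'.restrict (divD (n + 1))) k _ ?_
      exact mem_chains_divD_of_carried c.2 hc (H (k + 2)) (hinc _ _)
        fun v hv => hH1 (k + 2) v (P.incPart_mem c.2 hv)
    · have hb := (boundary K.complex (k + 1) c).2
      exact mem_chains_divD_of_carried hb hdc (H (k + 1)) (hinc _ _)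
        fun v hv => hH1 (k + 1) v (P.incPart_mem hb hv)
  refine ⟨hD.1, fun w hw => ?_⟩
  have h1 := hD.2 w hw
  have h2 := (hΨmem k c).2 w hw
  refine ⟨h2.1, h2.2, fun p hp => (GoodTriangulation.incl_mem_divD i α p).2 (h1.2.2 ?_)⟩
  exact (K'.mem_faceTriangulation_img i α).1 hp

end uniqueness

/-! ### Singular chains of contractible spaces -/

section singular

variable {X Y : Type} [TopologicalSpace X] [TopologicalSpace Y]

/-- Singular `p`-chains with coefficients in `ℚ`. -/
abbrev SingularChain (X : Type) [TopologicalSpace X] (p : ℕ) : Type := SingularSimplex X p →₀ ℚ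

/-- The boundary of a singular chain. -/
def singularBoundary (X : Type) [TopologicalSpace X] (p : ℕ) :
    SingularChain X (p + 1) →ₗ[ℚ] SingularChain X p :=
  Finsupp.linearCombination ℚ fun σ =>
    ∑ j : Fin (p + 2), Finsupp.single (SingularSimplex.face σ j) ((-1 : ℚ) ^ (j : ℕ))

theorem singularBoundary_single {p : ℕ} (σ : SingularSimplex X (p + 1)) :
    singularBoundary X p (Finsupp.single σ 1) =
      ∑ j : Fin (p + 2), Finsupp.single (SingularSimplex.face σ j) ((-1 : ℚ) ^ (j : ℕ)) := by
  simp [singularBoundary]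

theorem linearCombination_singularBoundary {p : ℕ} (u : SingularSimplex X p → ℚ)
    (z : SingularChain X (p + 1)) :
    Finsupp.linearCombination ℚ u (singularBoundary X p z) =
      Finsupp.linearCombination ℚ (singularCoboundary u) z := by
  suffices h : Finsupp.linearCombination ℚ u ∘ₗ singularBoundary X p =
      Finsupp.linearCombination ℚ (singularCoboundary u) from LinearMap.congr_fun h z
  ext σ
  simp [singularBoundary, singularCoboundary]

/-- The map of singular chains induced by a continuous map. -/
def singularMap (f : C(X, Y)) (p : ℕ) : SingularChain X p →ₗ[ℚ] SingularChain Y p :=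
  Finsupp.lmapDomain ℚ ℚ f.comp

theorem singularBoundary_singularMap (f : C(X, Y)) (p : ℕ) (z : SingularChain X (p + 1)) :
    singularBoundary Y p (singularMap f (p + 1) z) =
      singularMap f p (singularBoundary X p z) := by
  suffices h : singularBoundary Y p ∘ₗ singularMap f (p + 1) =
      singularMap f p ∘ₗ singularBoundary X p from LinearMap.congr_fun h z
  ext1 σ
  ext1
  simp only [singularBoundary, singularMap, LinearMap.comp_apply, Finsupp.lsingle_apply,
    Finsupp.lmapDomain_apply, Finsupp.mapDomain_single, Finsupp.linearCombination_single, one_smul,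
    map_sum]
  rfl

theorem map_succAbove_apply_self {p : ℕ} (j : Fin (p + 2)) (s : stdSimplex ℝ (Fin (p + 1))) :
    stdSimplex.map j.succAbove s j = 0 := by
  rw [stdSimplex.map_coe, FunOnFinite.linearMap_apply_apply]
  refine Finset.sum_eq_zero fun k hk => ?_
  exact absurd (Finset.mem_filter.1 hk).2 (Fin.succAbove_ne j k)

theorem map_succAbove_apply {p : ℕ} (j : Fin (p + 2)) (s : stdSimplex ℝ (Fin (p + 1)))
    (k : Fin (p + 1)) : stdSimplex.map j.succAbove s (j.succAbove k) = s k := by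
  rw [stdSimplex.map_coe, FunOnFinite.linearMap_apply_apply, Finset.sum_eq_single k]
  · intro l hl hlk
    exact absurd (Fin.succAbove_right_injective (Finset.mem_filter.1 hl).2) hlk
  · simp

/-- The point dividing the segment from the `0`-th vertex to the point `s` of the opposite face in
the ratio `t`, as a map on the product of the face with the unit interval. -/
def joinMap (p : ℕ) (s : stdSimplex ℝ (Fin (p + 1)) × unitInterval) :
    stdSimplex ℝ (Fin (p + 2)) :=
  ⟨Fin.cons s.2.1 fun j => (1 - s.2.1) * s.1 j, by
    constructor
    · refine Fin.cases s.2.2.1 fun j => ?_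
      simp only [Fin.cons_succ]
      exact mul_nonneg (sub_nonneg.2 s.2.2.2) (s.1.2.1 j)
    · rw [Fin.sum_univ_succ]
      simp only [Fin.cons_zero, Fin.cons_succ]
      rw [← Finset.mul_sum, stdSimplex.sum_eq_one s.1]
      ring⟩

theorem joinMap_succ (p : ℕ) (s : stdSimplex ℝ (Fin (p + 1)) × unitInterval) (j : Fin (p + 1)) :
    joinMap p s j.succ = (1 - s.2.1) * s.1 j := rfl

theorem continuous_joinMap (p : ℕ) : Continuous (joinMap p) := by
  refine Continuous.subtype_mk (continuous_pi fun j => ?_) _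
  refine Fin.cases ?_ (fun j => ?_) j
  · simp only [Fin.cons_zero]
    fun_prop
  · simp only [Fin.cons_succ]
    refine Continuous.mul (by fun_prop) ?_
    exact (continuous_apply j).comp (continuous_subtype_val.comp continuous_fst)

theorem joinMap_surjective (p : ℕ) : Function.Surjective (joinMap p) := by
  intro w
  have hw : w 0 + ∑ j : Fin (p + 1), w j.succ = 1 := by
    rw [← Fin.sum_univ_succ, stdSimplex.sum_eq_one w]
  by_cases h : w 0 = 1
  · refine ⟨(Classical.arbitrary _, ⟨w 0, stdSimplex.zero_le w 0, stdSimplex.le_one w 0⟩),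
      stdSimplex.ext (funext ?_)⟩
    refine Fin.cases rfl fun j => ?_
    rw [joinMap_succ]
    have h0 : ∑ j : Fin (p + 1), w j.succ = 0 := by linarith
    have := (Finset.sum_eq_zero_iff_of_nonneg fun j _ => stdSimplex.zero_le w (Fin.succ j)).1 h0 j
      (Finset.mem_univ j)
    rw [this]
    simp [h]
  · have h1 : 0 < 1 - w 0 := sub_pos.2 (lt_of_le_of_ne (stdSimplex.le_one w 0) h)
    refine ⟨(⟨fun j => w j.succ / (1 - w 0), fun j => div_nonneg (stdSimplex.zero_le w _) h1.le, ?_⟩,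
      ⟨w 0, stdSimplex.zero_le w 0, stdSimplex.le_one w 0⟩), stdSimplex.ext (funext ?_)⟩
    · rw [← Finset.sum_div, div_eq_one_iff_eq h1.ne']
      linarith
    · refine Fin.cases rfl fun j => ?_
      rw [joinMap_succ]
      exact mul_div_cancel₀ _ h1.ne'

theorem isQuotientMap_joinMap (p : ℕ) : IsQuotientMap (joinMap p) :=
  (continuous_joinMap p).isClosedMap.isQuotientMap (continuous_joinMap p) (joinMap_surjective p)

theorem joinMap_face_zero (p : ℕ) (s : stdSimplex ℝ (Fin (p + 1))) :
    stdSimplex.map (Fin.succAbove 0) s = joinMap p (s, 0) := by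
  refine stdSimplex.ext (funext (Fin.cases ?_ fun j => ?_))
  · rw [map_succAbove_apply_self]
    rfl
  · rw [joinMap_succ, ← Fin.succAbove_zero, map_succAbove_apply]
    simp

theorem joinMap_face_succ (p : ℕ) (s : stdSimplex ℝ (Fin (p + 1))) (t : unitInterval)
    (j : Fin (p + 2)) :
    stdSimplex.map j.succ.succAbove (joinMap p (s, t)) =
      joinMap (p + 1) (stdSimplex.map j.succAbove s, t) := by
  refine stdSimplex.ext (funext (Fin.cases ?_ fun k => ?_))
  · have h := map_succAbove_apply j.succ (joinMap p (s, t)) 0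
    rw [Fin.succ_succAbove_zero] at h
    rw [h]
    rfl
  · rw [joinMap_succ]
    rcases Fin.eq_self_or_eq_succAbove j k with rfl | ⟨l, rfl⟩
    · rw [map_succAbove_apply_self, map_succAbove_apply_self, mul_zero]
    · rw [← Fin.succ_succAbove_succ, map_succAbove_apply, map_succAbove_apply, joinMap_succ]

variable {q : X} (h : (ContinuousMap.id X).Homotopy (ContinuousMap.const X q))

/-- The cone of a singular simplex with respect to a contraction of the space. -/
def singularCone (p : ℕ) (σ : SingularSimplex X p) : SingularSimplex X (p + 1) :=
  IsQuotientMap.lift (f := ⟨joinMap p, continuous_joinMap p⟩) (isQuotientMap_joinMap p)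
    ⟨fun s : stdSimplex ℝ (Fin (p + 1)) × unitInterval => h (s.2, σ s.1), by fun_prop⟩ (by
      intro s s' hs
      change joinMap p s = joinMap p s' at hs
      change h (s.2, σ s.1) = h (s'.2, σ s'.1)
      have h0 : s.2 = s'.2 := Subtype.ext (congrArg (fun w : stdSimplex ℝ (Fin (p + 2)) => w 0) hs)
      by_cases h1 : s.2 = 1
      · rw [← h0, h1, h.apply_one, h.apply_one]
        rfl
      · have h2 : s.1 = s'.1 := by
          refine stdSimplex.ext (funext fun j => ?_)
          have := congrArg (fun w : stdSimplex ℝ (Fin (p + 2)) => w j.succ) hs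
          simp only [joinMap_succ, ← h0] at this
          exact mul_left_cancel₀ (sub_ne_zero.2 fun h3 => h1 (Subtype.ext h3.symm)) this
        rw [h0, h2])

theorem singularCone_joinMap (p : ℕ) (σ : SingularSimplex X p) (s : stdSimplex ℝ (Fin (p + 1)))
    (t : unitInterval) : singularCone h p σ (joinMap p (s, t)) = h (t, σ s) := by
  have h1 : ∀ (g : C(stdSimplex ℝ (Fin (p + 1)) × unitInterval, X)) hg,
      IsQuotientMap.lift (f := ⟨joinMap p, continuous_joinMap p⟩) (isQuotientMap_joinMap p) g hg
        (joinMap p (s, t)) = g (s, t) := fun g hg =>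
    ContinuousMap.congr_fun (IsQuotientMap.lift_comp
      (f := ⟨joinMap p, continuous_joinMap p⟩) (isQuotientMap_joinMap p) g hg) (s, t)
  exact h1 _ _

theorem singularCone_face_zero (p : ℕ) (σ : SingularSimplex X p) :
    SingularSimplex.face (singularCone h p σ) 0 = σ := by
  ext s
  change singularCone h p σ (stdSimplex.map (Fin.succAbove 0) s) = _
  rw [joinMap_face_zero, singularCone_joinMap, h.apply_zero]
  rfl

theorem singularCone_face_succ (p : ℕ) (σ : SingularSimplex X (p + 1)) (j : Fin (p + 2)) :
    SingularSimplex.face (singularCone h (p + 1) σ) j.succ =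
      singularCone h p (SingularSimplex.face σ j) := by
  ext w
  obtain ⟨⟨s, t⟩, rfl⟩ := joinMap_surjective p w
  change singularCone h (p + 1) σ (stdSimplex.map j.succ.succAbove _) = _
  rw [joinMap_face_succ, singularCone_joinMap, singularCone_joinMap]
  rfl

/-- Cycles of positive dimension of a contractible space are boundaries. -/
theorem exists_singularBoundary_eq [ContractibleSpace X] {p : ℕ} (z : SingularChain X (p + 1))
    (hz : singularBoundary X p z = 0) : ∃ y, singularBoundary X (p + 1) y = z := by
  obtain ⟨q, ⟨h⟩⟩ := id_nullhomotopic X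
  let c : ∀ p, SingularChain X p →ₗ[ℚ] SingularChain X (p + 1) := fun p =>
    Finsupp.lmapDomain ℚ ℚ (singularCone h p)
  have key : singularBoundary X (p + 1) ∘ₗ c (p + 1) + c p ∘ₗ singularBoundary X p =
      LinearMap.id := by
    ext1 σ
    ext1
    simp only [c, LinearMap.comp_apply, LinearMap.add_apply, Finsupp.lsingle_apply,
      Finsupp.lmapDomain_apply, Finsupp.mapDomain_single, LinearMap.id_apply,
      singularBoundary_single]
    rw [Fin.sum_univ_succ, singularCone_face_zero, ← Finsupp.lmapDomain_apply ℚ ℚ, map_sum,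
      add_assoc, ← Finset.sum_add_distrib, Finset.sum_eq_zero]
    · simp
    · intro j _
      rw [singularCone_face_succ, Finsupp.lmapDomain_apply, Finsupp.mapDomain_single,
        ← Finsupp.single_add, Fin.val_succ, pow_succ]
      simp
  have := LinearMap.congr_fun key z
  rw [LinearMap.add_apply, LinearMap.comp_apply, LinearMap.comp_apply, hz, map_zero, add_zero] at this
  exact ⟨_, this⟩

/-- The singular chains of `X` that lie in the subset `S`. -/
def singularChains (S : Set X) (p : ℕ) : Submodule ℚ (SingularChain X p) :=
  Finsupp.supported ℚ ℚ {σ | range σ ⊆ S}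

theorem single_mem_singularChains {S : Set X} {p : ℕ} {σ : SingularSimplex X p}
    (hσ : range σ ⊆ S) (a : ℚ) : Finsupp.single σ a ∈ singularChains S p :=
  Finsupp.single_mem_supported ℚ a hσ

theorem singularChains_mono {S T : Set X} (h : S ⊆ T) (p : ℕ) :
    singularChains S p ≤ singularChains T p :=
  Finsupp.supported_mono fun _ hσ => Subset.trans hσ h

theorem linearCombination_eq_zero_of_mem {S : Set X} {p : ℕ} {u : SingularSimplex X p → ℚ}
    (hu : ∀ σ : SingularSimplex X p, range σ ⊆ S → u σ = 0) {z : SingularChain X p}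
    (hz : z ∈ singularChains S p) : Finsupp.linearCombination ℚ u z = 0 := by
  rw [Finsupp.linearCombination_apply]
  exact Finset.sum_eq_zero fun σ hσ => by
    change z σ • u σ = 0
    rw [hu σ (hz hσ), smul_zero]

/-- Contractible subspaces are acyclic. -/
theorem exists_singularBoundary_eq_of_mem {S : Set X} [ContractibleSpace S] {p : ℕ}
    {z : SingularChain X (p + 1)} (hzS : z ∈ singularChains S (p + 1))
    (hz : singularBoundary X p z = 0) :
    ∃ y ∈ singularChains S (p + 2), singularBoundary X (p + 1) y = z := by
  classical
  let f : C(S, X) := ⟨Subtype.val, continuous_subtype_val⟩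
  have hf : Function.Injective f.comp (α := C(stdSimplex ℝ (Fin (p + 1)), S)) := by
    intro σ τ h
    ext s
    exact ContinuousMap.congr_fun h s
  obtain ⟨z', rfl⟩ : ∃ z', singularMap f (p + 1) z' = z := by
    have : z ∈ LinearMap.range (singularMap f (p + 1)) := by
      rw [← Finsupp.sum_single z]
      refine Submodule.sum_mem _ fun σ hσ => ?_
      refine ⟨Finsupp.single ⟨fun s => ⟨σ s, hzS hσ ⟨s, rfl⟩⟩, by fun_prop⟩ (z σ), ?_⟩
      rw [singularMap, Finsupp.lmapDomain_apply, Finsupp.mapDomain_single]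
      rfl
    exact this
  rw [singularBoundary_singularMap] at hz
  obtain ⟨y, hy⟩ := exists_singularBoundary_eq z' (Finsupp.mapDomain_injective hf (by
    change singularMap f p _ = singularMap f p 0
    rw [hz, map_zero]))
  refine ⟨singularMap f (p + 2) y, ?_, by rw [singularBoundary_singularMap, hy]⟩
  intro τ hτ
  rw [singularMap, Finsupp.lmapDomain_apply] at hτ
  obtain ⟨τ', -, rfl⟩ := Finset.mem_image.1 (Finsupp.mapDomain_support hτ)
  rintro _ ⟨s, rfl⟩
  exact (τ' s).2

/-- Two simplicial families of singular chains with the same contractible carriers give cohomologous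
cochains: `f₂` is the difference of the two families on triangles, and `f₁` is their difference on
edges, corrected so as to be a cycle. -/
theorem exists_coboundary_eq {E : Type} (good : ∀ {p : ℕ}, (Fin (p + 1) → E) → Prop)
    (hgood : ∀ v : Fin 3 → E, good v → ∀ j : Fin 3, good (v ∘ j.succAbove))
    (S : Finset E → Set X)
    (hS : ∀ (v : Fin 3 → E), good v → ∀ j : Fin 3, S (verts (v ∘ j.succAbove)) ⊆ S (verts v))
    (hS1 : ∀ e : Fin 2 → E, good e → ContractibleSpace (S (verts e)))
    (hS2 : ∀ v : Fin 3 → E, good v → ContractibleSpace (S (verts v)))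
    (f₁ : (Fin 2 → E) → SingularChain X 1) (f₂ : (Fin 3 → E) → SingularChain X 2)
    (hf₁ : ∀ e, good e → f₁ e ∈ singularChains (S (verts e)) 1)
    (hf₂ : ∀ v, good v → f₂ v ∈ singularChains (S (verts v)) 2)
    (hd₁ : ∀ e, good e → singularBoundary X 0 (f₁ e) = 0)
    (hd₂ : ∀ v, good v → singularBoundary X 1 (f₂ v) =
      ∑ j : Fin 3, (-1 : ℚ) ^ (j : ℕ) • f₁ (v ∘ j.succAbove))
    (x : SingularSimplex X 2 → ℚ)
    (hx : ∀ v : Fin 3 → E, good v → ∀ σ : SingularSimplex X 3, range σ ⊆ S (verts v) →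
      singularCoboundary x σ = 0) :
    ∃ η : (Fin 2 → E) → ℚ,
      (∀ e, ∃ y ∈ singularChains (S (verts e)) 2, η e = Finsupp.linearCombination ℚ x y) ∧
      ∀ v, good v → Finsupp.linearCombination ℚ x (f₂ v) = coboundary η v := by
  have h1 : ∀ e : Fin 2 → E, ∃ y ∈ singularChains (S (verts e)) 2,
      good e → singularBoundary X 1 y = f₁ e := by
    intro e
    by_cases he : good e
    · have := hS1 e he
      obtain ⟨y, hy, h⟩ := exists_singularBoundary_eq_of_mem (hf₁ e he) (hd₁ e he)
      exact ⟨y, hy, fun _ => h⟩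
    · exact ⟨0, zero_mem _, fun h => absurd h he⟩
  choose y hy hdy using h1
  refine ⟨fun e => Finsupp.linearCombination ℚ x (y e), fun e => ⟨y e, hy e, rfl⟩, fun v hv => ?_⟩
  have := hS2 v hv
  obtain ⟨w, hw, hdw⟩ := exists_singularBoundary_eq_of_mem (S := S (verts v))
    (z := f₂ v - ∑ j : Fin 3, (-1 : ℚ) ^ (j : ℕ) • y (v ∘ j.succAbove))
    (Submodule.sub_mem _ (hf₂ v hv) (Submodule.sum_mem _ fun j _ => Submodule.smul_mem _ _
      (singularChains_mono (hS v hv j) _ (hy _)))) (by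
      rw [map_sub, hd₂ v hv, map_sum, sub_eq_zero]
      exact Finset.sum_congr rfl fun j _ => by rw [map_smul, hdy _ (hgood v hv j)])
  have h2 : Finsupp.linearCombination ℚ x (singularBoundary X 2 w) = 0 := by
    rw [linearCombination_singularBoundary]
    exact linearCombination_eq_zero_of_mem (hx v hv) hw
  rw [hdw, map_sub, sub_eq_zero, map_sum] at h2
  rw [h2, coboundary]
  exact Finset.sum_congr rfl fun j _ => by rw [map_smul, smul_eq_mul]

end singular

/-! ### The topology of `ℙ¹` and `P^n` -/

section sphere

open OnePoint

theorem sphere_coe (z : ℂ) : sphere (z : OnePoint ℂ) =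
    ![2 * z.re / (‖z‖ ^ 2 + 1), 2 * z.im / (‖z‖ ^ 2 + 1), (‖z‖ ^ 2 - 1) / (‖z‖ ^ 2 + 1)] := rfl

theorem sphere_infty : sphere OnePoint.infty = ![0, 0, 1] := rfl

theorem contDiff_sphere_coe : ContDiff ℝ ω fun z : ℂ => sphere (z : OnePoint ℂ) := by
  have h1 : ContDiff ℝ ω fun z : ℂ => ‖z‖ ^ 2 := contDiff_norm_sq ℝ
  have h2 : ∀ z : ℂ, ‖z‖ ^ 2 + 1 ≠ 0 := fun z => by positivity
  rw [contDiff_pi]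
  intro j
  fin_cases j
  · exact ((contDiff_const.mul Complex.reCLM.contDiff).div (h1.add contDiff_const) h2)
  · exact ((contDiff_const.mul Complex.imCLM.contDiff).div (h1.add contDiff_const) h2)
  · exact (h1.sub contDiff_const).div (h1.add contDiff_const) h2

theorem continuous_sphere : Continuous sphere := by
  rw [continuous_iff_continuousAt]
  intro x
  induction x using OnePoint.rec with
  | coe z =>
    rw [continuousAt_coe]
    exact contDiff_sphere_coe.continuous.continuousAt
  | infty =>
    rw [continuousAt_infty', Filter.coclosedCompact_eq_cocompact, ← Metric.cobounded_eq_cocompact]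
    have hn : Filter.Tendsto (fun z : ℂ => ‖z‖⁻¹) (Bornology.cobounded ℂ) (𝓝 0) :=
      tendsto_inv_atTop_zero.comp tendsto_norm_cobounded_atTop
    have h2n : Filter.Tendsto (fun z : ℂ => 2 * ‖z‖⁻¹) (Bornology.cobounded ℂ) (𝓝 0) := by
      simpa using hn.const_mul 2
    have hne : ∀ᶠ z : ℂ in Bornology.cobounded ℂ, 1 ≤ ‖z‖ :=
      tendsto_norm_cobounded_atTop.eventually_ge_atTop 1
    have hb : ∀ a b : ℝ, 1 ≤ b → |a| ≤ b → ‖2 * a / (b ^ 2 + 1)‖ ≤ 2 * b⁻¹ := by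
      intro a b hb hab
      have hb0 : 0 < b := by linarith
      rw [Real.norm_eq_abs, abs_div, abs_mul, abs_of_pos (by positivity : (0 : ℝ) < b ^ 2 + 1),
        ← div_eq_mul_inv, div_le_div_iff₀ (by positivity) hb0, abs_of_pos (two_pos : (0 : ℝ) < 2)]
      nlinarith
    rw [tendsto_pi_nhds]
    intro j
    fin_cases j
    · exact squeeze_zero_norm' (hne.mono fun z hz => hb _ _ hz (Complex.abs_re_le_norm z)) h2n
    · exact squeeze_zero_norm' (hne.mono fun z hz => hb _ _ hz (Complex.abs_im_le_norm z)) h2n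
    · have h3 : Filter.Tendsto (fun z : ℂ => 1 - 2 * 1 / (‖z‖ ^ 2 + 1)) (Bornology.cobounded ℂ)
          (𝓝 (1 - 0)) :=
        tendsto_const_nhds.sub
          (squeeze_zero_norm' (hne.mono fun z hz => hb 1 _ hz (by simpa using hz)) h2n)
      rw [sub_zero] at h3
      refine h3.congr fun z => ?_
      have h4 : ‖z‖ ^ 2 + 1 ≠ 0 := by positivity
      change _ = (‖z‖ ^ 2 - 1) / (‖z‖ ^ 2 + 1)
      field_simp
      ring

theorem sphere_coe_two_ne_one (z : ℂ) : sphere (z : OnePoint ℂ) 2 ≠ 1 := by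
  rw [sphere_coe]
  change (‖z‖ ^ 2 - 1) / (‖z‖ ^ 2 + 1) ≠ 1
  intro h
  rw [div_eq_one_iff_eq (by positivity)] at h
  linarith

theorem sphere_injective : Function.Injective sphere := by
  intro x y h
  induction x using OnePoint.rec with
  | infty =>
    induction y using OnePoint.rec with
    | infty => rfl
    | coe w => exact absurd (congrFun h 2).symm (sphere_coe_two_ne_one w)
  | coe z =>
    induction y using OnePoint.rec with
    | infty => exact absurd (congrFun h 2) (sphere_coe_two_ne_one z)
    | coe w =>
      have hz : (0 : ℝ) < ‖z‖ ^ 2 + 1 := by positivity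
      have hw : (0 : ℝ) < ‖w‖ ^ 2 + 1 := by positivity
      have h2 : (‖z‖ ^ 2 - 1) / (‖z‖ ^ 2 + 1) = (‖w‖ ^ 2 - 1) / (‖w‖ ^ 2 + 1) := congrFun h 2
      have h3 : ‖z‖ ^ 2 = ‖w‖ ^ 2 := by
        rw [div_eq_div_iff hz.ne' hw.ne'] at h2
        linarith
      have h0 : 2 * z.re / (‖z‖ ^ 2 + 1) = 2 * w.re / (‖w‖ ^ 2 + 1) := congrFun h 0
      have h1 : 2 * z.im / (‖z‖ ^ 2 + 1) = 2 * w.im / (‖w‖ ^ 2 + 1) := congrFun h 1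
      rw [h3, div_left_inj' hw.ne'] at h0 h1
      congr 1
      exact Complex.ext (by linarith) (by linarith)

theorem isEmbedding_sphere : IsEmbedding sphere :=
  (continuous_sphere.isClosedEmbedding sphere_injective).isEmbedding

theorem continuous_iff_sphere {X : Type} [TopologicalSpace X] {f : X → OnePoint ℂ} :
    Continuous f ↔ Continuous fun x => sphere (f x) :=
  isEmbedding_sphere.continuous_iff

/-- The inversion `z ↦ 1 / z` of `ℙ¹`. -/
def inversion (x : OnePoint ℂ) : OnePoint ℂ :=
  x.elim ((0 : ℂ) : OnePoint ℂ) fun z => if z = 0 then OnePoint.infty else ((z⁻¹ : ℂ) : OnePoint ℂ)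

theorem inversion_infty : inversion OnePoint.infty = ((0 : ℂ) : OnePoint ℂ) := rfl

theorem inversion_zero : inversion ((0 : ℂ) : OnePoint ℂ) = OnePoint.infty := if_pos rfl

theorem inversion_coe {z : ℂ} (hz : z ≠ 0) :
    inversion (z : OnePoint ℂ) = ((z⁻¹ : ℂ) : OnePoint ℂ) := if_neg hz

theorem inversion_involutive : Function.Involutive inversion := by
  intro x
  induction x using OnePoint.rec with
  | infty => rw [inversion_infty, inversion_zero]
  | coe z =>
    by_cases hz : z = 0
    · rw [hz, inversion_zero, inversion_infty]
    · rw [inversion_coe hz, inversion_coe (inv_ne_zero hz), inv_inv]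

theorem sphere_inversion (x : OnePoint ℂ) :
    sphere (inversion x) = ![sphere x 0, -sphere x 1, -sphere x 2] := by
  induction x using OnePoint.rec with
  | infty => simp [inversion_infty, sphere_infty, sphere_coe]
  | coe z =>
    by_cases hz : z = 0
    · subst hz
      simp [inversion_zero, sphere_infty, sphere_coe]
    · have h1 : (0 : ℝ) < ‖z‖ := norm_pos_iff.2 hz
      have h2 : ‖z‖ ^ 2 + 1 ≠ 0 := by positivity
      have h3 : Complex.normSq z = ‖z‖ ^ 2 := Complex.normSq_eq_norm_sq z
      rw [inversion_coe hz, sphere_coe, sphere_coe, norm_inv, Complex.inv_re, Complex.inv_im, h3]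
      refine funext fun j => ?_
      fin_cases j
      · change 2 * (z.re / ‖z‖ ^ 2) / (‖z‖⁻¹ ^ 2 + 1) = 2 * z.re / (‖z‖ ^ 2 + 1)
        field_simp
        ring
      · change 2 * (-z.im / ‖z‖ ^ 2) / (‖z‖⁻¹ ^ 2 + 1) = -(2 * z.im / (‖z‖ ^ 2 + 1))
        field_simp
        ring
      · change (‖z‖⁻¹ ^ 2 - 1) / (‖z‖⁻¹ ^ 2 + 1) = -((‖z‖ ^ 2 - 1) / (‖z‖ ^ 2 + 1))
        field_simp
        ring

/-- The coordinate of `ℙ¹` that vanishes at the given pole: `z` or `1 / z`, as a self-homeomorphism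
of `ℙ¹`. -/
def Pole.coord (α : Pole) : OnePoint ℂ ≃ₜ OnePoint ℂ :=
  match α with
  | .zero => Homeomorph.refl _
  | .infty =>
    { toEquiv := inversion_involutive.toPerm
      continuous_toFun := by
        refine continuous_iff_sphere.2 ?_
        change Continuous fun x => sphere (inversion x)
        have h := fun j => (continuous_apply j).comp continuous_sphere
        simp only [sphere_inversion]
        refine continuous_pi fun j => ?_
        fin_cases j
        · exact h 0
        · exact (h 1).neg
        · exact (h 2).neg
      continuous_invFun := by
        refine continuous_iff_sphere.2 ?_
        change Continuous fun x => sphere (inversion x)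
        have h := fun j => (continuous_apply j).comp continuous_sphere
        simp only [sphere_inversion]
        refine continuous_pi fun j => ?_
        fin_cases j
        · exact h 0
        · exact (h 1).neg
        · exact (h 2).neg }

theorem Pole.coord_eq_zero_iff {α : Pole} {x : OnePoint ℂ} :
    α.coord x = ((0 : ℂ) : OnePoint ℂ) ↔ x = α.pt := by
  cases α with
  | zero => rfl
  | infty =>
    change inversion x = _ ↔ x = OnePoint.infty
    rw [← inversion_infty]
    exact inversion_involutive.injective.eq_iff

theorem localCoord_eq {α : Pole} {x : OnePoint ℂ} {z : ℂ} (h : α.coord x = (z : OnePoint ℂ)) :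
    localCoord α x = z := by
  cases α with
  | zero =>
    obtain rfl : x = z := h
    rfl
  | infty =>
    obtain rfl : x = inversion z := inversion_involutive.eq_iff.1 h
    by_cases hz : z = 0
    · subst hz
      rw [inversion_zero]
      rfl
    · rw [inversion_coe hz]
      exact inv_inv z

theorem mem_tube_iff {n : ℕ} {i : Fin n} {α : Pole} {p : PP n} :
    p ∈ tube i α ↔ ∃ z : ℂ, α.coord (p i) = (z : OnePoint ℂ) ∧ ‖z‖ < 1 := by
  cases α with
  | zero => rfl
  | infty =>
    change (p i = OnePoint.infty ∨ ∃ z : ℂ, p i = z ∧ 1 < ‖z‖) ↔ ∃ z : ℂ, inversion (p i) = z ∧ ‖z‖ < 1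
    constructor
    · rintro (h | ⟨z, h, hz⟩)
      · exact ⟨0, by rw [h, inversion_infty], by simp⟩
      · have hz0 : z ≠ 0 := by
          rintro rfl
          norm_num at hz
        exact ⟨z⁻¹, by rw [h, inversion_coe hz0], by
          rw [norm_inv]
          exact inv_lt_one_of_one_lt₀ hz⟩
    · rintro ⟨z, h, hz⟩
      by_cases hz0 : z = 0
      · left
        rw [hz0] at h
        exact Pole.coord_eq_zero_iff (α := .infty).1 h
      · right
        refine ⟨z⁻¹, ?_, ?_⟩
        · rw [← inversion_coe hz0]
          exact inversion_involutive.eq_iff.1 h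
        · rw [norm_inv]
          exact (one_lt_inv₀ (norm_pos_iff.2 hz0)).2 hz

theorem mem_divH_iff {n : ℕ} {i : Fin n} {α : Pole} {p : PP n} :
    p ∈ divH i α ↔ α.coord (p i) = ((0 : ℂ) : OnePoint ℂ) :=
  Pole.coord_eq_zero_iff.symm

theorem isOpen_tube {n : ℕ} (i : Fin n) (α : Pole) : IsOpen (tube i α) := by
  have h : tube i α = (fun p : PP n => α.coord (p i)) ⁻¹' ((↑) '' Metric.ball (0 : ℂ) 1) := by
    ext p
    rw [mem_tube_iff]
    constructor
    · rintro ⟨z, h, hz⟩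
      exact ⟨z, by simpa using hz, h.symm⟩
    · rintro ⟨z, hz, h⟩
      exact ⟨z, h.symm, by simpa using hz⟩
  rw [h]
  exact (isOpenEmbedding_coe.isOpenMap _ Metric.isOpen_ball).preimage
    (α.coord.continuous.comp (continuous_apply i))

theorem isClosed_divH {n : ℕ} (i : Fin n) (α : Pole) : IsClosed (divH i α : Set (PP n)) :=
  isClosed_singleton.preimage (continuous_apply i)

/-- Multiplication of a point of `ℙ¹` by a positive real number. -/
def scale (r : ℝ) (x : OnePoint ℂ) : OnePoint ℂ :=
  x.elim OnePoint.infty fun z => ((r * z : ℂ) : OnePoint ℂ)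

theorem sphere_scale {r : ℝ} (hr : 0 < r) (x : OnePoint ℂ) :
    sphere (scale r x) =
      ![2 * r * sphere x 0 / (r ^ 2 * (1 + sphere x 2) + (1 - sphere x 2)),
        2 * r * sphere x 1 / (r ^ 2 * (1 + sphere x 2) + (1 - sphere x 2)),
        (r ^ 2 * (1 + sphere x 2) - (1 - sphere x 2)) /
          (r ^ 2 * (1 + sphere x 2) + (1 - sphere x 2))] := by
  induction x using OnePoint.rec with
  | infty =>
    have h : r ^ 2 * (1 + 1) ≠ 0 := by positivity
    change sphere OnePoint.infty = _
    simp [sphere_infty, div_self h]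
  | coe z =>
    change sphere ((r * z : ℂ) : OnePoint ℂ) = _
    rw [sphere_coe, sphere_coe]
    have h1 : (0 : ℝ) < ‖z‖ ^ 2 + 1 := by positivity
    have h2 : ‖(r * z : ℂ)‖ ^ 2 = r ^ 2 * ‖z‖ ^ 2 := by
      rw [norm_mul, mul_pow, Complex.norm_real, Real.norm_eq_abs, sq_abs]
    have h3 : (0 : ℝ) < r ^ 2 * ‖z‖ ^ 2 + 1 := by positivity
    have h4 : r ^ 2 * (1 + (‖z‖ ^ 2 - 1) / (‖z‖ ^ 2 + 1)) + (1 - (‖z‖ ^ 2 - 1) / (‖z‖ ^ 2 + 1)) =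
        2 * (r ^ 2 * ‖z‖ ^ 2 + 1) / (‖z‖ ^ 2 + 1) := by
      field_simp
      ring
    have h5 : r ^ 2 * (1 + (‖z‖ ^ 2 - 1) / (‖z‖ ^ 2 + 1)) - (1 - (‖z‖ ^ 2 - 1) / (‖z‖ ^ 2 + 1)) =
        2 * (r ^ 2 * ‖z‖ ^ 2 - 1) / (‖z‖ ^ 2 + 1) := by
      field_simp
      ring
    rw [h2]
    refine funext fun j => ?_
    fin_cases j
    · change 2 * ((r * z : ℂ)).re / (r ^ 2 * ‖z‖ ^ 2 + 1) = 2 * r * (2 * z.re / (‖z‖ ^ 2 + 1)) /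
        (r ^ 2 * (1 + (‖z‖ ^ 2 - 1) / (‖z‖ ^ 2 + 1)) + (1 - (‖z‖ ^ 2 - 1) / (‖z‖ ^ 2 + 1)))
      rw [h4, Complex.re_ofReal_mul]
      field_simp
    · change 2 * ((r * z : ℂ)).im / (r ^ 2 * ‖z‖ ^ 2 + 1) = 2 * r * (2 * z.im / (‖z‖ ^ 2 + 1)) /
        (r ^ 2 * (1 + (‖z‖ ^ 2 - 1) / (‖z‖ ^ 2 + 1)) + (1 - (‖z‖ ^ 2 - 1) / (‖z‖ ^ 2 + 1)))
      rw [h4, Complex.im_ofReal_mul]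
      field_simp
    · change (r ^ 2 * ‖z‖ ^ 2 - 1) / (r ^ 2 * ‖z‖ ^ 2 + 1) =
        (r ^ 2 * (1 + (‖z‖ ^ 2 - 1) / (‖z‖ ^ 2 + 1)) - (1 - (‖z‖ ^ 2 - 1) / (‖z‖ ^ 2 + 1))) /
        (r ^ 2 * (1 + (‖z‖ ^ 2 - 1) / (‖z‖ ^ 2 + 1)) + (1 - (‖z‖ ^ 2 - 1) / (‖z‖ ^ 2 + 1)))
      rw [h4, h5]
      field_simp

theorem abs_sphere_two_le (x : OnePoint ℂ) : |sphere x 2| ≤ 1 := by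
  induction x using OnePoint.rec with
  | infty =>
    change |(1 : ℝ)| ≤ 1
    simp
  | coe z =>
    change |(‖z‖ ^ 2 - 1) / (‖z‖ ^ 2 + 1)| ≤ 1
    have h1 : (0 : ℝ) < ‖z‖ ^ 2 + 1 := by positivity
    rw [abs_div, abs_of_pos h1, div_le_one h1, abs_le]
    constructor <;> nlinarith [sq_nonneg ‖z‖]

theorem continuous_scale {X : Type} [TopologicalSpace X] {r : X → ℝ} (hr : Continuous r)
    (hr0 : ∀ x, 0 < r x) {f : X → OnePoint ℂ} (hf : Continuous f) :
    Continuous fun x => scale (r x) (f x) := by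
  have h := fun j => (continuous_apply j).comp (continuous_sphere.comp hf)
  have hN : ∀ x, r x ^ 2 * (1 + sphere (f x) 2) + (1 - sphere (f x) 2) ≠ 0 := by
    intro x
    have h1 := abs_le.1 (abs_sphere_two_le (f x))
    have h2 : 0 < r x ^ 2 := pow_pos (hr0 x) 2
    rcases h1.2.lt_or_eq with h3 | h3
    · have : 0 ≤ r x ^ 2 * (1 + sphere (f x) 2) := mul_nonneg h2.le (by linarith)
      exact ne_of_gt (by linarith)
    · rw [h3]
      exact ne_of_gt (by linarith)
  have hNc : Continuous fun x => r x ^ 2 * (1 + sphere (f x) 2) + (1 - sphere (f x) 2) :=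
    ((hr.pow 2).mul (continuous_const.add (h 2))).add (continuous_const.sub (h 2))
  rw [continuous_iff_sphere]
  simp only [sphere_scale (hr0 _)]
  refine continuous_pi fun j => ?_
  fin_cases j
  · exact ((continuous_const.mul hr).mul (h 0)).div hNc hN
  · exact ((continuous_const.mul hr).mul (h 1)).div hNc hN
  · exact (((hr.pow 2).mul (continuous_const.add (h 2))).sub (continuous_const.sub (h 2))).div hNc hN

variable {n : ℕ} (i : Fin n) (α : Pole)

/-- The homotopy that shrinks the `i`-th coordinate, in the coordinate at the given pole, by a factor
that grows from `1 / 2` to `1`. -/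
def shrink : C(PP n × unitInterval, PP n) where
  toFun x := Function.update x.1 i (α.coord.symm (scale ((1 + x.2.1) / 2) (α.coord (x.1 i))))
  continuous_toFun := by
    refine continuous_fst.update i (α.coord.symm.continuous.comp (continuous_scale ?_ ?_ ?_))
    · fun_prop
    · intro x
      have := x.2.2.1
      positivity
    · exact α.coord.continuous.comp ((continuous_apply i).comp continuous_fst)

theorem coord_shrink (p : PP n) (t : unitInterval) :
    α.coord (shrink i α (p, t) i) = scale ((1 + t.1) / 2) (α.coord (p i)) := by
  change α.coord (Function.update p i (α.coord.symm (scale ((1 + t.1) / 2) (α.coord (p i)))) i) = _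
  rw [Function.update_self, Homeomorph.apply_symm_apply]

theorem shrink_one (p : PP n) : shrink i α (p, 1) = p := by
  have h : ∀ x : OnePoint ℂ, scale ((1 + ((1 : unitInterval) : ℝ)) / 2) x = x := by
    intro x
    induction x using OnePoint.rec with
    | infty => rfl
    | coe z =>
      change (((((1 + ((1 : unitInterval) : ℝ)) / 2 : ℝ) : ℂ) * z : ℂ) : OnePoint ℂ) = z
      norm_num
  change Function.update p i (α.coord.symm (scale ((1 + ((1 : unitInterval) : ℝ)) / 2)
    (α.coord (p i)))) = p
  rw [h, Homeomorph.symm_apply_apply, Function.update_eq_self]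

theorem shrink_mem_divH_iff {p : PP n} {t : unitInterval} :
    shrink i α (p, t) ∈ divH i α ↔ p ∈ divH i α := by
  rw [mem_divH_iff, mem_divH_iff, coord_shrink]
  have ht : (0 : ℝ) < (1 + t.1) / 2 := by
    have := t.2.1
    positivity
  generalize α.coord (p i) = x
  induction x using OnePoint.rec with
  | infty => rfl
  | coe z =>
    change ((((1 + t.1) / 2 : ℝ) * z : ℂ) : OnePoint ℂ) = _ ↔ _
    rw [OnePoint.coe_eq_coe, OnePoint.coe_eq_coe, mul_eq_zero,
      or_iff_right (Complex.ofReal_ne_zero.2 ht.ne')]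

theorem shrink_zero_mem_tube {p : PP n}
    (hp : ∃ z : ℂ, α.coord (p i) = (z : OnePoint ℂ) ∧ ‖z‖ ≤ 1) :
    shrink i α (p, 0) ∈ tube i α := by
  obtain ⟨z, hz, hz1⟩ := hp
  rw [mem_tube_iff, coord_shrink, hz]
  refine ⟨_, rfl, ?_⟩
  rw [norm_mul, Complex.norm_real]
  norm_num
  linarith

end sphere

/-! ### One-dimensional cochains with a potential -/

section paths

variable {X : Type} [TopologicalSpace X]

/-- The affine singular simplex with given vertices. -/
def affineSimplex {E : Type} [AddCommGroup E] [Module ℝ E] [TopologicalSpace E]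
    [ContinuousAdd E] [ContinuousSMul ℝ E] {p : ℕ} (v : Fin (p + 1) → E) : SingularSimplex E p where
  toFun s := ∑ j, s j • v j
  continuous_toFun := continuous_finsetSum _ fun j _ =>
    ((continuous_apply j).comp continuous_subtype_val).smul continuous_const

theorem sum_map_succAbove_smul {E : Type} [AddCommGroup E] [Module ℝ E] {p : ℕ}
    (v : Fin (p + 2) → E) (j : Fin (p + 2)) (s : stdSimplex ℝ (Fin (p + 1))) :
    ∑ k, stdSimplex.map j.succAbove s k • v k = ∑ k, s k • v (j.succAbove k) := by
  rw [Fin.sum_univ_succAbove _ j, map_succAbove_apply_self, zero_smul, zero_add]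
  exact Finset.sum_congr rfl fun k _ => by rw [map_succAbove_apply]

theorem affineSimplex_face {E : Type} [AddCommGroup E] [Module ℝ E] [TopologicalSpace E]
    [ContinuousAdd E] [ContinuousSMul ℝ E] {p : ℕ} (v : Fin (p + 2) → E) (j : Fin (p + 2)) :
    SingularSimplex.face (affineSimplex v) j = affineSimplex (v ∘ j.succAbove) := by
  ext1 s
  exact sum_map_succAbove_smul v j s

theorem SingularSimplex.continuous_path (σ : SingularSimplex X 1) : Continuous σ.path :=
  σ.continuous.comp (stdSimplexHomeomorphUnitInterval.symm.continuous.comp continuous_projIcc)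

theorem SingularSimplex.path_apply_one (σ : SingularSimplex X 1) (s : stdSimplex ℝ (Fin 2)) :
    σ.path (s 1) = σ s := by
  have h : projIcc (0 : ℝ) 1 zero_le_one (s 1) = stdSimplexHomeomorphUnitInterval s :=
    projIcc_of_mem zero_le_one ⟨stdSimplex.zero_le s 1, stdSimplex.le_one s 1⟩
  rw [SingularSimplex.path, h, Homeomorph.symm_apply_apply]

theorem SingularSimplex.path_mem_range (σ : SingularSimplex X 1) (t : ℝ) : σ.path t ∈ range σ :=
  ⟨_, rfl⟩

theorem SingularSimplex.face_zero_eq (σ : SingularSimplex X 1) :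
    SingularSimplex.face σ 0 = ContinuousMap.const _ (σ.path 1) := by
  ext s
  change σ (stdSimplex.map (Fin.succAbove 0) s) = σ.path 1
  rw [← σ.path_apply_one]
  have := map_succAbove_apply (p := 0) 0 s 0
  rw [Fin.succAbove_zero, Fin.succ_zero_eq_one] at this
  have h1 := stdSimplex.sum_eq_one s
  rw [Fin.sum_univ_one] at h1
  rw [Fin.succAbove_zero, this, h1]

theorem SingularSimplex.face_one_eq (σ : SingularSimplex X 1) :
    SingularSimplex.face σ 1 = ContinuousMap.const _ (σ.path 0) := by
  ext s
  change σ (stdSimplex.map (Fin.succAbove 1) s) = σ.path 0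
  rw [← σ.path_apply_one, map_succAbove_apply_self]

theorem singularBoundary_single_one (σ : SingularSimplex X 1) :
    singularBoundary X 0 (Finsupp.single σ 1) =
      Finsupp.single (ContinuousMap.const _ (σ.path 1)) 1 -
        Finsupp.single (ContinuousMap.const _ (σ.path 0)) 1 := by
  rw [singularBoundary_single, Fin.sum_univ_two, SingularSimplex.face_zero_eq,
    SingularSimplex.face_one_eq]
  simp [sub_eq_add_neg]

theorem singularCoboundary_two (c : SingularSimplex X 1 → ℚ) (σ : SingularSimplex X 2) :
    singularCoboundary c σ = c (SingularSimplex.face σ 0) - c (SingularSimplex.face σ 1) +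
      c (SingularSimplex.face σ 2) := by
  rw [singularCoboundary, Fin.sum_univ_three]
  simp [sub_eq_add_neg]

theorem range_comp_subset {Y : Type} [TopologicalSpace Y] {p : ℕ} (f : C(X, Y))
    (σ : SingularSimplex X p) : range (f.comp σ) ⊆ range f := by
  rintro _ ⟨s, rfl⟩
  exact ⟨σ s, rfl⟩

theorem path_comp_affineSimplex {E : Type} [AddCommGroup E] [Module ℝ E] [TopologicalSpace E]
    [ContinuousAdd E] [ContinuousSMul ℝ E] (f : C(E, X)) (a b : E) {t : ℝ} (ht : t ∈ Icc (0 : ℝ) 1) :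
    SingularSimplex.path (f.comp (affineSimplex ![a, b])) t = f ((1 - t) • a + t • b) := by
  rw [SingularSimplex.path, projIcc_of_mem zero_le_one ht]
  change f (∑ j, (stdSimplexHomeomorphUnitInterval.symm ⟨t, ht⟩) j • ![a, b] j) = _
  rw [Fin.sum_univ_two]
  rfl

/-- A closed `1`-cochain that is locally given by the differences of the values of a function is
given by these differences. -/
theorem eq_sub_of_locally_eq_sub {U : Set X} {c : SingularSimplex X 1 → ℚ}
    (hc : ∀ σ : SingularSimplex X 2, range σ ⊆ U → singularCoboundary c σ = 0) {F : X → ℂ}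
    (hF : ∀ p ∈ U, ∃ S ∈ 𝓝 p, ∀ σ : SingularSimplex X 1, range σ ⊆ S →
      (c σ : ℂ) = F (σ.path 1) - F (σ.path 0))
    (σ : SingularSimplex X 1) (hσ : range σ ⊆ U) :
    (c σ : ℂ) = F (σ.path 1) - F (σ.path 0) := by
  let γ : C(ℝ, X) := ⟨σ.path, σ.continuous_path⟩
  let e : ℝ → ℝ → SingularSimplex X 1 := fun a b => γ.comp (affineSimplex ![a, b])
  have hγ : range γ ⊆ U := by
    rintro _ ⟨t, rfl⟩
    exact hσ (σ.path_mem_range t)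
  have hadd : ∀ a b d, c (e b d) - c (e a d) + c (e a b) = 0 := by
    intro a b d
    have h := hc (γ.comp (affineSimplex ![a, b, d])) ((range_comp_subset _ _).trans hγ)
    rw [singularCoboundary_two] at h
    have hf : ∀ j, SingularSimplex.face (γ.comp (affineSimplex ![a, b, d])) j =
        γ.comp (affineSimplex (![a, b, d] ∘ j.succAbove)) := by
      intro j
      rw [← affineSimplex_face]
      rfl
    rw [hf, hf, hf] at h
    convert h using 6 <;>
    · ext k
      fin_cases k <;> rfl
  have hpath : ∀ a b, (e a b).path 0 = γ a ∧ (e a b).path 1 = γ b := by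
    intro a b
    constructor
    · rw [path_comp_affineSimplex γ a b ⟨le_rfl, zero_le_one⟩]
      simp
    · rw [path_comp_affineSimplex γ a b ⟨zero_le_one, le_rfl⟩]
      simp
  have hloc : IsLocallyConstant fun t => (c (e 0 t) : ℂ) - F (γ t) := by
    rw [IsLocallyConstant.iff_eventually_eq]
    intro t₀
    obtain ⟨S, hS, hSF⟩ := hF (γ t₀) (hγ ⟨t₀, rfl⟩)
    obtain ⟨r, hr, hrS⟩ := Metric.mem_nhds_iff.1 (γ.continuous.continuousAt.preimage_mem_nhds hS)
    filter_upwards [Metric.ball_mem_nhds t₀ hr] with t ht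
    have h1 := hSF (e t₀ t) (by
      rintro _ ⟨s, rfl⟩
      refine hrS ?_
      change (∑ j, s j • ![t₀, t] j) ∈ _
      refine (convex_ball t₀ r).sum_mem (fun j _ => stdSimplex.zero_le s j)
        (stdSimplex.sum_eq_one s) fun j _ => ?_
      fin_cases j
      · exact Metric.mem_ball_self hr
      · exact ht)
    rw [(hpath _ _).1, (hpath _ _).2] at h1
    have h2 : (c (e 0 t) : ℂ) = c (e t₀ t) + c (e 0 t₀) := by
      exact_mod_cast (by linarith [hadd 0 t₀ t] : c (e 0 t) = c (e t₀ t) + c (e 0 t₀))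
    rw [h2, h1]
    ring
  have h1 := hloc.apply_eq_of_isPreconnected isPreconnected_univ (mem_univ (1 : ℝ)) (mem_univ 0)
  have h2 : c (e 0 0) = 0 := by linarith [hadd 0 0 0]
  have h3 : e 0 1 = σ := by
    ext s
    change σ.path (∑ j, s j • ![(0 : ℝ), 1] j) = σ s
    rw [← σ.path_apply_one, Fin.sum_univ_two]
    simp
  simp only [h2, h3] at h1
  change (c σ : ℂ) - F (σ.path 1) = ((0 : ℚ) : ℂ) - F (σ.path 0) at h1
  push_cast at h1
  linear_combination h1

theorem contDiff_sphere_coord_symm (α : Pole) :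
    ContDiff ℝ ω fun z : ℂ => sphere (α.coord.symm (z : OnePoint ℂ)) := by
  cases α with
  | zero => exact contDiff_sphere_coe
  | infty =>
    change ContDiff ℝ ω fun z : ℂ => sphere (inversion (z : OnePoint ℂ))
    simp only [sphere_inversion]
    have h := contDiff_pi.1 contDiff_sphere_coe
    rw [contDiff_pi]
    intro j
    fin_cases j
    · exact h 0
    · exact (h 1).neg
    · exact (h 2).neg

/-- Every point of `P^n` has arbitrarily small contractible neighbourhoods in which any two points
are joined by a smooth path. -/
theorem exists_contractible_nhd {n : ℕ} {U : Set (PP n)} {p : PP n} (hU : U ∈ 𝓝 p) :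
    ∃ S ∈ 𝓝 p, S ⊆ U ∧ ContractibleSpace S ∧ ∀ x ∈ S, ∀ y ∈ S,
      ∃ τ : SingularSimplex (PP n) 1, range τ ⊆ S ∧ IsSmooth τ ∧ τ.path 0 = x ∧ τ.path 1 = y := by
  have hcoord : ∀ x : OnePoint ℂ, ∃ (β : Pole) (z : ℂ), β.coord.symm (z : OnePoint ℂ) = x := by
    intro x
    induction x using OnePoint.rec with
    | infty => exact ⟨.infty, 0, inversion_zero⟩
    | coe z => exact ⟨.zero, z, rfl⟩
  choose β z hβ using fun j => hcoord (p j)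
  let Ψ : (Fin n → ℂ) → PP n := Pi.map fun j (w : ℂ) => (β j).coord.symm (w : OnePoint ℂ)
  have hΨ : IsOpenEmbedding Ψ := IsOpenEmbedding.piMap fun j =>
    (β j).coord.symm.isOpenEmbedding.comp OnePoint.isOpenEmbedding_coe
  have hp : Ψ z = p := funext hβ
  obtain ⟨r, hr, hrU⟩ := Metric.mem_nhds_iff.1 (hΨ.continuous.continuousAt.preimage_mem_nhds
    (hp.symm ▸ hU : U ∈ 𝓝 (Ψ z)))
  refine ⟨Ψ '' Metric.ball z r, hp ▸ hΨ.isOpenMap.image_mem_nhds (Metric.ball_mem_nhds z hr),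
    image_subset_iff.2 hrU, ?_, ?_⟩
  · have := (convex_ball z r).contractibleSpace ⟨z, Metric.mem_ball_self hr⟩
    exact (hΨ.isEmbedding.homeomorphImage (Metric.ball z r)).symm.contractibleSpace
  · rintro _ ⟨a, ha, rfl⟩ _ ⟨b, hb, rfl⟩
    let τ : SingularSimplex (PP n) 1 := (⟨Ψ, hΨ.continuous⟩ : C(_, _)).comp (affineSimplex ![a, b])
    have hτ : ∀ t ∈ Icc (0 : ℝ) 1, τ.path t = Ψ ((1 - t) • a + t • b) := fun t ht =>
      path_comp_affineSimplex _ a b ht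
    refine ⟨τ, ?_, ?_, ?_, ?_⟩
    · rintro _ ⟨s, rfl⟩
      refine ⟨∑ j, s j • ![a, b] j, ?_, rfl⟩
      refine (convex_ball z r).sum_mem (fun j _ => stdSimplex.zero_le s j)
        (stdSimplex.sum_eq_one s) fun j _ => ?_
      fin_cases j
      · exact ha
      · exact hb
    · have h : ContDiff ℝ ω fun t : ℝ => embed (Ψ ((1 - t) • a + t • b)) := by
        rw [contDiff_pi]
        rintro ⟨j, k⟩
        have h1 : ContDiff ℝ ω fun t : ℝ => (1 - t) • a j + t • b j :=
          ((contDiff_const.sub contDiff_id).smul contDiff_const).add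
            (contDiff_id.smul contDiff_const)
        exact (contDiff_pi.1 (contDiff_sphere_coord_symm (β j)) k).comp h1
      exact (h.of_le le_top).contDiffOn.congr fun t ht => by rw [hτ t ht]
    · rw [hτ 0 ⟨le_rfl, zero_le_one⟩]
      simp
    · rw [hτ 1 ⟨zero_le_one, le_rfl⟩]
      simp

/-- A closed rational `1`-cochain on an open subset of `P^n` that is given on smooth paths by the
differences of the values of a complex function is the coboundary of a rational `0`-cochain. -/
theorem exists_potential {n : ℕ} {U : Set (PP n)} (hU : IsOpen U)
    {c : SingularSimplex (PP n) 1 → ℚ}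
    (hc : ∀ σ : SingularSimplex (PP n) 2, range σ ⊆ U → singularCoboundary c σ = 0) {F : PP n → ℂ}
    (hF : ∀ σ : SingularSimplex (PP n) 1, range σ ⊆ U → IsSmooth σ →
      (c σ : ℂ) = F (σ.path 1) - F (σ.path 0)) :
    ∃ g : PP n → ℚ, ∀ σ : SingularSimplex (PP n) 1, range σ ⊆ U →
      c σ = g (σ.path 1) - g (σ.path 0) := by
  have key := eq_sub_of_locally_eq_sub hc (F := F) (by
    intro p hp
    obtain ⟨S, hS, hSU, hcontr, hsm⟩ := exists_contractible_nhd (hU.mem_nhds hp)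
    refine ⟨S, hS, fun σ hσ => ?_⟩
    obtain ⟨τ, hτ, hτs, h0, h1⟩ := hsm _ (hσ (σ.path_mem_range 0)) _ (hσ (σ.path_mem_range 1))
    obtain ⟨y, hy, hdy⟩ := exists_singularBoundary_eq_of_mem (S := S)
      (z := Finsupp.single σ 1 - Finsupp.single τ 1)
      (Submodule.sub_mem _ (single_mem_singularChains hσ _) (single_mem_singularChains hτ _)) (by
        rw [map_sub, singularBoundary_single_one, singularBoundary_single_one, h0, h1, sub_self])
    have h2 : Finsupp.linearCombination ℚ c (singularBoundary _ 1 y) = 0 := by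
      rw [linearCombination_singularBoundary]
      exact linearCombination_eq_zero_of_mem (fun ρ hρ => hc ρ (hρ.trans hSU)) hy
    rw [hdy, map_sub, Finsupp.linearCombination_single, Finsupp.linearCombination_single, one_smul,
      one_smul, sub_eq_zero] at h2
    rw [h2, hF τ (hτ.trans hSU) hτs, h0, h1])
  obtain ⟨ρ, hρ⟩ := (Algebra.linearMap ℚ ℂ).exists_leftInverse_of_injective
    (LinearMap.ker_eq_bot.2 (algebraMap ℚ ℂ).injective)
  refine ⟨fun p => ρ (F p), fun σ hσ => ?_⟩
  rw [← map_sub, ← key σ hσ]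
  exact (LinearMap.congr_fun hρ (c σ)).symm

end paths

/-! ### Singular simplices of a triangulation -/

/-- A point of a simplex with positive barycentric coordinates is in the relative interior. -/
theorem sum_smul_mem_relInterior {E : Type} [AddCommGroup E] [Module ℝ E] {s : Finset E}
    (hi : AffineIndependent ℝ ((↑) : s → E)) {w : E → ℝ} (hw : ∀ y ∈ s, 0 < w y)
    (hw1 : ∑ y ∈ s, w y = 1) : ∑ y ∈ s, w y • y ∈ relInterior s := by
  classical
  refine ⟨Finset.mem_convexHull'.2 ⟨w, fun y hy => (hw y hy).le, hw1, rfl⟩, fun hx => ?_⟩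
  obtain ⟨⟨t, ht⟩, hxt⟩ := mem_iUnion.1 hx
  rw [Finset.mem_convexHull'] at hxt
  obtain ⟨w', -, hw1', hw2'⟩ := hxt
  obtain ⟨a, has, hat⟩ := Finset.exists_of_ssubset ht
  have hA : ∑ y ∈ s, (if y ∈ t then w' y else 0) = 1 := by
    rw [← Finset.sum_filter, Finset.filter_mem_eq_inter, Finset.inter_eq_right.2 ht.subset, hw1']
  have hB : ∑ y ∈ s, (if y ∈ t then w' y else 0) • y = ∑ y ∈ s, w y • y := by
    rw [← hw2']
    simp only [ite_smul, zero_smul]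
    rw [← Finset.sum_filter, Finset.filter_mem_eq_inter, Finset.inter_eq_right.2 ht.subset]
  have := (affineIndependent_iff.1 hi) Finset.univ
    (fun y => (if y.1 ∈ t then w' y.1 else 0) - w y.1) ?_ ?_ ⟨a, has⟩ (Finset.mem_univ _)
  · simp only [hat, if_false, zero_sub, neg_eq_zero] at this
    exact (hw a has).ne' this
  · rw [Finset.univ_eq_attach, Finset.sum_attach s
      (fun y => (if y ∈ t then w' y else 0) - w y), Finset.sum_sub_distrib, hA, hw1, sub_self]
  · rw [Finset.univ_eq_attach, Finset.sum_attach s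
      (fun y => ((if y ∈ t then w' y else 0) - w y) • y)]
    simp only [sub_smul]
    rw [Finset.sum_sub_distrib, hB, sub_self]

theorem convexHull_subset_closure_relInterior {E : Type} [NormedAddCommGroup E] [NormedSpace ℝ E]
    {s : Finset E} (hi : AffineIndependent ℝ ((↑) : s → E)) :
    convexHull ℝ (s : Set E) ⊆ closure (relInterior s) := by
  intro x hx
  rw [Finset.mem_convexHull'] at hx
  obtain ⟨w, hw, hw1, rfl⟩ := hx
  have hs : s.Nonempty := Finset.nonempty_iff_ne_empty.2 fun h => by simp [h] at hw1
  have hc : (0 : ℝ) < s.card := by exact_mod_cast hs.card_pos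
  let f : ℝ → E := fun t => ∑ y ∈ s, ((1 - t) * w y + t * (s.card : ℝ)⁻¹) • y
  have hf : Continuous f := by fun_prop
  have h0 : f 0 = ∑ y ∈ s, w y • y := by simp [f]
  rw [← h0]
  have hmem : (0 : ℝ) ∈ closure (Ioo 0 1) := by
    rw [closure_Ioo (by norm_num)]
    exact ⟨le_rfl, zero_le_one⟩
  refine map_mem_closure hf hmem fun t ht => ?_
  refine sum_smul_mem_relInterior hi (fun y hy => ?_) ?_
  · have h1 := mul_nonneg (sub_nonneg.2 ht.2.le) (hw y hy)
    have h2 : 0 < t * (s.card : ℝ)⁻¹ := mul_pos ht.1 (inv_pos.2 hc)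
    linarith
  · rw [Finset.sum_add_distrib, ← Finset.mul_sum, hw1, Finset.sum_const, nsmul_eq_mul]
    field_simp
    ring

namespace Triangulation

variable {n : ℕ} (K : Triangulation n)

theorem simplexImg_subset_closure {s : Finset K.E} (hs : s ∈ K.complex.faces) :
    K.simplexImg s ⊆ closure (K.img (relInterior s)) := by
  rintro _ ⟨y, hy, rfl⟩
  have h1 : y ∈ closure ((↑) ⁻¹' relInterior s : Set K.complex.space) := by
    rw [IsEmbedding.subtypeVal.isInducing.closure_eq_preimage_closure_image,
      Subtype.image_preimage_coe, inter_eq_right.2]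
    · exact convexHull_subset_closure_relInterior (K.complex.indep hs) hy
    · exact fun x hx => K.complex.convexHull_subset_space hs hx.1
  exact map_mem_closure K.homeo.continuous h1 fun x hx => ⟨x, hx, rfl⟩

theorem contractibleSpace_simplexImg {s : Finset K.E} (hs : s ∈ K.complex.faces) :
    ContractibleSpace (K.simplexImg s) := by
  have h0 := (convex_convexHull ℝ (s : Set K.E)).contractibleSpace
    ((K.complex.nonempty_of_mem_faces hs).coe_sort.elim fun y =>
      ⟨y.1, subset_convexHull ℝ _ y.2⟩)
  let A : Set K.complex.space := {y | y.1 ∈ convexHull ℝ (s : Set K.E)}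
  have h1 : (Subtype.val '' A : Set K.E) = convexHull ℝ (s : Set K.E) := by
    ext x
    exact ⟨fun ⟨y, hy, h⟩ => h ▸ hy, fun hx => ⟨⟨x, K.complex.convexHull_subset_space hs hx⟩, hx, rfl⟩⟩
  have h2 : K.homeo '' A = K.simplexImg s := rfl
  have e1 : A ≃ₜ convexHull ℝ (s : Set K.E) :=
    (IsEmbedding.subtypeVal.homeomorphImage A).trans (Homeomorph.setCongr h1)
  have e2 : A ≃ₜ K.simplexImg s :=
    (K.homeo.isEmbedding.homeomorphImage A).trans (Homeomorph.setCongr h2)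
  exact (e2.symm.trans e1).contractibleSpace

theorem singular_face {p : ℕ} {v : Fin (p + 2) → K.E} (hv : IsSimplex K.complex v)
    (j : Fin (p + 2)) : SingularSimplex.face (K.singular v hv) j =
      K.singular (v ∘ j.succAbove) (hv.comp Fin.succAbove_right_injective) := by
  ext1 s
  exact congrArg K.homeo (Subtype.ext (sum_map_succAbove_smul v j s))

theorem range_singular_subset {p : ℕ} {v : Fin (p + 1) → K.E} (hv : IsSimplex K.complex v) :
    range (K.singular v hv) ⊆ K.simplexImg (verts v) := by
  rintro _ ⟨s, rfl⟩
  exact ⟨_, mem_convexHull_of_exists_fintype _ v s.2.1 s.2.2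
    (fun j => Finset.mem_coe.2 (mem_verts.2 ⟨j, rfl⟩)) rfl, rfl⟩

theorem verts_comp_subset {E : Type} {p q : ℕ} (v : Fin (p + 1) → E) (f : Fin (q + 1) → Fin (p + 1)) :
    verts (v ∘ f) ⊆ verts v := by
  intro x hx
  obtain ⟨j, rfl⟩ := mem_verts.1 hx
  exact mem_verts.2 ⟨f j, rfl⟩

open scoped Classical in
/-- The singular chain of `P^n` defined by a chain of ordered simplices. -/
def singularization (p : ℕ) : TupleChain K.E (p + 1) →ₗ[ℚ] SingularChain (PP n) p :=
  Finsupp.linearCombination ℚ fun v =>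
    if h : IsSimplex K.complex v then Finsupp.single (K.singular v h) 1 else 0

theorem singularization_single {p : ℕ} {v : Fin (p + 1) → K.E} (hv : IsSimplex K.complex v) :
    K.singularization p (Finsupp.single v 1) = Finsupp.single (K.singular v hv) 1 := by
  rw [singularization, Finsupp.linearCombination_single, one_smul, dif_pos hv]

theorem singularBoundary_singularization {p : ℕ} {z : TupleChain K.E (p + 2)}
    (hz : z ∈ Finsupp.supported ℚ ℚ {v | IsSimplex K.complex v}) :
    singularBoundary (PP n) p (K.singularization (p + 1) z) =
      K.singularization p (tupleBoundary K.E (p + 1) z) := by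
  have h : (singularBoundary (PP n) p ∘ₗ K.singularization (p + 1) -
      K.singularization p ∘ₗ tupleBoundary K.E (p + 1)) z ∈
      (⊥ : Submodule ℚ (SingularChain (PP n) p)) := by
    refine map_mem_of_mem_supported (fun v hv => ?_) hz
    rw [Submodule.mem_bot, LinearMap.sub_apply, sub_eq_zero, LinearMap.comp_apply,
      LinearMap.comp_apply, K.singularization_single hv, singularBoundary_single,
      tupleBoundary_single, map_sum]
    refine Finset.sum_congr rfl fun j _ => ?_
    rw [K.singular_face hv, ← mul_one ((-1 : ℚ) ^ (j : ℕ)), ← smul_eq_mul, ← Finsupp.smul_single,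
      ← Finsupp.smul_single, map_smul,
      K.singularization_single (IsSimplex.comp hv Fin.succAbove_right_injective)]
  rw [Submodule.mem_bot, LinearMap.sub_apply, sub_eq_zero] at h
  exact h

theorem singularization_mem {p : ℕ} {z : TupleChain K.E (p + 1)} {S : Set (PP n)}
    (hz : ∀ v ∈ z.support, K.simplexImg (verts v) ⊆ S) :
    K.singularization p z ∈ singularChains S p := by
  refine map_mem_of_mem_supported (S := {v | K.simplexImg (verts v) ⊆ S}) (fun v hv => ?_) hz
  by_cases h : IsSimplex K.complex v
  · rw [K.singularization_single h]
    exact single_mem_singularChains ((K.range_singular_subset h).trans hv) _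
  · rw [singularization, Finsupp.linearCombination_single, one_smul, dif_neg h]
    exact zero_mem _

/-- A singular `0`-chain in a point is determined by its augmentation. -/
theorem eq_zero_of_mem_singularChains_singleton {X : Type} [TopologicalSpace X] {x : X}
    {z : SingularChain X 0} (hz : z ∈ singularChains {x} 0)
    (h : Finsupp.linearCombination ℚ (fun _ => (1 : ℚ)) z = 0) : z = 0 := by
  have h1 : z = Finsupp.single (ContinuousMap.const _ x) (z (ContinuousMap.const _ x)) := by
    rw [← Finsupp.support_subset_singleton]
    intro σ hσ
    rw [Finset.mem_singleton]
    ext s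
    exact hz hσ ⟨s, rfl⟩
  rw [h1, Finsupp.linearCombination_single, smul_eq_mul, mul_one] at h
  rw [h1, h, Finsupp.single_zero]

end Triangulation

open Triangulation

/-- A simplex that meets `H_{i,α}` is contained in the closed unit disc bundle of `H_{i,α}`. -/
theorem GoodTriangulation.exists_coord_eq_of_meets {n : ℕ} (K : GoodTriangulation n) (i : Fin n)
    (α : Pole) {s : Finset K.E} (hs : s ∈ K.complex.faces)
    (h : (K.simplexImg s ∩ divH i α).Nonempty) {p : PP n} (hp : p ∈ K.simplexImg s) :
    ∃ z : ℂ, α.coord (p i) = (z : OnePoint ℂ) ∧ ‖z‖ ≤ 1 := by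
  obtain ⟨q, hqs, hq⟩ := h
  cases α with
  | zero =>
    have hqt : q ∈ tube i Pole.zero := by
      rw [mem_tube_iff]
      exact ⟨0, mem_divH_iff.1 hq, by simp⟩
    obtain ⟨r, hrt, hrs⟩ := mem_closure_iff.1 (K.simplexImg_subset_closure hs hqs) _
      (isOpen_tube i Pole.zero) hqt
    obtain ⟨z, hz, hz1⟩ := hrt
    exact (K.disc i).simplexImg_subset hs hrs ⟨z, hz, hz1.le⟩ hp
  | infty =>
    -- The open simplex is disjoint from the subcomplex `{|z_i| ≤ 1}`, which does not contain `q`.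
    have h1 : K.img (relInterior s) ⊆
        (fun p : PP n => Pole.infty.coord (p i)) ⁻¹' ((↑) '' Metric.closedBall (0 : ℂ) 1) := by
      intro r hr
      have hrD : ¬ ∃ z : ℂ, r i = (z : OnePoint ℂ) ∧ ‖z‖ ≤ 1 := by
        intro hrD
        obtain ⟨z, hz, -⟩ := (K.disc i).simplexImg_subset hs hr hrD hqs
        have : q i = OnePoint.infty := hq
        rw [this] at hz
        exact OnePoint.infty_ne_coe z hz
      generalize hx : r i = x at hrD
      change inversion (r i) ∈ ((↑) '' Metric.closedBall (0 : ℂ) 1 : Set (OnePoint ℂ))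
      rw [hx]
      induction x using OnePoint.rec with
      | infty => exact ⟨0, by simp, rfl⟩
      | coe z =>
        have hz : 1 < ‖z‖ := by
          by_contra! hz
          exact hrD ⟨z, rfl, hz⟩
        have hz0 : z ≠ 0 := by
          rintro rfl
          norm_num at hz
        rw [inversion_coe hz0]
        refine ⟨z⁻¹, ?_, rfl⟩
        rw [mem_closedBall_zero_iff, norm_inv]
        exact inv_le_one_of_one_le₀ hz.le
    have h2 : IsClosed ((fun p : PP n => Pole.infty.coord (p i)) ⁻¹'
        ((↑) '' Metric.closedBall (0 : ℂ) 1)) :=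
      (((isCompact_closedBall (0 : ℂ) 1).image OnePoint.continuous_coe).isClosed).preimage
        (Pole.infty.coord.continuous.comp (continuous_apply i))
    obtain ⟨z, hz, hpz⟩ := closure_minimal h1 h2 (K.simplexImg_subset_closure hs hp)
    exact ⟨z, hpz.symm, by simpa using hz⟩

/-! ### Comparison of Thom cocycles -/

section comparison

variable {X : Type} [TopologicalSpace X]

theorem SingularSimplex.path_zero_eq (σ : SingularSimplex X 1) :
    σ.path 0 = σ (stdSimplex.vertex 0) := by
  rw [← σ.path_apply_one]
  congr 1

theorem SingularSimplex.path_one_eq (σ : SingularSimplex X 1) :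
    σ.path 1 = σ (stdSimplex.vertex 1) := by
  rw [← σ.path_apply_one]
  congr 1

theorem SingularSimplex.face_path_zero (σ : SingularSimplex X 2) (j : Fin 3) :
    (SingularSimplex.face σ j).path 0 = σ (stdSimplex.vertex (j.succAbove 0)) := by
  rw [SingularSimplex.path_zero_eq]
  exact congrArg σ (stdSimplex.map_vertex _ _)

theorem SingularSimplex.face_path_one (σ : SingularSimplex X 2) (j : Fin 3) :
    (SingularSimplex.face σ j).path 1 = σ (stdSimplex.vertex (j.succAbove 1)) := by
  rw [SingularSimplex.path_one_eq]
  exact congrArg σ (stdSimplex.map_vertex _ _)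

theorem sum_succAbove_sub_eq_zero {M : Type} [AddCommGroup M] [Module ℚ M] (G : Fin 3 → M) :
    ∑ j : Fin 3, ((-1 : ℚ) ^ (j : ℕ)) • (G (j.succAbove 1) - G (j.succAbove 0)) = 0 := by
  have h1 : Fin.succAbove (0 : Fin 3) (1 : Fin 2) = 2 := rfl
  have h2 : Fin.succAbove (0 : Fin 3) (0 : Fin 2) = 1 := rfl
  have h3 : Fin.succAbove (1 : Fin 3) (1 : Fin 2) = 2 := rfl
  have h4 : Fin.succAbove (1 : Fin 3) (0 : Fin 2) = 0 := rfl
  have h5 : Fin.succAbove (2 : Fin 3) (1 : Fin 2) = 1 := rfl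
  have h6 : Fin.succAbove (2 : Fin 3) (0 : Fin 2) = 0 := rfl
  simp only [Fin.sum_univ_three, h1, h2, h3, h4, h5, h6, Fin.val_zero, Fin.val_one, Fin.val_two,
    pow_zero, pow_one, one_smul, neg_smul, even_two, Even.neg_pow, one_pow]
  abel

theorem sum_face_path_eq_zero {M : Type} [AddCommGroup M] [Module ℚ M] (g : X → M)
    (σ : SingularSimplex X 2) :
    ∑ j : Fin 3, ((-1 : ℚ) ^ (j : ℕ)) • (g ((SingularSimplex.face σ j).path 1) -
      g ((SingularSimplex.face σ j).path 0)) = 0 := by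
  simp only [SingularSimplex.face_path_zero, SingularSimplex.face_path_one]
  exact sum_succAbove_sub_eq_zero fun k => g (σ (stdSimplex.vertex k))

variable {n : ℕ}

/-- The values of two representatives of the Thom class on the simplices of a triangulation differ by
a relative coboundary: in the tube the difference is the coboundary of a closed cochain on the tube
minus `H_{i,α}`, which has a potential, and every simplex is shrunk into the tube by a homotopy. -/
theorem RepresentsThomClass.exists_coboundary_eq {i : Fin n} {α : Pole}
    {u u' : SingularSimplex (PP n) 2 → ℚ} (hu : RepresentsThomClass i α u)
    (hu' : RepresentsThomClass i α u') (K : GoodTriangulation n) :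
    ∃ η : (Fin 2 → K.E) → ℚ,
      (∀ e, η e ≠ 0 → (K.simplexImg (verts e) ∩ divH i α).Nonempty) ∧
      ∀ (v : Fin 3 → K.E) (hv : IsSimplex K.complex v),
        u (K.singular v hv) - u' (K.singular v hv) = coboundary η v := by
  classical
  obtain ⟨b, ⟨f, hf⟩, hb⟩ := hu.restriction
  obtain ⟨b', ⟨f', hf'⟩, hb'⟩ := hu'.restriction
  let x : SingularSimplex (PP n) 2 → ℚ := fun σ => u σ - u' σ
  let c : SingularSimplex (PP n) 1 → ℚ := fun σ => b σ - b' σ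
  have hxrel : ∀ σ : SingularSimplex (PP n) 2, range σ ⊆ (divH i α)ᶜ → x σ = 0 := fun σ hσ => by
    simp only [x, hu.relative σ hσ, hu'.relative σ hσ, sub_zero]
  have hxco : ∀ σ : SingularSimplex (PP n) 3, singularCoboundary x σ = 0 := fun σ => by
    have h1 := hu.cocycle σ
    have h2 := hu'.cocycle σ
    rw [singularCoboundary] at h1 h2 ⊢
    simp only [x, mul_sub, Finset.sum_sub_distrib, h1, h2, sub_zero]
  have hxc : ∀ σ : SingularSimplex (PP n) 2, range σ ⊆ tube i α → x σ = singularCoboundary c σ := by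
    intro σ hσ
    simp only [x, hb σ hσ, hb' σ hσ, c, singularCoboundary, mul_sub, Finset.sum_sub_distrib]
  obtain ⟨g, hg⟩ := exists_potential (U := tube i α \ divH i α) (c := c)
    (F := fun p => f p - f' p) ((isOpen_tube i α).sdiff (isClosed_divH i α)) (by
      intro σ hσ
      rw [← hxc σ (hσ.trans sdiff_subset), hxrel σ fun p hp => (hσ hp).2]) (by
      intro σ hσ hs
      have h1 := hf σ hσ hs
      have h2 := hf' σ hσ hs
      simp only [c]
      push_cast
      linear_combination h1 - h2)
  -- The homotopy from the shrunk simplex to the simplex.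
  let lift : unitInterval → C(PP n, PP n × unitInterval) := fun t =>
    ⟨fun p => (p, t), by fun_prop⟩
  let vert : PP n → SingularSimplex (PP n × unitInterval) 1 := fun p =>
    ⟨fun s => (p, stdSimplexHomeomorphUnitInterval s), by fun_prop⟩
  let V : PP n → SingularChain (PP n × unitInterval) 1 := fun p => Finsupp.single (vert p) 1
  let f₁ : (Fin 2 → K.E) → SingularChain (PP n × unitInterval) 1 := fun e =>
    if he : IsSimplex K.complex e then
      Finsupp.single ((lift 1).comp (K.singular e he)) 1 -
        Finsupp.single ((lift 0).comp (K.singular e he)) 1 -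
        (V ((K.singular e he).path 1) - V ((K.singular e he).path 0))
    else 0
  let f₂ : (Fin 3 → K.E) → SingularChain (PP n × unitInterval) 2 := fun v =>
    if hv : IsSimplex K.complex v then
      Finsupp.single ((lift 1).comp (K.singular v hv)) 1 -
        Finsupp.single ((lift 0).comp (K.singular v hv)) 1
    else 0
  let S : Finset K.E → Set (PP n × unitInterval) := fun s => K.simplexImg s ×ˢ univ
  have hScontr : ∀ s ∈ K.complex.faces, ContractibleSpace (S s) := by
    intro s hs
    have h1 := K.contractibleSpace_simplexImg hs
    have h2 : ContractibleSpace (univ : Set unitInterval) := by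
      have : ContractibleSpace unitInterval :=
        (convex_Icc (0 : ℝ) 1).contractibleSpace ⟨0, le_rfl, zero_le_one⟩
      exact (Homeomorph.Set.univ unitInterval).contractibleSpace
    exact (Homeomorph.Set.prod (K.simplexImg s) univ).contractibleSpace
  have hlift : ∀ {p : ℕ} {v : Fin (p + 1) → K.E} (hv : IsSimplex K.complex v) t,
      range ((lift t).comp (K.singular v hv)) ⊆ S (verts v) := by
    rintro p v hv t _ ⟨s, rfl⟩
    exact ⟨K.range_singular_subset hv ⟨s, rfl⟩, mem_univ _⟩
  have hV : ∀ {v : Fin 2 → K.E} (hv : IsSimplex K.complex v) (t : ℝ),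
      V ((K.singular v hv).path t) ∈ singularChains (S (verts v)) 1 := by
    intro v hv t
    refine single_mem_singularChains ?_ _
    rintro _ ⟨s, rfl⟩
    exact ⟨K.range_singular_subset hv ((K.singular v hv).path_mem_range t), mem_univ _⟩
  have hlift1 : ∀ t (σ : SingularSimplex (PP n) 1) r,
      SingularSimplex.path ((lift t).comp σ) r = (σ.path r, t) := fun _ _ _ => rfl
  have hvert0 : ∀ p, (vert p).path 0 = (p, 0) := fun p => by
    rw [SingularSimplex.path_zero_eq]
    refine Prod.ext rfl (Subtype.ext ?_)
    change (stdSimplex.vertex (0 : Fin 2) : stdSimplex ℝ (Fin 2)) 1 = 0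
    simp
  have hvert1 : ∀ p, (vert p).path 1 = (p, 1) := fun p => by
    rw [SingularSimplex.path_one_eq]
    refine Prod.ext rfl (Subtype.ext ?_)
    change (stdSimplex.vertex (1 : Fin 2) : stdSimplex ℝ (Fin 2)) 1 = 1
    simp
  obtain ⟨η, hη, hηx⟩ := CubicalChain.exists_coboundary_eq
    (good := fun {p} v => IsSimplex K.complex (p := p) v)
    (fun v hv j => IsSimplex.comp hv Fin.succAbove_right_injective) S
    (fun v _ j => prod_mono (K.simplexImg_mono (Triangulation.verts_comp_subset v _)) subset_rfl)
    (fun e he => hScontr _ he.2) (fun v hv => hScontr _ hv.2) f₁ f₂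
    (fun e he => by
      simp only [f₁, dif_pos he]
      exact Submodule.sub_mem _ (Submodule.sub_mem _ (single_mem_singularChains (hlift he 1) _)
        (single_mem_singularChains (hlift he 0) _)) (Submodule.sub_mem _ (hV he 1) (hV he 0)))
    (fun v hv => by
      simp only [f₂, dif_pos hv]
      exact Submodule.sub_mem _ (single_mem_singularChains (hlift hv 1) _)
        (single_mem_singularChains (hlift hv 0) _))
    (fun e he => by
      simp only [f₁, dif_pos he, map_sub, V, singularBoundary_single_one, hlift1, hvert0, hvert1]
      abel)
    (fun v hv => by
      have h1 : ∀ j : Fin 3, f₁ (v ∘ j.succAbove) =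
          Finsupp.single (SingularSimplex.face ((lift 1).comp (K.singular v hv)) j) 1 -
          Finsupp.single (SingularSimplex.face ((lift 0).comp (K.singular v hv)) j) 1 -
          (V ((SingularSimplex.face (K.singular v hv) j).path 1) -
            V ((SingularSimplex.face (K.singular v hv) j).path 0)) := by
        intro j
        simp only [f₁, dif_pos (IsSimplex.comp hv (Fin.succAbove_right_injective (p := j)))]
        rw [K.singular_face hv j]
        congr 2
        · rw [← K.singular_face hv j]
          rfl
        · rw [← K.singular_face hv j]
          rfl
      simp only [h1, smul_sub _ (_ - _), Finset.sum_sub_distrib, sum_face_path_eq_zero, sub_zero]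
      simp only [f₂, dif_pos hv, map_sub, singularBoundary_single, smul_sub, Finsupp.smul_single,
        Finset.sum_sub_distrib, smul_eq_mul, mul_one])
    (fun σ => x ((shrink i α).comp σ)) (fun v _ σ _ => hxco ((shrink i α).comp σ))
  let h0 : C(PP n, PP n) := (shrink i α).comp (lift 0)
  have hmeet : ∀ s ∈ K.complex.faces, (K.simplexImg s ∩ divH i α).Nonempty →
      ∀ p ∈ K.simplexImg s, h0 p ∈ tube i α := fun s hs hne p hp =>
    shrink_zero_mem_tube i α (K.exists_coord_eq_of_meets i α hs hne hp)
  let η' : (Fin 2 → K.E) → ℚ := fun e =>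
    if h : IsSimplex K.complex e ∧ (K.simplexImg (verts e) ∩ divH i α).Nonempty then
      c (h0.comp (K.singular e h.1)) - (g (SingularSimplex.path (h0.comp (K.singular e h.1)) 1) -
        g (SingularSimplex.path (h0.comp (K.singular e h.1)) 0))
    else 0
  refine ⟨η + η', fun e he => ?_, fun v hv => ?_⟩
  · by_contra hne
    refine he ?_
    have h1 : η' e = 0 := dif_neg fun h => hne h.2
    obtain ⟨y, hy, hηy⟩ := hη e
    rw [Pi.add_apply, h1, add_zero, hηy]
    refine linearCombination_eq_zero_of_mem (S := S (verts e)) (fun σ hσ => hxrel _ ?_) hy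
    rintro _ ⟨s, rfl⟩ hs
    exact hne ⟨(σ s).1, (hσ ⟨s, rfl⟩).1, (shrink_mem_divH_iff i α (t := (σ s).2)).1 hs⟩
  · have hsum : coboundary (η + η') v = coboundary η v + coboundary η' v := by
      simp only [coboundary, Pi.add_apply, mul_add, Finset.sum_add_distrib]
    have h1 := hηx v hv
    have h2 : (shrink i α).comp ((lift 1).comp (K.singular v hv)) = K.singular v hv := by
      ext1 s
      exact shrink_one i α _
    simp only [f₂, dif_pos hv, map_sub, Finsupp.linearCombination_single, one_smul, h2] at h1
    rw [hsum, ← h1]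
    change x (K.singular v hv) = x (K.singular v hv) - x (h0.comp (K.singular v hv)) + _
    suffices h : coboundary η' v = x (h0.comp (K.singular v hv)) by rw [h, sub_add_cancel]
    have hface : ∀ j : Fin 3, SingularSimplex.face (h0.comp (K.singular v hv)) j =
        h0.comp (K.singular (v ∘ j.succAbove)
          (IsSimplex.comp hv Fin.succAbove_right_injective)) := by
      intro j
      rw [← K.singular_face hv j]
      rfl
    by_cases hne : (K.simplexImg (verts v) ∩ divH i α).Nonempty
    · have ht := hmeet _ hv.2 hne
      have h3 : ∀ j : Fin 3, η' (v ∘ j.succAbove) =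
          c (SingularSimplex.face (h0.comp (K.singular v hv)) j) -
          (g ((SingularSimplex.face (h0.comp (K.singular v hv)) j).path 1) -
            g ((SingularSimplex.face (h0.comp (K.singular v hv)) j).path 0)) := by
        intro j
        have hj : IsSimplex K.complex (v ∘ j.succAbove) :=
          IsSimplex.comp hv Fin.succAbove_right_injective
        rw [hface]
        by_cases hne' : (K.simplexImg (verts (v ∘ j.succAbove)) ∩ divH i α).Nonempty
        · exact dif_pos ⟨hj, hne'⟩
        · have h4 : η' (v ∘ j.succAbove) = 0 := dif_neg fun h => hne' h.2
          rw [h4, eq_comm, sub_eq_zero]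
          refine hg _ ?_
          rintro _ ⟨s, rfl⟩
          have hs := K.range_singular_subset hj ⟨s, rfl⟩
          exact ⟨ht _ (K.simplexImg_mono (Triangulation.verts_comp_subset v _) hs), fun hH =>
            hne' ⟨_, hs, (shrink_mem_divH_iff i α).1 hH⟩⟩
      have h5 := sum_face_path_eq_zero g (h0.comp (K.singular v hv))
      simp only [smul_eq_mul] at h5
      rw [coboundary]
      simp only [h3, mul_sub _ (c _), Finset.sum_sub_distrib, h5, sub_zero]
      refine (hxc _ ?_).symm
      rintro _ ⟨s, rfl⟩
      exact ht _ (K.range_singular_subset hv ⟨s, rfl⟩)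
    · have h3 : ∀ j : Fin 3, η' (v ∘ j.succAbove) = 0 := fun j => dif_neg fun h => hne
        (h.2.mono (inter_subset_inter_left _
          (K.simplexImg_mono (Triangulation.verts_comp_subset v _))))
      rw [coboundary, Finset.sum_eq_zero fun j _ => by rw [h3, mul_zero]]
      refine (hxrel _ ?_).symm
      rintro _ ⟨s, rfl⟩ hs
      exact hne ⟨_, K.range_singular_subset hv ⟨s, rfl⟩, (shrink_mem_divH_iff i α).1 hs⟩

end comparison

/-! ### Singular cochains and subdivisions -/

section subdivisionComparison

theorem linearCombination_tupleBoundary {E : Type} {p : ℕ} (w : (Fin (p + 1) → E) → ℚ)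
    (z : TupleChain E (p + 2)) :
    Finsupp.linearCombination ℚ w (tupleBoundary E (p + 1) z) =
      Finsupp.linearCombination ℚ (coboundary w) z := by
  suffices h : Finsupp.linearCombination ℚ w ∘ₗ tupleBoundary E (p + 1) =
      Finsupp.linearCombination ℚ (coboundary w) from LinearMap.congr_fun h z
  refine tupleChain_hom_ext fun v => ?_
  rw [LinearMap.comp_apply, tupleBoundary_single, map_sum, Finsupp.linearCombination_single,
    one_smul, coboundary]
  exact Finset.sum_congr rfl fun j _ => by rw [Finsupp.linearCombination_single, smul_eq_mul]

variable {n : ℕ}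

open scoped Classical in
/-- The image of an ordered simplex under a chain map to the chains of `K'`, written as a combination
of increasing simplices. -/
def orderedImage {K K' : Triangulation n} (Λ : ∀ p, chains K.complex p →ₗ[ℚ] chains K'.complex p)
    (Q : VertexOrder K'.complex) (p : ℕ) (v : Fin (p + 1) → K.E) : TupleChain K'.E (p + 1) :=
  if hv : IsSimplex K.complex v then Q.incPart p (Λ p ⟨oriented v, oriented_mem hv⟩).1 else 0

variable {K K' : Triangulation n} {Λ : ∀ p, chains K.complex p →ₗ[ℚ] chains K'.complex p}
  (Q : VertexOrder K'.complex)

theorem orderedImage_eq {p : ℕ} {v : Fin (p + 1) → K.E} (hv : IsSimplex K.complex v) :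
    orderedImage Λ Q p v = Q.incPart p (Λ p ⟨oriented v, oriented_mem hv⟩).1 := dif_pos hv

theorem orderedImage_mem {p : ℕ} {v : Fin (p + 1) → K.E} (hv : IsSimplex K.complex v) :
    orderedImage Λ Q p v ∈
      Finsupp.supported ℚ ℚ {v' | IsSimplex K'.complex v' ∧ Q.Increasing v'} := by
  rw [orderedImage_eq Q hv]
  exact Q.incPart_mem (Λ p _).2

theorem orderedImage_carried (hΛ : IsSubdivisionOperator K K' Λ) {p : ℕ} {v : Fin (p + 1) → K.E}
    (v' : Fin (p + 1) → K'.E)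
    (h : orderedImage Λ Q p v v' ≠ 0) : K'.simplexImg (verts v') ⊆ K.simplexImg (verts v) := by
  classical
  rw [orderedImage] at h
  split_ifs at h with hv
  · rw [Q.incPart_apply] at h
    split_ifs at h
    · obtain ⟨w, hw, h1⟩ := hΛ.carried p _ v' h
      obtain ⟨π, rfl⟩ := oriented_apply_ne_zero hw
      exact h1.trans (K.simplexImg_mono (Triangulation.verts_comp_subset v π))
    · exact absurd rfl h
  · exact absurd rfl h

theorem tupleBoundary_orderedImage (hΛ : IsSubdivisionOperator K K' Λ) {p : ℕ} {v : Fin (p + 2) → K.E}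
    (hv : IsSimplex K.complex v) :
    tupleBoundary K'.E (p + 1) (orderedImage Λ Q (p + 1) v) =
      ∑ j : Fin (p + 2), ((-1 : ℚ) ^ (j : ℕ)) • orderedImage Λ Q p (v ∘ j.succAbove) := by
  have hj : ∀ j : Fin (p + 2), IsSimplex K.complex (v ∘ j.succAbove) := fun j =>
    IsSimplex.comp hv Fin.succAbove_right_injective
  have h1 : boundary K.complex p ⟨oriented v, oriented_mem hv⟩ =
      ∑ j : Fin (p + 2), ((-1 : ℚ) ^ (j : ℕ)) • ⟨oriented (v ∘ j.succAbove), oriented_mem (hj j)⟩ := by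
    refine Subtype.ext ?_
    rw [AddSubmonoidClass.coe_finsetSum]
    exact tailBoundary_oriented v
  rw [orderedImage_eq Q hv, Q.tupleBoundary_incPart (Λ (p + 1) _).2]
  change Q.incPart p (boundary K'.complex p (Λ (p + 1) _)).1 = _
  rw [← hΛ.comm, h1, map_sum, AddSubmonoidClass.coe_finsetSum, map_sum]
  refine Finset.sum_congr rfl fun j _ => ?_
  rw [map_smul, SetLike.val_smul, map_smul, orderedImage_eq Q (hj j)]

/-- A singular cocycle takes cohomologous values on the simplices of a triangulation and on their
subdivisions. -/
theorem exists_coboundary_eq_subdivision (hΛ : IsSubdivisionOperator K K' Λ)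
    (u : SingularSimplex (PP n) 2 → ℚ)
    (hu : ∀ σ : SingularSimplex (PP n) 3, singularCoboundary u σ = 0) :
    ∃ η : (Fin 2 → K.E) → ℚ,
      (∀ e, ∃ y ∈ singularChains (K.simplexImg (verts e)) 2,
        η e = Finsupp.linearCombination ℚ u y) ∧
      ∀ (v : Fin 3 → K.E) (hv : IsSimplex K.complex v),
        Finsupp.linearCombination ℚ u (K'.singularization 2 (orderedImage Λ Q 2 v)) -
          u (K.singular v hv) = coboundary η v := by
  let f : ∀ p, (Fin (p + 1) → K.E) → SingularChain (PP n) p := fun p v =>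
    K'.singularization p (orderedImage Λ Q p v) - K.singularization p (Finsupp.single v 1)
  have hf : ∀ p v, f p v ∈ singularChains (K.simplexImg (verts v)) p := by
    intro p v
    refine Submodule.sub_mem _ (K'.singularization_mem fun v' hv' => ?_)
      (K.singularization_mem fun w hw => ?_)
    · exact orderedImage_carried Q hΛ v' (Finsupp.mem_support_iff.1 hv')
    · have := Finsupp.support_single_subset hw
      rw [Finset.mem_singleton] at this
      rw [this]
  have hd : ∀ p (v : Fin (p + 2) → K.E), IsSimplex K.complex v →
      singularBoundary (PP n) p (f (p + 1) v) =
      ∑ j : Fin (p + 2), ((-1 : ℚ) ^ (j : ℕ)) • f p (v ∘ j.succAbove) := by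
    intro p v hv
    rw [map_sub, K'.singularBoundary_singularization fun v' hv' => (orderedImage_mem Q hv hv').1,
      K.singularBoundary_singularization (Finsupp.single_mem_supported ℚ _ hv),
      tupleBoundary_orderedImage Q hΛ hv, tupleBoundary_single, map_sum, map_sum,
      ← Finset.sum_sub_distrib]
    refine Finset.sum_congr rfl fun j _ => ?_
    rw [smul_sub, map_smul, ← map_smul (K.singularization p), Finsupp.smul_single, smul_eq_mul,
      mul_one]
  -- On vertices the two chains are equal, because the subdivision operator preserves augmentations.
  have haug : ∀ {L : Triangulation n} {z : TupleChain L.E 1},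
      z ∈ Finsupp.supported ℚ ℚ {v | IsSimplex L.complex v} →
      Finsupp.linearCombination ℚ (fun _ => (1 : ℚ)) (L.singularization 0 z) = coeffSum L.E 1 z := by
    intro L z hz
    have h1 : (Finsupp.linearCombination ℚ (fun _ => (1 : ℚ)) ∘ₗ L.singularization 0 -
        coeffSum L.E 1) z ∈ (⊥ : Submodule ℚ ℚ) := by
      refine map_mem_of_mem_supported (fun v hv => ?_) hz
      rw [Submodule.mem_bot, LinearMap.sub_apply, LinearMap.comp_apply, L.singularization_single hv]
      simp [coeffSum]
    rw [Submodule.mem_bot, LinearMap.sub_apply, sub_eq_zero] at h1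
    exact h1
  have hf0 : ∀ v : Fin 1 → K.E, IsSimplex K.complex v → f 0 v = 0 := by
    intro v hv
    have hpt : K.simplexImg (verts v) = {K.singular v hv (Classical.arbitrary _)} := by
      refine subset_antisymm ?_ (singleton_subset_iff.2 (K.range_singular_subset hv ⟨_, rfl⟩))
      have h1 : (verts v : Set K.E) = {v 0} := by
        ext x
        rw [Finset.mem_coe, mem_verts, mem_singleton_iff]
        exact ⟨fun ⟨j, hj⟩ => by rw [← hj, Fin.fin_one_eq_zero j], fun h => ⟨0, h.symm⟩⟩
      have h2 : ∀ p ∈ K.simplexImg (verts v), ∀ q ∈ K.simplexImg (verts v), p = q := by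
        rintro _ ⟨y, hy, rfl⟩ _ ⟨y', hy', rfl⟩
        rw [h1, convexHull_singleton, mem_singleton_iff] at hy hy'
        rw [Subtype.ext (hy.trans hy'.symm)]
      exact fun p hp => h2 p hp _ (K.range_singular_subset hv ⟨_, rfl⟩)
    refine Triangulation.eq_zero_of_mem_singularChains_singleton (hpt ▸ hf 0 v) ?_
    have h1 : coeffSum K'.E 1 (orderedImage Λ Q 0 v) = 1 := by
      have h2 := hΛ.augmentation ⟨oriented v, oriented_mem hv⟩
      rw [← coeffSum_eq_sum, ← coeffSum_eq_sum, coeffSum_oriented_zero,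
        ← Q.tupleAlt_incPart (Λ 0 _).2] at h2
      rw [orderedImage_eq Q hv, ← h2]
      have h3 : tupleAlt K'.E 1 = LinearMap.id := tupleChain_hom_ext fun w => by
        rw [tupleAlt_single, Fintype.sum_unique]
        simp
      rw [h3]
      rfl
    rw [map_sub, haug fun v' hv' => (orderedImage_mem Q hv hv').1,
      haug (Finsupp.single_mem_supported ℚ _ hv), h1]
    simp [coeffSum]
  obtain ⟨η, hη, hηu⟩ := exists_coboundary_eq
    (good := fun {p} v => IsSimplex K.complex (p := p) v)
    (fun v hv j => IsSimplex.comp hv Fin.succAbove_right_injective) K.simplexImg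
    (fun v _ j => K.simplexImg_mono (Triangulation.verts_comp_subset v _))
    (fun e he => K.contractibleSpace_simplexImg he.2)
    (fun v hv => K.contractibleSpace_simplexImg hv.2) (f 1) (f 2) (fun e _ => hf 1 e)
    (fun v _ => hf 2 v)
    (fun e he => by
      rw [hd 0 e he]
      refine Finset.sum_eq_zero fun j _ => ?_
      rw [hf0 _ (IsSimplex.comp he Fin.succAbove_right_injective), smul_zero])
    (fun v hv => hd 1 v hv) u (fun v _ σ _ => hu σ)
  refine ⟨η, hη, fun v hv => ?_⟩
  rw [← hηu v hv, map_sub, K.singularization_single hv, Finsupp.linearCombination_single, one_smul]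

end subdivisionComparison

/-! ### Thom cocycles and subdivisions -/

section comparisonCocycles

variable {n : ℕ} {K K' : GoodTriangulation (n + 1)} {i : Fin (n + 1)} {α : Pole}

theorem coeffSum_capAux_eq (T' : K'.ThomCocycle i α) (O' : K'.GoodOrder i α)
    (Q : VertexOrder K'.complex) {c : TupleChain K'.E 3} (hc : c ∈ chains K'.complex 2) :
    coeffSum K'.E 1 (capAux K' T' O' 0 c) = Finsupp.linearCombination ℚ T'.1 (Q.incPart 2 c) := by
  refine Q.induction_chains (f := coeffSum K'.E 1 ∘ₗ capAux K' T' O' 0)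
    (g := Finsupp.linearCombination ℚ T'.1 ∘ₗ Q.incPart 2) (fun v hv hQ => ?_) hc
  rw [LinearMap.comp_apply, coeffSum_capAux_oriented T' O' hv, LinearMap.comp_apply,
    ← tupleAlt_single_eq_oriented, Q.incPart_tupleAlt (Finsupp.single_mem_supported ℚ _ ⟨hv, hQ⟩),
    Finsupp.linearCombination_single, one_smul]

/-- The pull-back of a Thom cocycle under the subdivision operator differs from a Thom cocycle by the
coboundary of a relative cochain. -/
theorem exists_coboundary_eq_thomCocycle
    {Λ : ∀ p, chains K.complex p →ₗ[ℚ] chains K'.complex p}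
    (hΛ : IsSubdivisionOperator K.toTriangulation K'.toTriangulation Λ)
    (T : K.ThomCocycle i α) (T' : K'.ThomCocycle i α) (O' : K'.GoodOrder i α) :
    ∃ (P : VertexOrder K.complex) (η : (Fin 2 → K.E) → ℚ),
      (∀ v, IsSimplex K.complex v → P.Increasing v → η v ≠ 0 →
        (K.simplexImg (verts v) ∩ divH i α).Nonempty) ∧
      ∀ (v : Fin 3 → K.E) (hv : IsSimplex K.complex v), P.Increasing v →
        T.1 v - coeffSum K'.E 1 (capAux K' T' O' 0 (Λ 2 ⟨oriented v, oriented_mem hv⟩).1) =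
          coboundary η v := by
  obtain ⟨u, hu, P, w, hw, hTw⟩ := T.2.thomClass
  obtain ⟨u', hu', Q, w', hw', hTw'⟩ := T'.2.thomClass
  obtain ⟨η₁, h₁, h₁'⟩ := hu.exists_coboundary_eq hu' K
  obtain ⟨η₂, h₂, h₂'⟩ := exists_coboundary_eq_subdivision Q hΛ u' hu'.cocycle
  let η₃ : (Fin 2 → K.E) → ℚ := fun e =>
    Finsupp.linearCombination ℚ w' (orderedImage Λ Q 1 e)
  refine ⟨P, fun e => η₁ e + w e - η₂ e - η₃ e, fun e _ _ he => ?_, fun v hv hP => ?_⟩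
  · by_contra hne
    have hdis : ∀ p ∈ K.simplexImg (verts e), p ∉ divH i α := fun p hp hpH => hne ⟨p, hp, hpH⟩
    have e1 : η₁ e = 0 := by_contra fun h => hne (h₁ e h)
    have e2 : w e = 0 := by_contra fun h => hne (hw.2 e h).2
    have e3 : η₂ e = 0 := by
      obtain ⟨y, hy, h⟩ := h₂ e
      rw [h]
      exact linearCombination_eq_zero_of_mem
        (fun σ hσ => hu'.relative σ fun p hp => hdis p (hσ hp)) hy
    have e4 : η₃ e = 0 := by
      refine Finset.sum_eq_zero fun v' hv' => ?_
      have h5 := orderedImage_carried Q hΛ v' (Finsupp.mem_support_iff.1 hv')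
      have h6 : w' v' = 0 := by
        by_contra h
        obtain ⟨p, hp, hpH⟩ := (hw'.2 v' h).2
        exact hdis p (h5 hp) hpH
      change (orderedImage Λ Q 1 e v' : ℚ) • w' v' = 0
      rw [h6, smul_zero]
    exact he (by simp only [e1, e2, e3, e4]; ring)
  · have h3 : coboundary η₃ v =
        Finsupp.linearCombination ℚ (coboundary w') (orderedImage Λ Q 2 v) := by
      rw [← linearCombination_tupleBoundary, tupleBoundary_orderedImage Q hΛ hv, map_sum]
      exact Finset.sum_congr rfl fun j _ => by rw [map_smul, smul_eq_mul]
    have h4 : Finsupp.linearCombination ℚ T'.1 (orderedImage Λ Q 2 v) =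
        Finsupp.linearCombination ℚ u' (K'.singularization 2 (orderedImage Λ Q 2 v)) +
          Finsupp.linearCombination ℚ (coboundary w') (orderedImage Λ Q 2 v) := by
      have h5 : (Finsupp.linearCombination ℚ T'.1 - Finsupp.linearCombination ℚ u' ∘ₗ
          K'.singularization 2 - Finsupp.linearCombination ℚ (coboundary w'))
          (orderedImage Λ Q 2 v) ∈ (⊥ : Submodule ℚ ℚ) := by
        refine map_mem_of_mem_supported (fun v' hv' => ?_) (orderedImage_mem Q hv)
        rw [Submodule.mem_bot, LinearMap.sub_apply, LinearMap.sub_apply, LinearMap.comp_apply,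
          K'.singularization_single hv'.1]
        simp only [Finsupp.linearCombination_single, one_smul]
        rw [hTw' v' hv'.1 hv'.2]
        ring
      rw [Submodule.mem_bot, LinearMap.sub_apply, LinearMap.sub_apply, LinearMap.comp_apply] at h5
      linarith
    have hsum : coboundary (fun e => η₁ e + w e - η₂ e - η₃ e) v =
        coboundary η₁ v + coboundary w v - coboundary η₂ v - coboundary η₃ v := by
      simp only [coboundary, mul_add, mul_sub, Finset.sum_add_distrib, Finset.sum_sub_distrib]
    rw [coeffSum_capAux_eq T' O' Q (Λ 2 _).2, ← orderedImage_eq Q hv, h4, hsum, ← h₁' v hv,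
      ← h₂' v hv, h3, hTw v hv hP]
    ring

end comparisonCocycles

/-! ### Logarithms and lifts to `ℂ²` over simplices -/

section lifts

/-- A property of continuous maps on a compact contractible space that holds for constant maps and is
inherited by all uniformly close maps holds for all continuous maps. -/
theorem induction_close {Y M : Type} [MetricSpace Y] [CompactSpace Y] [ContractibleSpace Y]
    [PseudoMetricSpace M] (Q : C(Y, M) → Prop) (hconst : ∀ m, Q (ContinuousMap.const _ m)) {ε : ℝ}
    (hε : 0 < ε) (hstep : ∀ g g' : C(Y, M), (∀ y, dist (g' y) (g y) < ε) → Q g → Q g') (f : C(Y, M)) :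
    Q f := by
  obtain ⟨q, ⟨h⟩⟩ := id_nullhomotopic Y
  let F : C(unitInterval × Y, M) := f.comp h.toContinuousMap
  have hF : UniformContinuous F := CompactSpace.uniformContinuous_of_continuous F.continuous
  obtain ⟨δ, hδ, hFδ⟩ := Metric.uniformContinuous_iff.1 hF ε hε
  obtain ⟨N, hN⟩ := exists_nat_one_div_lt hδ
  let s : ℕ → unitInterval := fun k => projIcc 0 1 zero_le_one ((k : ℝ) / (N + 1))
  let G : ℕ → C(Y, M) := fun k => F.comp ⟨fun y => (s k, y), by fun_prop⟩
  have hs : ∀ k, dist (s k) (s (k + 1)) < δ := by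
    intro k
    refine lt_of_le_of_lt ?_ hN
    have h1 : dist (s k) (s (k + 1)) ≤ dist ((k : ℝ) / (N + 1)) (((k + 1 : ℕ) : ℝ) / (N + 1)) := by
      have := (LipschitzWith.projIcc (zero_le_one (α := ℝ))).dist_le_mul ((k : ℝ) / (N + 1))
        (((k + 1 : ℕ) : ℝ) / (N + 1))
      rwa [NNReal.coe_one, one_mul] at this
    refine h1.trans (le_of_eq ?_)
    have hN0 : (0 : ℝ) < N + 1 := by positivity
    rw [Real.dist_eq, ← sub_div, abs_div, abs_of_pos hN0]
    push_cast
    simp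
  have hG : ∀ k, Q (G (k + 1)) → Q (G k) := by
    intro k
    refine hstep _ _ fun y => hFδ ?_
    change max (dist (s k) (s (k + 1))) (dist y y) < δ
    rw [dist_self, max_eq_left dist_nonneg]
    exact hs k
  have hlast : Q (G (N + 1)) := by
    have h1 : G (N + 1) = ContinuousMap.const _ (f q) := by
      ext y
      have h2 : s (N + 1) = 1 := by
        refine projIcc_of_right_le _ ?_
        rw [le_div_iff₀ (by positivity)]
        push_cast
        linarith
      change f (h (s (N + 1), y)) = f q
      rw [h2, h.apply_one]
      rfl
    rw [h1]
    exact hconst _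
  have hall : ∀ k, Q (G k) → Q (G 0) := by
    intro k
    induction k with
    | zero => exact id
    | succ k ih => exact fun hk => ih (hG k hk)
  have h0 : G 0 = f := by
    ext y
    have h2 : s 0 = 0 := projIcc_of_le_left _ (by simp)
    change f (h (s 0, y)) = f y
    rw [h2, h.apply_zero]
    rfl
  exact h0 ▸ hall _ hlast

instance (p : ℕ) : ContractibleSpace (stdSimplex ℝ (Fin (p + 1))) :=
  (convex_stdSimplex ℝ _).contractibleSpace ⟨_, single_mem_stdSimplex ℝ 0⟩

/-- Nowhere vanishing functions on a simplex have logarithms. -/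
theorem exists_log {p : ℕ} (f : C(stdSimplex ℝ (Fin (p + 1)), ℂ)) (hf : ∀ s, f s ≠ 0) :
    ∃ L : C(stdSimplex ℝ (Fin (p + 1)), ℂ), ∀ s, Complex.exp (L s) = f s := by
  obtain ⟨s₀, -, hs₀⟩ := isCompact_univ.exists_isMinOn univ_nonempty
    (f.continuous.norm.continuousOn (s := univ))
  let m := ‖f s₀‖
  have hm : 0 < m := norm_pos_iff.2 (hf s₀)
  let M : Type := {z : ℂ // m ≤ ‖z‖}
  refine induction_close (M := M) (fun g => ∃ L : C(stdSimplex ℝ (Fin (p + 1)), ℂ),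
    ∀ s, Complex.exp (L s) = (g s).1) (fun z => ?_) hm (fun g g' hgg' ⟨L, hL⟩ => ?_)
    ⟨fun s => ⟨f s, hs₀ (mem_univ s)⟩, by fun_prop⟩
  · exact ⟨ContinuousMap.const _ (Complex.log z.1), fun s =>
      Complex.exp_log (norm_pos_iff.1 (hm.trans_le z.2))⟩
  · have hg0 : ∀ s, (g s).1 ≠ 0 := fun s => norm_pos_iff.1 (hm.trans_le (g s).2)
    have hg0' : ∀ s, (g' s).1 ≠ 0 := fun s => norm_pos_iff.1 (hm.trans_le (g' s).2)
    have hslit : ∀ s, (g' s).1 / (g s).1 ∈ Complex.slitPlane := by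
      intro s
      refine Complex.ball_one_subset_slitPlane ?_
      have h1 : (g' s).1 / (g s).1 - 1 = ((g' s).1 - (g s).1) / (g s).1 := by
        rw [sub_div, div_self (hg0 s)]
      rw [Metric.mem_ball, dist_eq_norm, h1, norm_div, div_lt_one (norm_pos_iff.2 (hg0 s)),
        ← dist_eq_norm]
      exact (hgg' s).trans_le (g s).2
    have hc : Continuous fun s => (g' s).1 / (g s).1 :=
      (continuous_subtype_val.comp g'.continuous).div (continuous_subtype_val.comp g.continuous) hg0
    refine ⟨⟨fun s => L s + Complex.log ((g' s).1 / (g s).1),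
      L.continuous.add (hc.clog hslit)⟩, fun s => ?_⟩
    change Complex.exp (L s + Complex.log ((g' s).1 / (g s).1)) = _
    rw [Complex.exp_add, hL, Complex.exp_log (div_ne_zero (hg0' s) (hg0 s)),
      mul_div_cancel₀ _ (hg0 s)]

/-- Two logarithms of a function on a connected space differ by a constant. -/
theorem log_sub_eq {Y : Type} [TopologicalSpace Y] [PreconnectedSpace Y] {L L' : Y → ℂ}
    (hL : Continuous L) (hL' : Continuous L') (h : ∀ s, Complex.exp (L s) = Complex.exp (L' s))
    (s t : Y) : L t - L s = L' t - L' s := by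
  have h1 : ∀ s, ∃ m : ℤ, L s = L' s + m * (2 * Real.pi * Complex.I) := fun s =>
    Complex.exp_eq_exp_iff_exists_int.1 (h s)
  choose m hm using h1
  have h2 : ∀ s, (m s : ℝ) = ((L s - L' s) / (2 * Real.pi * Complex.I)).re := by
    intro s
    rw [hm s, add_sub_cancel_left, mul_div_cancel_right₀ _ Complex.two_pi_I_ne_zero]
    simp
  have hmc : Continuous m := by
    rw [Int.isClosedEmbedding_coe_real.isEmbedding.continuous_iff]
    have : ((↑) ∘ m : Y → ℝ) = fun s => ((L s - L' s) / (2 * Real.pi * Complex.I)).re := funext h2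
    rw [this]
    exact Complex.continuous_re.comp ((hL.sub hL').div_const _)
  rw [hm s, hm t, PreconnectedSpace.constant inferInstance hmc (x := s) (y := t)]
  ring

/-- The change of a continuous logarithm of a function along the standard `1`-simplex. -/
def logDiff (f : stdSimplex ℝ (Fin 2) → ℂ) : ℂ :=
  open scoped Classical in
  if h : ∃ L : stdSimplex ℝ (Fin 2) → ℂ, Continuous L ∧ ∀ s, Complex.exp (L s) = f s then
    h.choose (stdSimplex.vertex 1) - h.choose (stdSimplex.vertex 0) else 0

theorem logDiff_eq {f L : stdSimplex ℝ (Fin 2) → ℂ} (hL : Continuous L)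
    (h : ∀ s, Complex.exp (L s) = f s) :
    logDiff f = L (stdSimplex.vertex 1) - L (stdSimplex.vertex 0) := by
  have h' : ∃ L : stdSimplex ℝ (Fin 2) → ℂ, Continuous L ∧ ∀ s, Complex.exp (L s) = f s := ⟨L, hL, h⟩
  rw [logDiff, dif_pos h']
  exact log_sub_eq h'.choose_spec.1 hL (fun s => (h'.choose_spec.2 s).trans (h s).symm) _ _

theorem logDiff_one : logDiff (fun _ => 1) = 0 := by
  rw [logDiff_eq (L := fun _ => 0) continuous_const fun _ => Complex.exp_zero, sub_self]

theorem logDiff_mul {f g : stdSimplex ℝ (Fin 2) → ℂ} (hf : Continuous f) (hg : Continuous g)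
    (hf0 : ∀ s, f s ≠ 0) (hg0 : ∀ s, g s ≠ 0) :
    logDiff (fun s => f s * g s) = logDiff f + logDiff g := by
  obtain ⟨L, hL⟩ := exists_log ⟨f, hf⟩ hf0
  obtain ⟨L', hL'⟩ := exists_log ⟨g, hg⟩ hg0
  rw [logDiff_eq (f := f) L.continuous hL, logDiff_eq (f := g) L'.continuous hL',
    logDiff_eq (L := fun s => L s + L' s) (by fun_prop) fun s => by
      rw [Complex.exp_add, hL, hL']
      rfl]
  ring

theorem exp_logDiff {f : stdSimplex ℝ (Fin 2) → ℂ} (hf : Continuous f) (hf0 : ∀ s, f s ≠ 0) :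
    Complex.exp (logDiff f) = f (stdSimplex.vertex 1) / f (stdSimplex.vertex 0) := by
  obtain ⟨L, hL⟩ := exists_log ⟨f, hf⟩ hf0
  rw [logDiff_eq (f := f) L.continuous hL, Complex.exp_sub, hL, hL]
  rfl

/-- The vector `e` of `ℂ²` is a system of homogeneous coordinates of the point `x` of `ℙ¹`. -/
def IsHomogeneous (x : OnePoint ℂ) (e : ℂ × ℂ) : Prop :=
  e ≠ 0 ∧ x.elim (e.2 = 0) fun z => e.1 = z * e.2

theorem isHomogeneous_coe {z : ℂ} {e : ℂ × ℂ} :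
    IsHomogeneous (z : OnePoint ℂ) e ↔ e ≠ 0 ∧ e.1 = z * e.2 := Iff.rfl

theorem isHomogeneous_infty {e : ℂ × ℂ} :
    IsHomogeneous OnePoint.infty e ↔ e ≠ 0 ∧ e.2 = 0 := Iff.rfl

/-- The quotient of two proportional vectors of `ℂ²`. -/
def quot (e e' : ℂ × ℂ) : ℂ :=
  (e.1 * starRingEnd ℂ e'.1 + e.2 * starRingEnd ℂ e'.2) /
    (e'.1 * starRingEnd ℂ e'.1 + e'.2 * starRingEnd ℂ e'.2)

theorem quot_denominator_ne_zero {e : ℂ × ℂ} (he : e ≠ 0) :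
    e.1 * starRingEnd ℂ e.1 + e.2 * starRingEnd ℂ e.2 ≠ 0 := by
  rw [Complex.mul_conj, Complex.mul_conj, ← Complex.ofReal_add, Complex.ofReal_ne_zero]
  intro h
  have h1 := Complex.normSq_nonneg e.1
  have h2 := Complex.normSq_nonneg e.2
  refine he (Prod.ext ?_ ?_)
  · exact Complex.normSq_eq_zero.1 (by linarith)
  · exact Complex.normSq_eq_zero.1 (by linarith)

theorem quot_smul {r : ℂ} {e : ℂ × ℂ} (he : e ≠ 0) : quot (r • e) e = r := by
  rw [quot, div_eq_iff (quot_denominator_ne_zero he)]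
  simp only [Prod.smul_fst, Prod.smul_snd, smul_eq_mul]
  ring

theorem IsHomogeneous.exists_eq_smul {x : OnePoint ℂ} {e e' : ℂ × ℂ} (he : IsHomogeneous x e)
    (he' : IsHomogeneous x e') : ∃ r : ℂ, r ≠ 0 ∧ e = r • e' := by
  have key : ∃ r : ℂ, e = r • e' := by
    induction x using OnePoint.rec with
    | infty =>
      rw [isHomogeneous_infty] at he he'
      have h : e'.1 ≠ 0 := fun h => he'.1 (Prod.ext h he'.2)
      exact ⟨e.1 / e'.1, Prod.ext (div_mul_cancel₀ _ h).symm (by simp [he.2, he'.2])⟩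
    | coe z =>
      rw [isHomogeneous_coe] at he he'
      have h : e'.2 ≠ 0 := fun h => he'.1 (Prod.ext (by rw [he'.2, h, mul_zero]; rfl) h)
      refine ⟨e.2 / e'.2, Prod.ext ?_ (div_mul_cancel₀ _ h).symm⟩
      change e.1 = e.2 / e'.2 * e'.1
      rw [he.2, he'.2]
      field_simp
  obtain ⟨r, hr⟩ := key
  refine ⟨r, ?_, hr⟩
  rintro rfl
  exact he.1 (by rw [hr, zero_smul])

theorem IsHomogeneous.quot_ne_zero {x : OnePoint ℂ} {e e' : ℂ × ℂ} (he : IsHomogeneous x e)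
    (he' : IsHomogeneous x e') : quot e e' ≠ 0 := by
  obtain ⟨r, hr, rfl⟩ := he.exists_eq_smul he'
  rwa [quot_smul he'.1]

theorem IsHomogeneous.quot_mul_quot {x : OnePoint ℂ} {e e' e'' : ℂ × ℂ} (he : IsHomogeneous x e)
    (he' : IsHomogeneous x e') (he'' : IsHomogeneous x e'') :
    quot e e' * quot e' e'' = quot e e'' := by
  obtain ⟨r, hr, rfl⟩ := he.exists_eq_smul he'
  obtain ⟨r', hr', rfl⟩ := he'.exists_eq_smul he''
  rw [quot_smul he'.1, quot_smul he''.1, smul_smul, quot_smul he''.1]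

theorem IsHomogeneous.quot_self {x : OnePoint ℂ} {e : ℂ × ℂ} (he : IsHomogeneous x e) :
    quot e e = 1 := by
  have := quot_smul (r := 1) he.1
  rwa [one_smul] at this

theorem IsHomogeneous.smul {x : OnePoint ℂ} {e : ℂ × ℂ} (he : IsHomogeneous x e) {r : ℂ}
    (hr : r ≠ 0) : IsHomogeneous x (r • e) := by
  refine ⟨smul_ne_zero hr he.1, ?_⟩
  induction x using OnePoint.rec with
  | infty =>
    change r * e.2 = 0
    rw [he.2, mul_zero]
  | coe z =>
    change r * e.1 = z * (r * e.2)
    rw [he.2]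
    ring

theorem continuous_quot {Y : Type} [TopologicalSpace Y] {e e' : Y → ℂ × ℂ} (he : Continuous e)
    (he' : Continuous e') (h : ∀ y, e' y ≠ 0) : Continuous fun y => quot (e y) (e' y) := by
  refine Continuous.div ?_ ?_ fun y => quot_denominator_ne_zero (h y)
  · exact ((continuous_fst.comp he).mul (Complex.continuous_conj.comp (continuous_fst.comp he'))).add
      ((continuous_snd.comp he).mul (Complex.continuous_conj.comp (continuous_snd.comp he')))
  · exact ((continuous_fst.comp he').mul (Complex.continuous_conj.comp (continuous_fst.comp he'))).add
      ((continuous_snd.comp he').mul (Complex.continuous_conj.comp (continuous_snd.comp he')))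

/-- The orthogonal projection of `ℂ²` to the line with the given image in the unit sphere of `ℝ³`. -/
def lineProj (v : Fin 3 → ℝ) (e : ℂ × ℂ) : ℂ × ℂ :=
  (((1 + v 2 : ℝ) * e.1 + (v 0 + v 1 * Complex.I) * e.2) / 2,
    ((v 0 - v 1 * Complex.I) * e.1 + (1 - v 2 : ℝ) * e.2) / 2)

theorem isHomogeneous_lineProj {x : OnePoint ℂ} {e : ℂ × ℂ} (h : lineProj (sphere x) e ≠ 0) :
    IsHomogeneous x (lineProj (sphere x) e) := by
  refine ⟨h, ?_⟩
  induction x using OnePoint.rec with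
  | infty =>
    change (((0 : ℝ) - (0 : ℝ) * Complex.I : ℂ) * e.1 + ((1 - 1 : ℝ) : ℂ) * e.2) / 2 = 0
    simp
  | coe z =>
    change (((1 + (‖z‖ ^ 2 - 1) / (‖z‖ ^ 2 + 1) : ℝ) : ℂ) * e.1 +
        (((2 * z.re / (‖z‖ ^ 2 + 1) : ℝ) : ℂ) + ((2 * z.im / (‖z‖ ^ 2 + 1) : ℝ) : ℂ) * Complex.I) *
          e.2) / 2 =
      z * (((((2 * z.re / (‖z‖ ^ 2 + 1) : ℝ) : ℂ) - ((2 * z.im / (‖z‖ ^ 2 + 1) : ℝ) : ℂ) * Complex.I) *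
        e.1 + ((1 - (‖z‖ ^ 2 - 1) / (‖z‖ ^ 2 + 1) : ℝ) : ℂ) * e.2) / 2)
    have h0 : ((‖z‖ ^ 2 + 1 : ℝ) : ℂ) ≠ 0 := by
      rw [Complex.ofReal_ne_zero]
      positivity
    have h1 : ((z.re : ℂ) + z.im * Complex.I) = z := Complex.re_add_im z
    have h2 : ((z.re : ℂ) - z.im * Complex.I) * z = ((‖z‖ : ℝ) : ℂ) ^ 2 := by
      rw [← Complex.conj_mul' z]
      congr 1
      apply Complex.ext <;> simp
    push_cast at h0 ⊢
    field_simp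
    linear_combination (2 * e.2) * h1 - (2 * e.1) * h2

theorem lineProj_eq_self {x : OnePoint ℂ} {e : ℂ × ℂ} (h : IsHomogeneous x e) :
    lineProj (sphere x) e = e := by
  induction x using OnePoint.rec with
  | infty =>
    rw [isHomogeneous_infty] at h
    refine Prod.ext ?_ ?_
    · change (((1 + 1 : ℝ) : ℂ) * e.1 + ((0 : ℝ) + (0 : ℝ) * Complex.I : ℂ) * e.2) / 2 = e.1
      rw [h.2]
      push_cast
      ring
    · change (((0 : ℝ) - (0 : ℝ) * Complex.I : ℂ) * e.1 + ((1 - 1 : ℝ) : ℂ) * e.2) / 2 = e.2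
      rw [h.2]
      simp
  | coe z =>
    rw [isHomogeneous_coe] at h
    have h0 : ((‖z‖ ^ 2 + 1 : ℝ) : ℂ) ≠ 0 := by
      rw [Complex.ofReal_ne_zero]
      positivity
    have h1 : ((z.re : ℂ) + z.im * Complex.I) = z := Complex.re_add_im z
    have h2 : ((z.re : ℂ) - z.im * Complex.I) * z = ((‖z‖ : ℝ) : ℂ) ^ 2 := by
      rw [← Complex.conj_mul' z]
      congr 1
      apply Complex.ext <;> simp
    refine Prod.ext ?_ ?_
    · change (((1 + (‖z‖ ^ 2 - 1) / (‖z‖ ^ 2 + 1) : ℝ) : ℂ) * e.1 +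
        (((2 * z.re / (‖z‖ ^ 2 + 1) : ℝ) : ℂ) + ((2 * z.im / (‖z‖ ^ 2 + 1) : ℝ) : ℂ) * Complex.I) *
          e.2) / 2 = e.1
      rw [h.2]
      push_cast at h0 ⊢
      field_simp
      linear_combination (2 * e.2) * h1
    · change ((((2 * z.re / (‖z‖ ^ 2 + 1) : ℝ) : ℂ) -
        ((2 * z.im / (‖z‖ ^ 2 + 1) : ℝ) : ℂ) * Complex.I) *
        e.1 + ((1 - (‖z‖ ^ 2 - 1) / (‖z‖ ^ 2 + 1) : ℝ) : ℂ) * e.2) / 2 = e.2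
      rw [h.2]
      push_cast at h0 ⊢
      field_simp
      linear_combination (2 * e.2) * h2

theorem norm_lineProj_sub_lt {v v' : Fin 3 → ℝ} (h : dist v' v < 1 / 2) {e : ℂ × ℂ} (he : e ≠ 0) :
    ‖lineProj v' e - lineProj v e‖ < ‖e‖ := by
  have he0 : 0 < ‖e‖ := norm_pos_iff.2 he
  have hd : ∀ j, ‖((v' j - v j : ℝ) : ℂ)‖ < 1 / 2 := by
    intro j
    rw [Complex.norm_real, ← dist_eq_norm]
    exact (dist_le_pi_dist v' v j).trans_lt h
  have h01 : ∀ c : ℂ, ‖c‖ ≤ 1 → ‖((v' 0 - v 0 : ℝ) : ℂ) + ((v' 1 - v 1 : ℝ) : ℂ) * c‖ < 1 := by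
    intro c hc
    have h1 : ‖((v' 1 - v 1 : ℝ) : ℂ) * c‖ ≤ ‖((v' 1 - v 1 : ℝ) : ℂ)‖ := by
      rw [norm_mul]
      exact mul_le_of_le_one_right (norm_nonneg _) hc
    linarith [norm_add_le ((v' 0 - v 0 : ℝ) : ℂ) (((v' 1 - v 1 : ℝ) : ℂ) * c), hd 0, hd 1]
  have key : ∀ a b c d : ℂ, ‖a‖ < 1 → ‖b‖ < 1 → ‖c‖ ≤ ‖e‖ → ‖d‖ ≤ ‖e‖ →
      ‖(a * c + b * d) / 2‖ < ‖e‖ := by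
    intro a b c d ha hb hc hd
    rw [norm_div, Complex.norm_two, div_lt_iff₀ two_pos]
    have h1 : ‖a * c‖ ≤ ‖a‖ * ‖e‖ := by
      rw [norm_mul]
      exact mul_le_mul_of_nonneg_left hc (norm_nonneg _)
    have h2 : ‖b * d‖ ≤ ‖b‖ * ‖e‖ := by
      rw [norm_mul]
      exact mul_le_mul_of_nonneg_left hd (norm_nonneg _)
    nlinarith [norm_add_le (a * c) (b * d)]
  have e1 : (lineProj v' e - lineProj v e).1 = (((v' 2 - v 2 : ℝ) : ℂ) * e.1 +
      (((v' 0 - v 0 : ℝ) : ℂ) + ((v' 1 - v 1 : ℝ) : ℂ) * Complex.I) * e.2) / 2 := by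
    simp only [lineProj, Prod.fst_sub]
    push_cast
    ring
  have e2 : (lineProj v' e - lineProj v e).2 = ((((v' 0 - v 0 : ℝ) : ℂ) +
      ((v' 1 - v 1 : ℝ) : ℂ) * (-Complex.I)) * e.1 + (-((v' 2 - v 2 : ℝ) : ℂ)) * e.2) / 2 := by
    simp only [lineProj, Prod.snd_sub]
    push_cast
    ring
  have hd2 := hd 2
  rw [Prod.norm_def, max_lt_iff, e1, e2]
  refine ⟨key _ _ _ _ (by linarith) (h01 _ ?_) (norm_fst_le e) (norm_snd_le e),
    key _ _ _ _ (h01 _ ?_) ?_ (norm_fst_le e) (norm_snd_le e)⟩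
  · rw [Complex.norm_I]
  · rw [norm_neg, Complex.norm_I]
  · rw [norm_neg]
    linarith

/-- Maps of a simplex to `ℙ¹` lift to homogeneous coordinates. -/
theorem exists_isHomogeneous {p : ℕ} (g : C(stdSimplex ℝ (Fin (p + 1)), OnePoint ℂ)) :
    ∃ e : C(stdSimplex ℝ (Fin (p + 1)), ℂ × ℂ), ∀ s, IsHomogeneous (g s) (e s) := by
  have h := induction_close (M := range sphere)
    (fun g => ∃ e : C(stdSimplex ℝ (Fin (p + 1)), ℂ × ℂ), ∀ s x, sphere x = (g s).1 →
      IsHomogeneous x (e s)) (ε := 1 / 2) ?_ (by norm_num) ?_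
    ⟨fun s => ⟨sphere (g s), g s, rfl⟩, (continuous_sphere.comp g.continuous).subtype_mk _⟩
  · obtain ⟨e, he⟩ := h
    exact ⟨e, fun s => he s _ rfl⟩
  · rintro ⟨_, x, rfl⟩
    obtain ⟨e₀, he₀⟩ : ∃ e₀, IsHomogeneous x e₀ := by
      induction x using OnePoint.rec with
      | infty => exact ⟨(1, 0), isHomogeneous_infty.2 ⟨by simp, rfl⟩⟩
      | coe z => exact ⟨(z, 1), isHomogeneous_coe.2 ⟨by simp, by simp⟩⟩
    refine ⟨ContinuousMap.const _ e₀, fun s y hy => ?_⟩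
    rw [sphere_injective hy]
    exact he₀
  · rintro g g' hgg' ⟨e, he⟩
    have hg : Continuous fun s => (g' s).1 := continuous_subtype_val.comp g'.continuous
    have hgj : ∀ j, Continuous fun s => (((g' s).1 j : ℝ) : ℂ) := fun j =>
      Complex.continuous_ofReal.comp ((continuous_apply j).comp hg)
    have h1 := continuous_fst.comp e.continuous
    have h2 := continuous_snd.comp e.continuous
    have hc : Continuous fun s => lineProj (g' s).1 (e s) := by
      unfold lineProj
      push_cast
      refine Continuous.prodMk ?_ ?_
      · exact (((continuous_const.add (hgj 2)).mul h1).add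
          (((hgj 0).add ((hgj 1).mul continuous_const)).mul h2)).div_const _
      · exact ((((hgj 0).sub ((hgj 1).mul continuous_const)).mul h1).add
          ((continuous_const.sub (hgj 2)).mul h2)).div_const _
    refine ⟨⟨_, hc⟩, fun s x hx => ?_⟩
    change IsHomogeneous x (lineProj (g' s).1 (e s))
    obtain ⟨y, hy⟩ := (g s).2
    have he' := he s y hy
    have h3 := norm_lineProj_sub_lt (v := (g s).1) (v' := (g' s).1) (hgg' s) he'.1
    rw [← hy, lineProj_eq_self he'] at h3
    rw [← hx] at h3 ⊢
    refine isHomogeneous_lineProj fun h4 => ?_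
    rw [h4, zero_sub, norm_neg] at h3
    exact lt_irrefl _ h3

end lifts

/-! ### The Thom class -/

section euler

/-- The affine coordinate of a point of `ℙ¹` other than `∞`. -/
def affinePart (x : OnePoint ℂ) : ℂ := x.elim 0 id

theorem coe_affinePart {x : OnePoint ℂ} (hx : x ≠ OnePoint.infty) :
    (affinePart x : OnePoint ℂ) = x := by
  induction x using OnePoint.rec with
  | infty => exact absurd rfl hx
  | coe z => rfl

theorem continuous_affinePart {Y : Type} [TopologicalSpace Y] {f : Y → OnePoint ℂ}
    (hf : Continuous f) (h : ∀ y, f y ≠ OnePoint.infty) : Continuous fun y => affinePart (f y) := by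
  rw [OnePoint.isOpenEmbedding_coe.isEmbedding.continuous_iff]
  exact hf.congr fun y => (coe_affinePart (h y)).symm

/-- A system of homogeneous coordinates of `x`, with first coordinate `1` if `x ≠ 0`. -/
def dualFrame (x : OnePoint ℂ) : ℂ × ℂ :=
  open scoped Classical in
  if x = ((0 : ℂ) : OnePoint ℂ) then (0, 1) else (1, affinePart (inversion x))

/-- The system of homogeneous coordinates of `x` with second coordinate `1`, for `x ≠ ∞`. -/
def affineFrame (x : OnePoint ℂ) : ℂ × ℂ := (affinePart x, 1)

theorem isHomogeneous_dualFrame (x : OnePoint ℂ) : IsHomogeneous x (dualFrame x) := by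
  unfold dualFrame
  split_ifs with h
  · rw [h, isHomogeneous_coe]
    simp
  · induction x using OnePoint.rec with
    | infty => exact ⟨by simp, rfl⟩
    | coe z =>
      have hz : z ≠ 0 := fun hz => h (by rw [hz])
      rw [inversion_coe hz, isHomogeneous_coe]
      exact ⟨by simp, (mul_inv_cancel₀ hz).symm⟩

theorem continuous_dualFrame {Y : Type} [TopologicalSpace Y] {f : Y → OnePoint ℂ}
    (hf : Continuous f) (h : ∀ y, f y ≠ ((0 : ℂ) : OnePoint ℂ)) :
    Continuous fun y => dualFrame (f y) := by
  have h1 : ∀ y, dualFrame (f y) = (1, affinePart (inversion (f y))) := fun y => if_neg (h y)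
  simp only [h1]
  refine continuous_const.prodMk (continuous_affinePart ?_ fun y hy => h y ?_)
  · exact Pole.infty.coord.continuous.comp hf
  · rw [← inversion_infty]
    exact (inversion_involutive.eq_iff.1 hy)

theorem isHomogeneous_affineFrame {x : OnePoint ℂ} (hx : x ≠ OnePoint.infty) :
    IsHomogeneous x (affineFrame x) := by
  induction x using OnePoint.rec with
  | infty => exact absurd rfl hx
  | coe z => exact isHomogeneous_coe.2 ⟨by simp [affineFrame], by simp [affineFrame, affinePart]⟩

theorem continuous_affineFrame {Y : Type} [TopologicalSpace Y] {f : Y → OnePoint ℂ}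
    (hf : Continuous f) (h : ∀ y, f y ≠ OnePoint.infty) : Continuous fun y => affineFrame (f y) :=
  (continuous_affinePart hf h).prodMk continuous_const

theorem quot_affineFrame_dualFrame {x : OnePoint ℂ} (hx : x ≠ OnePoint.infty)
    (hx0 : x ≠ ((0 : ℂ) : OnePoint ℂ)) : quot (affineFrame x) (dualFrame x) = affinePart x := by
  induction x using OnePoint.rec with
  | infty => exact absurd rfl hx
  | coe z =>
    have hz : z ≠ 0 := fun hz => hx0 (by rw [hz])
    have h1 : affineFrame (z : OnePoint ℂ) = z • dualFrame (z : OnePoint ℂ) := by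
      rw [dualFrame, if_neg hx0, inversion_coe hz]
      refine Prod.ext ?_ ?_
      · change z = z * 1
        rw [mul_one]
      · exact (mul_inv_cancel₀ hz).symm
    rw [h1, quot_smul (isHomogeneous_dualFrame _).1]
    rfl

theorem exists_edgeLift (τ : SingularSimplex (OnePoint ℂ) 1) :
    ∃ e : C(stdSimplex ℝ (Fin 2), ℂ × ℂ), (∀ s, IsHomogeneous (τ s) (e s)) ∧
      (∀ k, e (stdSimplex.vertex k) = dualFrame (τ (stdSimplex.vertex k))) ∧
      ((∀ s, τ s ≠ ((0 : ℂ) : OnePoint ℂ)) → ∀ s, e s = dualFrame (τ s)) := by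
  by_cases h : ∀ s, τ s ≠ ((0 : ℂ) : OnePoint ℂ)
  · exact ⟨⟨fun s => dualFrame (τ s), continuous_dualFrame τ.continuous h⟩,
      fun s => isHomogeneous_dualFrame _, fun _ => rfl, fun _ _ => rfl⟩
  · obtain ⟨e, he⟩ := exists_isHomogeneous τ
    choose r hr0 hr using fun k => (isHomogeneous_dualFrame (τ (stdSimplex.vertex k))).exists_eq_smul
      (he (stdSimplex.vertex k))
    -- The lift is corrected by a function that interpolates between the factors at the end points.
    let L : stdSimplex ℝ (Fin 2) → ℂ := fun s =>
      (s 0 : ℂ) * Complex.log (r 0) + (s 1 : ℂ) * Complex.log (r 1)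
    have hL : Continuous L := by
      have hs : ∀ k : Fin 2, Continuous fun s : stdSimplex ℝ (Fin 2) => ((s k : ℝ) : ℂ) := fun k =>
        Complex.continuous_ofReal.comp ((continuous_apply k).comp continuous_subtype_val)
      exact ((hs 0).mul continuous_const).add ((hs 1).mul continuous_const)
    refine ⟨⟨fun s => Complex.exp (L s) • e s, (Complex.continuous_exp.comp hL).smul e.continuous⟩,
      fun s => (he s).smul (Complex.exp_ne_zero _), fun k => ?_, fun h' => absurd h' h⟩
    rw [hr k]
    change Complex.exp (L (stdSimplex.vertex k)) • e (stdSimplex.vertex k) =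
      r k • e (stdSimplex.vertex k)
    congr 1
    rw [← Complex.exp_log (hr0 k)]
    congr 1
    fin_cases k <;> simp [L]

/-- A lift of a path in `ℙ¹` to homogeneous coordinates with prescribed values at the end points, and
everywhere if the path avoids `0`. -/
def edgeLift (τ : SingularSimplex (OnePoint ℂ) 1) : C(stdSimplex ℝ (Fin 2), ℂ × ℂ) :=
  (exists_edgeLift τ).choose

theorem isHomogeneous_edgeLift (τ : SingularSimplex (OnePoint ℂ) 1) (s : stdSimplex ℝ (Fin 2)) :
    IsHomogeneous (τ s) (edgeLift τ s) := (exists_edgeLift τ).choose_spec.1 s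

theorem edgeLift_vertex (τ : SingularSimplex (OnePoint ℂ) 1) (k : Fin 2) :
    edgeLift τ (stdSimplex.vertex k) = dualFrame (τ (stdSimplex.vertex k)) :=
  (exists_edgeLift τ).choose_spec.2.1 k

theorem edgeLift_eq {τ : SingularSimplex (OnePoint ℂ) 1} (h : ∀ s, τ s ≠ ((0 : ℂ) : OnePoint ℂ))
    (s : stdSimplex ℝ (Fin 2)) : edgeLift τ s = dualFrame (τ s) :=
  (exists_edgeLift τ).choose_spec.2.2 h s

variable {p : ℕ}

/-- The edge of a singular simplex that joins two of its vertices. -/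
def edge {X : Type} [TopologicalSpace X] (σ : SingularSimplex X p) (f : Fin 2 → Fin (p + 1)) :
    SingularSimplex X 1 :=
  σ.comp ⟨stdSimplex.map f, stdSimplex.continuous_map f⟩

theorem edge_face {X : Type} [TopologicalSpace X] (σ : SingularSimplex X (p + 1)) (j : Fin (p + 2))
    (f : Fin 2 → Fin (p + 1)) :
    edge (SingularSimplex.face σ j) f = edge σ (j.succAbove ∘ f) := by
  ext s
  exact congrArg σ (stdSimplex.map_comp_apply _ _ s)

/-- The change of the logarithm of the quotient of a lift of a simplex by the chosen lift of one of
its edges. -/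
def edgeTerm (σ : SingularSimplex (OnePoint ℂ) p) (e : stdSimplex ℝ (Fin (p + 1)) → ℂ × ℂ)
    (f : Fin 2 → Fin (p + 1)) : ℂ :=
  logDiff fun s => quot (e (stdSimplex.map f s)) (edgeLift (edge σ f) s)

variable {σ : SingularSimplex (OnePoint ℂ) p} {e e' : stdSimplex ℝ (Fin (p + 1)) → ℂ × ℂ}

theorem continuous_edge_quot (hec : Continuous e) (f : Fin 2 → Fin (p + 1)) :
    Continuous fun s => quot (e (stdSimplex.map f s)) (edgeLift (edge σ f) s) :=
  continuous_quot (hec.comp (stdSimplex.continuous_map f)) (edgeLift (edge σ f)).continuous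
    fun s => (isHomogeneous_edgeLift (edge σ f) s).1

theorem edge_quot_ne_zero (he : ∀ s, IsHomogeneous (σ s) (e s)) (f : Fin 2 → Fin (p + 1))
    (s : stdSimplex ℝ (Fin 2)) : quot (e (stdSimplex.map f s)) (edgeLift (edge σ f) s) ≠ 0 :=
  (he (stdSimplex.map f s)).quot_ne_zero (isHomogeneous_edgeLift (edge σ f) s)

/-- The chosen lift of the edge is the `dualFrame` at the end points, so these determine the change of
the logarithm up to `2πiℤ`. -/
theorem exists_edgeTerm_eq (hec : Continuous e) (he : ∀ s, IsHomogeneous (σ s) (e s))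
    (f : Fin 2 → Fin (p + 1)) : ∃ m : ℤ, edgeTerm σ e f =
      Complex.log (quot (e (stdSimplex.vertex (f 1))) (dualFrame (σ (stdSimplex.vertex (f 1))))) -
      Complex.log (quot (e (stdSimplex.vertex (f 0))) (dualFrame (σ (stdSimplex.vertex (f 0))))) +
      m * (2 * Real.pi * Complex.I) := by
  rw [← Complex.exp_eq_exp_iff_exists_int, edgeTerm,
    exp_logDiff (continuous_edge_quot hec f) (edge_quot_ne_zero he f), Complex.exp_sub,
    Complex.exp_log, Complex.exp_log]
  · have h : ∀ k, edge σ f (stdSimplex.vertex k) = σ (stdSimplex.vertex (f k)) := fun k =>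
      congrArg σ (stdSimplex.map_vertex f k)
    rw [edgeLift_vertex, edgeLift_vertex, h, h, stdSimplex.map_vertex, stdSimplex.map_vertex]
  · exact (he _).quot_ne_zero (isHomogeneous_dualFrame _)
  · exact (he _).quot_ne_zero (isHomogeneous_dualFrame _)

/-- The obstruction to extending the chosen lifts of the edges of a triangle to the triangle, computed
by means of a lift of the triangle. -/
def obstruction (σ : SingularSimplex (OnePoint ℂ) 2) (e : stdSimplex ℝ (Fin 3) → ℂ × ℂ) : ℂ :=
  ∑ j : Fin 3, ((-1 : ℚ) ^ (j : ℕ)) • edgeTerm σ e j.succAbove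

/-- The obstruction does not depend on the lift of the triangle: the logarithm of the quotient of two
lifts changes along the boundary by zero in total. -/
theorem obstruction_eq {σ : SingularSimplex (OnePoint ℂ) 2}
    {e e' : stdSimplex ℝ (Fin 3) → ℂ × ℂ} (hec : Continuous e) (hec' : Continuous e')
    (he : ∀ s, IsHomogeneous (σ s) (e s)) (he' : ∀ s, IsHomogeneous (σ s) (e' s)) :
    obstruction σ e = obstruction σ e' := by
  obtain ⟨L, hL⟩ := exists_log ⟨_, continuous_quot hec hec' fun s => (he' s).1⟩
    fun s => (he s).quot_ne_zero (he' s)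
  have h1 : ∀ f : Fin 2 → Fin 3, edgeTerm σ e f = (L (stdSimplex.vertex (f 1)) -
      L (stdSimplex.vertex (f 0))) + edgeTerm σ e' f := by
    intro f
    have h2 := logDiff_eq (f := fun s => quot (e (stdSimplex.map f s)) (e' (stdSimplex.map f s)))
      (L := fun s => L (stdSimplex.map f s)) (L.continuous.comp (stdSimplex.continuous_map f))
      fun s => hL (stdSimplex.map f s)
    simp only [stdSimplex.map_vertex] at h2
    rw [← h2, edgeTerm, edgeTerm, ← logDiff_mul
      (f := fun s => quot (e (stdSimplex.map f s)) (e' (stdSimplex.map f s)))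
      (continuous_quot (hec.comp (stdSimplex.continuous_map f))
        (hec'.comp (stdSimplex.continuous_map f)) fun s => (he' _).1)
      (continuous_edge_quot hec' f) (fun s => (he _).quot_ne_zero (he' _)) (edge_quot_ne_zero he' f)]
    congr 1
    funext s
    exact ((he (stdSimplex.map f s)).quot_mul_quot (he' _)
      (isHomogeneous_edgeLift (edge σ f) s)).symm
  simp only [obstruction, h1, smul_add, Finset.sum_add_distrib]
  rw [sum_succAbove_sub_eq_zero fun k => L (stdSimplex.vertex k), zero_add]

/-- The obstruction is integral: modulo `2πiℤ` the edge terms are differences of values at the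
vertices. -/
theorem exists_obstruction_eq (σ : SingularSimplex (OnePoint ℂ) 2) :
    ∃ m : ℤ, ∀ e : stdSimplex ℝ (Fin 3) → ℂ × ℂ, Continuous e →
      (∀ s, IsHomogeneous (σ s) (e s)) →
      obstruction σ e = (m : ℚ) • (2 * Real.pi * Complex.I : ℂ) := by
  obtain ⟨e, he⟩ := exists_isHomogeneous σ
  choose m hm using fun j : Fin 3 => exists_edgeTerm_eq e.continuous he j.succAbove
  refine ⟨∑ j : Fin 3, (-1) ^ (j : ℕ) * m j, fun e' hec' he' => ?_⟩
  rw [obstruction_eq hec' e.continuous he' he]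
  simp only [obstruction, hm, smul_add, Finset.sum_add_distrib]
  rw [sum_succAbove_sub_eq_zero fun k => Complex.log (quot (e (stdSimplex.vertex k))
    (dualFrame (σ (stdSimplex.vertex k)))), zero_add]
  push_cast
  rw [Finset.sum_smul]
  refine Finset.sum_congr rfl fun j _ => ?_
  rw [mul_smul]
  congr 1

/-- The Euler cochain of the tautological line bundle on `ℙ¹`, relative to the section `1` of its dual
over `ℙ¹ - {0}`. -/
def eulerCochain (σ : SingularSimplex (OnePoint ℂ) 2) : ℚ := (exists_obstruction_eq σ).choose

theorem obstruction_eq_eulerCochain {σ : SingularSimplex (OnePoint ℂ) 2}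
    {e : stdSimplex ℝ (Fin 3) → ℂ × ℂ} (hec : Continuous e) (he : ∀ s, IsHomogeneous (σ s) (e s)) :
    obstruction σ e = eulerCochain σ • (2 * Real.pi * Complex.I : ℂ) :=
  (exists_obstruction_eq σ).choose_spec e hec he

theorem smul_two_pi_I_injective {a b : ℚ}
    (h : a • (2 * Real.pi * Complex.I : ℂ) = b • (2 * Real.pi * Complex.I : ℂ)) : a = b := by
  rw [Rat.smul_def, Rat.smul_def] at h
  exact_mod_cast mul_right_cancel₀ Complex.two_pi_I_ne_zero h

/-- Over `ℙ¹ - {0}` the `dualFrame` is a lift of the triangle that extends the chosen lifts of its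
edges. -/
theorem eulerCochain_eq_zero {σ : SingularSimplex (OnePoint ℂ) 2}
    (h : ∀ s, σ s ≠ ((0 : ℂ) : OnePoint ℂ)) : eulerCochain σ = 0 := by
  refine smul_two_pi_I_injective ?_
  rw [← obstruction_eq_eulerCochain (continuous_dualFrame σ.continuous h)
    fun s => isHomogeneous_dualFrame _, zero_smul]
  refine Finset.sum_eq_zero fun j _ => ?_
  have h1 : edgeTerm σ (fun s => dualFrame (σ s)) j.succAbove = 0 := by
    rw [edgeTerm, ← logDiff_one]
    congr 1
    funext s
    rw [edgeLift_eq (fun s => h _)]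
    exact (isHomogeneous_dualFrame _).quot_self
  rw [h1, smul_zero]

/-- A lift of a tetrahedron computes the obstructions of all its faces, and the terms of each edge
cancel. -/
theorem singularCoboundary_eulerCochain (ρ : SingularSimplex (OnePoint ℂ) 3) :
    singularCoboundary eulerCochain ρ = 0 := by
  obtain ⟨e, he⟩ := exists_isHomogeneous ρ
  refine smul_two_pi_I_injective ?_
  rw [zero_smul, singularCoboundary, Finset.sum_smul]
  have h1 : ∀ k : Fin 4, eulerCochain (SingularSimplex.face ρ k) • (2 * Real.pi * Complex.I : ℂ) =
      ∑ j : Fin 3, ((-1 : ℚ) ^ (j : ℕ)) • edgeTerm ρ e (k.succAbove ∘ j.succAbove) := by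
    intro k
    rw [← obstruction_eq_eulerCochain (e := fun s => e (stdSimplex.map k.succAbove s))
      (e.continuous.comp (stdSimplex.continuous_map _)) fun s => he _, obstruction]
    refine Finset.sum_congr rfl fun j _ => ?_
    rw [edgeTerm, edgeTerm, edge_face]
    simp only [stdSimplex.map_comp_apply]
  have h2 := congrArg (Finsupp.linearCombination ℚ (edgeTerm ρ e))
    (tupleBoundary_tupleBoundary 2 (Finsupp.single (id : Fin 4 → Fin 4) 1))
  rw [map_zero, tupleBoundary_single, map_sum, map_sum] at h2
  rw [← h2]
  refine Finset.sum_congr rfl fun k _ => ?_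
  rw [mul_smul, h1, ← mul_one ((-1 : ℚ) ^ (k : ℕ)), ← smul_eq_mul (_ ^ _), ← Finsupp.smul_single,
    map_smul, map_smul, tupleBoundary_single, map_sum, smul_eq_mul, mul_one]
  congr 1
  refine Finset.sum_congr rfl fun j _ => ?_
  rw [Finsupp.linearCombination_single]
  rfl

/-- The winding of a path in `ℙ¹ - {∞}`: the change of the logarithm of the quotient of the lift with
second coordinate `1` by the chosen lift. -/
def winding (τ : SingularSimplex (OnePoint ℂ) 1) : ℂ :=
  logDiff fun s => quot (affineFrame (τ s)) (edgeLift τ s)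

/-- The correction term that makes the winding of paths integral. -/
def logFrame (x : OnePoint ℂ) : ℂ := Complex.log (quot (affineFrame x) (dualFrame x))

theorem exists_winding_eq {τ : SingularSimplex (OnePoint ℂ) 1} (h : ∀ s, τ s ≠ OnePoint.infty) :
    ∃ m : ℤ, winding τ = logFrame (τ.path 1) - logFrame (τ.path 0) +
      (m : ℚ) • (2 * Real.pi * Complex.I : ℂ) := by
  obtain ⟨m, hm⟩ := exists_edgeTerm_eq (σ := τ) (continuous_affineFrame τ.continuous h)
    (fun s => isHomogeneous_affineFrame (h s)) id
  refine ⟨m, ?_⟩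
  have h1 : edge τ id = τ := by
    ext s
    exact congrArg τ (stdSimplex.map_id_apply s)
  rw [edgeTerm, h1] at hm
  simp only [stdSimplex.map_id_apply] at hm
  rw [Rat.smul_def, SingularSimplex.path_one_eq, SingularSimplex.path_zero_eq]
  push_cast
  exact hm

open scoped Classical in
/-- The integral `1`-cochain on `ℙ¹ - {∞}` whose coboundary is the Euler cochain. -/
def windingCochain (τ : SingularSimplex (OnePoint ℂ) 1) : ℚ :=
  if h : ∀ s, τ s ≠ OnePoint.infty then (exists_winding_eq h).choose else 0

theorem winding_eq {τ : SingularSimplex (OnePoint ℂ) 1} (h : ∀ s, τ s ≠ OnePoint.infty) :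
    winding τ = logFrame (τ.path 1) - logFrame (τ.path 0) +
      windingCochain τ • (2 * Real.pi * Complex.I : ℂ) := by
  rw [windingCochain, dif_pos h]
  exact (exists_winding_eq h).choose_spec

theorem eulerCochain_eq_singularCoboundary {σ : SingularSimplex (OnePoint ℂ) 2}
    (h : ∀ s, σ s ≠ OnePoint.infty) : eulerCochain σ = singularCoboundary windingCochain σ := by
  refine smul_two_pi_I_injective ?_
  rw [← obstruction_eq_eulerCochain (continuous_affineFrame σ.continuous h)
    fun s => isHomogeneous_affineFrame (h s)]
  have h1 : ∀ j : Fin 3, edgeTerm σ (fun s => affineFrame (σ s)) j.succAbove =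
      logFrame ((SingularSimplex.face σ j).path 1) - logFrame ((SingularSimplex.face σ j).path 0) +
        windingCochain (SingularSimplex.face σ j) • (2 * Real.pi * Complex.I : ℂ) := fun j =>
    winding_eq (τ := SingularSimplex.face σ j) fun s => h _
  simp only [obstruction, h1, smul_add, Finset.sum_add_distrib]
  rw [sum_face_path_eq_zero logFrame σ, zero_add, singularCoboundary, Finset.sum_smul]
  exact Finset.sum_congr rfl fun j _ => (mul_smul _ _ _).symm

/-- Integration of the logarithmic derivative computes the change of the logarithm. -/
theorem integral_deriv_div {ζ M : ℝ → ℂ} (hζ : ContDiffOn ℝ ∞ ζ (Icc 0 1)) (hM : Continuous M)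
    (h : ∀ t, Complex.exp (M t) = ζ t) :
    ∫ t in (0 : ℝ)..1, deriv ζ t / ζ t = M 1 - M 0 := by
  have hζ0 : ∀ t, ζ t ≠ 0 := fun t => h t ▸ Complex.exp_ne_zero _
  have hd : ∀ t ∈ Ioo (0 : ℝ) 1, HasDerivAt ζ (deriv ζ t) t := fun t ht =>
    ((hζ.contDiffAt (Icc_mem_nhds ht.1 ht.2)).differentiableAt (by simp)).hasDerivAt
  have hMd : ∀ t ∈ Ioo (0 : ℝ) 1, HasDerivAt M (deriv ζ t / ζ t) t := by
    intro t ht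
    have h1 : HasDerivAt (fun s => ζ s / ζ t) (deriv ζ t / ζ t) t := (hd t ht).div_const _
    have h2 : HasDerivAt (fun s => M t + Complex.log (ζ s / ζ t)) (deriv ζ t / ζ t) t := by
      have h3 := h1.clog_real (by rw [div_self (hζ0 t)]; exact Complex.one_mem_slitPlane)
      rw [div_self (hζ0 t), div_one] at h3
      exact h3.const_add _
    refine h2.congr_of_eventuallyEq ?_
    have h4 : Filter.Tendsto (fun s => (M s - M t).im) (𝓝 t) (𝓝 0) := by
      have : Continuous fun s => (M s - M t).im := by fun_prop
      simpa using this.tendsto t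
    filter_upwards [h4.eventually (Ioo_mem_nhds (neg_lt_zero.2 Real.pi_pos) Real.pi_pos)] with s hs
    rw [← h s, ← h t, ← Complex.exp_sub, Complex.log_exp hs.1 hs.2.le]
    ring
  have hc : ContinuousOn (fun t => derivWithin ζ (Icc 0 1) t / ζ t) (Icc 0 1) :=
    (hζ.continuousOn_derivWithin (uniqueDiffOn_Icc zero_lt_one) (by simp)).div hζ.continuousOn
      fun t _ => hζ0 t
  have hint : IntervalIntegrable (fun t => deriv ζ t / ζ t) MeasureTheory.volume 0 1 := by
    rw [← uIcc_of_le (zero_le_one (α := ℝ))] at hc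
    refine hc.intervalIntegrable.congr_uIoo fun t ht => ?_
    rw [uIoo_of_le zero_le_one] at ht
    simp only
    rw [uIcc_of_le zero_le_one, derivWithin_of_mem_nhds (Icc_mem_nhds ht.1 ht.2)]
  exact intervalIntegral.integral_eq_sub_of_hasDerivAt_of_le zero_le_one hM.continuousOn hMd hint

variable {n : ℕ} (i : Fin n) (α : Pole)

/-- The `i`-th coordinate of `P^n`, normalized so as to vanish on `H_{i,α}`. -/
def coordMap : C(PP n, OnePoint ℂ) :=
  ⟨fun p => α.coord (p i), α.coord.continuous.comp (continuous_apply i)⟩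

theorem contDiffOn_localCoord {σ : SingularSimplex (PP n) 1} (hσ : IsSmooth σ)
    (h : ∀ t, α.coord (σ.path t i) ≠ OnePoint.infty) :
    ContDiffOn ℝ ∞ (fun t => localCoord α (σ.path t i)) (Icc 0 1) := by
  have h0 : ∀ j, ContDiffOn ℝ ∞ (fun t => sphere (σ.path t i) j) (Icc 0 1) := fun j =>
    contDiffOn_pi.1 hσ (i, j)
  have h1 : ∀ j, ContDiffOn ℝ ∞ (fun t => sphere (α.coord (σ.path t i)) j) (Icc 0 1) := by
    intro j
    cases α with
    | zero => exact h0 j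
    | infty =>
      change ContDiffOn ℝ ∞ (fun t => sphere (inversion (σ.path t i)) j) (Icc 0 1)
      simp only [sphere_inversion]
      fin_cases j
      · exact h0 0
      · exact (h0 1).neg
      · exact (h0 2).neg
  have hne : ∀ t, 1 - sphere (α.coord (σ.path t i)) 2 ≠ 0 := by
    intro t
    rw [← coe_affinePart (h t)]
    exact sub_ne_zero.2 (sphere_coe_two_ne_one _).symm
  have h2 : ∀ t, localCoord α (σ.path t i) =
      ((sphere (α.coord (σ.path t i)) 0 / (1 - sphere (α.coord (σ.path t i)) 2) : ℝ) : ℂ) +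
      ((sphere (α.coord (σ.path t i)) 1 / (1 - sphere (α.coord (σ.path t i)) 2) : ℝ) : ℂ) *
        Complex.I := by
    intro t
    rw [localCoord_eq (coe_affinePart (h t)).symm]
    rw [← coe_affinePart (h t)]
    generalize affinePart (α.coord (σ.path t i)) = z
    have hz : (0 : ℝ) < ‖z‖ ^ 2 + 1 := by positivity
    have h3 : 1 - (‖z‖ ^ 2 - 1) / (‖z‖ ^ 2 + 1) = 2 / (‖z‖ ^ 2 + 1) := by
      field_simp
      ring
    have h4 : 2 * z.re / (‖z‖ ^ 2 + 1) / (1 - (‖z‖ ^ 2 - 1) / (‖z‖ ^ 2 + 1)) = z.re := by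
      rw [h3]
      field_simp
    have h5 : 2 * z.im / (‖z‖ ^ 2 + 1) / (1 - (‖z‖ ^ 2 - 1) / (‖z‖ ^ 2 + 1)) = z.im := by
      rw [h3]
      field_simp
    change z = ((2 * z.re / (‖z‖ ^ 2 + 1) / (1 - (‖z‖ ^ 2 - 1) / (‖z‖ ^ 2 + 1)) : ℝ) : ℂ) +
      ((2 * z.im / (‖z‖ ^ 2 + 1) / (1 - (‖z‖ ^ 2 - 1) / (‖z‖ ^ 2 + 1)) : ℝ) : ℂ) * Complex.I
    rw [h4, h5, Complex.re_add_im]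
  simp only [h2]
  have h6 : ∀ j, ContDiffOn ℝ ∞ (fun t => ((sphere (α.coord (σ.path t i)) j /
      (1 - sphere (α.coord (σ.path t i)) 2) : ℝ) : ℂ)) (Icc 0 1) := fun j =>
    Complex.ofRealCLM.contDiff.comp_contDiffOn
      ((h1 j).div (contDiffOn_const.sub (h1 2)) fun t _ => hne t)
  exact (h6 0).add ((h6 1).mul contDiffOn_const)

/-- The Thom class has a representative: the pull-back of the Euler cochain. -/
theorem representsThomClass_eulerCochain :
    RepresentsThomClass i α fun σ => eulerCochain ((coordMap i α).comp σ) where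
  relative σ hσ := eulerCochain_eq_zero fun s hs => hσ ⟨s, rfl⟩ (mem_divH_iff.2 hs)
  cocycle σ := singularCoboundary_eulerCochain ((coordMap i α).comp σ)
  restriction := by
    have htube : ∀ {p : PP n}, p ∈ tube i α → α.coord (p i) ≠ OnePoint.infty := by
      intro p hp hinf
      obtain ⟨z, hz, -⟩ := mem_tube_iff.1 hp
      exact OnePoint.coe_ne_infty z (hz.symm.trans hinf)
    refine ⟨fun σ => windingCochain ((coordMap i α).comp σ),
      ⟨fun p => -(2 * Real.pi * Complex.I)⁻¹ * logFrame (α.coord (p i)), fun σ hσ hs => ?_⟩,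
      fun σ hσ => eulerCochain_eq_singularCoboundary fun s => htube (hσ ⟨s, rfl⟩)⟩
    have h1 : ∀ s, (coordMap i α).comp σ s ≠ OnePoint.infty := fun s => htube (hσ ⟨s, rfl⟩).1
    have h2 : ∀ s, (coordMap i α).comp σ s ≠ ((0 : ℂ) : OnePoint ℂ) := fun s hs =>
      (hσ ⟨s, rfl⟩).2 (mem_divH_iff.2 hs)
    have h3 : winding ((coordMap i α).comp σ) =
        logDiff fun s => affinePart ((coordMap i α).comp σ s) := by
      rw [winding]
      congr 1
      funext s
      rw [edgeLift_eq h2, quot_affineFrame_dualFrame (h1 s) (h2 s)]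
    have h4 : affinePart ∘ (coordMap i α).comp σ = fun s => localCoord α (σ s i) :=
      funext fun s => (localCoord_eq (coe_affinePart (h1 s)).symm).symm
    obtain ⟨L, hL⟩ := exists_log
      ⟨_, continuous_affinePart ((coordMap i α).comp σ).continuous h1⟩ (by
        intro s hs
        refine h2 s ?_
        rw [← coe_affinePart (h1 s)]
        exact congrArg _ hs)
    have h5 : ∀ s, Complex.exp (L s) = localCoord α (σ s i) := fun s =>
      (hL s).trans (congrFun h4 s)
    have h6 := integral_deriv_div (contDiffOn_localCoord i α hs fun t => htube
        (hσ (σ.path_mem_range t)).1)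
      (M := SingularSimplex.path L) (SingularSimplex.continuous_path L) fun t => h5 _
    have h7 : winding ((coordMap i α).comp σ) = SingularSimplex.path L 1 - SingularSimplex.path L 0 := by
      rw [h3, logDiff_eq (f := fun s => affinePart ((coordMap i α).comp σ s)) L.continuous hL,
        SingularSimplex.path_one_eq, SingularSimplex.path_zero_eq]
    have h8 := winding_eq h1
    rw [Rat.smul_def] at h8
    have h9 : ∀ t, SingularSimplex.path ((coordMap i α).comp σ) t = α.coord (σ.path t i) :=
      fun _ => rfl
    rw [h7, h9, h9] at h8
    rw [dlogIntegral, h6, h8]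
    have hpi := Complex.two_pi_I_ne_zero
    field_simp
    ring

end euler

/-! ### Existence of Thom cocycles and good orderings -/

section existence

variable {n : ℕ} (K : Triangulation n)

/-- The ordering of `K` in which the vertices in `H_{i,α}` come last. -/
def separatingGoodOrder (i : Fin n) (α : Pole) : K.GoodOrder i α where
  toVertexOrder := separatingOrder K.complex fun v => K.simplexImg {v} ⊆ divH i α
  good v _ w _ hv h := by
    rcases h with h | h
    · exact h.2
    · exact h.1.1 hv

/-- The alternating simplicial cochain whose values on the increasing simplices are those of the
singular cochain `u`. -/
def simplicialCochain (O : VertexOrder K.complex) (p : ℕ) (u : SingularSimplex (PP n) p → ℚ) :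
    TupleChain K.E (p + 1) →ₗ[ℚ] ℚ :=
  Finsupp.linearCombination ℚ u ∘ₗ K.singularization p ∘ₗ O.incPart p ∘ₗ tupleAlt K.E (p + 1)

variable {K}

theorem simplicialCochain_single (O : VertexOrder K.complex) {p : ℕ}
    (u : SingularSimplex (PP n) p → ℚ) {v : Fin (p + 1) → K.E} (hv : IsSimplex K.complex v)
    (hO : O.Increasing v) :
    simplicialCochain K O p u (Finsupp.single v 1) = u (K.singular v hv) := by
  simp only [simplicialCochain, LinearMap.comp_apply]
  rw [O.incPart_tupleAlt (Finsupp.single_mem_supported ℚ _ ⟨hv, hO⟩), K.singularization_single hv,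
    Finsupp.linearCombination_single, one_smul]

theorem simplicialCochain_tupleBoundary (O : VertexOrder K.complex) {p : ℕ}
    {u : SingularSimplex (PP n) (p + 1) → ℚ} (hu : ∀ σ, singularCoboundary u σ = 0)
    {v : Fin (p + 3) → K.E} (hv : IsSimplex K.complex v) :
    simplicialCochain K O (p + 1) u (tupleBoundary K.E (p + 2) (Finsupp.single v 1)) = 0 := by
  have hc : tupleAlt K.E (p + 3) (Finsupp.single v 1) ∈ chains K.complex (p + 2) := by
    rw [tupleAlt_single_eq_oriented]
    exact oriented_mem hv
  simp only [simplicialCochain, LinearMap.comp_apply]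
  rw [← tailBoundary_tupleAlt, ← O.tupleBoundary_incPart hc,
    ← K.singularBoundary_singularization fun w hw => (O.incPart_mem hc hw).1,
    linearCombination_singularBoundary, funext hu]
  simp [Finsupp.linearCombination_apply]

theorem simplicialCochain_mem_relCochains (O : VertexOrder K.complex) {p : ℕ} {i : Fin n} {α : Pole}
    {u : SingularSimplex (PP n) p → ℚ}
    (hu : ∀ σ : SingularSimplex (PP n) p, range σ ⊆ (divH i α)ᶜ → u σ = 0) :
    (fun v => simplicialCochain K O p u (Finsupp.single v 1)) ∈ K.relCochains i α p := by
  refine ⟨fun v π => ?_, fun v hv => ?_⟩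
  · simp only [simplicialCochain, LinearMap.comp_apply]
    rw [tupleAlt_comp_perm, map_smul, map_smul, map_smul, smul_eq_mul]
  · by_contra hne
    refine hv ?_
    have h : (Finsupp.linearCombination ℚ u ∘ₗ K.singularization p ∘ₗ O.incPart p)
        (tupleAlt K.E (p + 1) (Finsupp.single v 1)) ∈ (⊥ : Submodule ℚ ℚ) := by
      refine map_mem_of_mem_supported (S := {w | ∃ π : Equiv.Perm (Fin (p + 1)), v ∘ π = w})
        ?_ fun w hw => ?_
      · rintro _ ⟨π, rfl⟩
        simp only [Submodule.mem_bot, LinearMap.comp_apply]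
        rw [VertexOrder.incPart, Finsupp.linearCombination_single, one_smul]
        split_ifs
        · by_cases hπ : IsSimplex K.complex (v ∘ π)
          · rw [K.singularization_single hπ, Finsupp.linearCombination_single, one_smul]
            refine hu _ fun q hq hqH => hne ⟨?_, q, ?_, hqH⟩
            · simpa [Function.comp_assoc] using hπ.comp π.symm.injective
            · rw [← verts_comp_perm v π]
              exact K.range_singular_subset hπ hq
          · rw [Triangulation.singularization, Finsupp.linearCombination_single, one_smul,
              dif_neg hπ, map_zero]
        · rw [map_zero, map_zero]
      · rw [tupleAlt_single_eq_oriented] at hw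
        obtain ⟨π, h⟩ := oriented_apply_ne_zero (Finsupp.mem_support_iff.1 hw)
        exact ⟨π, h.symm⟩
    exact h

/-- The Euler cochain defines a Thom cocycle on every triangulation. -/
theorem nonempty_thomCocycle (K : Triangulation n) (i : Fin n) (α : Pole) :
    Nonempty (K.ThomCocycle i α) := by
  have hu := representsThomClass_eulerCochain i α
  let O : VertexOrder K.complex := (separatingGoodOrder K i α).toVertexOrder
  refine ⟨⟨_, simplicialCochain_mem_relCochains O hu.relative, fun v hv => ?_, _, hu, O, 0,
    zero_mem _, fun v hv hO => ?_⟩⟩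
  · have h := simplicialCochain_tupleBoundary O hu.cocycle hv
    rw [tupleBoundary_single, map_sum] at h
    rw [coboundary, ← h]
    refine Finset.sum_congr rfl fun j _ => ?_
    rw [← smul_eq_mul, ← map_smul, Finsupp.smul_single, smul_eq_mul, mul_one]
  · rw [simplicialCochain_single O _ hv hO]
    simp [coboundary]

end existence

/-! ### The face maps of the complex of admissible chains -/

section faceMaps

theorem isSubdivisionOperator_subdivision {n : ℕ} {K K' : GoodTriangulation n} (h : K ≤ K') :
    IsSubdivisionOperator K.toTriangulation K'.toTriangulation
      (subdivision K.toTriangulation K'.toTriangulation) := by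
  have h1 := Triangulation.IsSubdivision.exists_isSubdivisionOperator h
  unfold subdivision
  rw [dif_pos h1]
  exact h1.choose_spec

theorem isSubdivisionOperator_id {n : ℕ} (K : Triangulation n) :
    IsSubdivisionOperator K K fun _ => LinearMap.id where
  carried _ _ v h := ⟨v, h, subset_rfl⟩
  comm _ _ := rfl
  augmentation _ := rfl

variable {n : ℕ} {i : Fin (n + 1)} {α : Pole}

/-- The cap product with a Thom cocycle on admissible chains is compatible with subdivision operators,
for any choices of Thom cocycles and good orderings. -/
theorem mk_subdivision_cap_eq {K K' : GoodTriangulation (n + 1)} (hKK' : K ≤ K')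
    {Λ : ∀ p, chains K.complex p →ₗ[ℚ] chains K'.complex p}
    (hΛ : IsSubdivisionOperator K.toTriangulation K'.toTriangulation Λ)
    {Λ' : ∀ p, chains (K.face i α).complex p →ₗ[ℚ] chains (K'.face i α).complex p}
    (hΛ' : IsSubdivisionOperator (K.face i α).toTriangulation (K'.face i α).toTriangulation Λ')
    (T : K.ThomCocycle i α) (O : K.GoodOrder i α) (T' : K'.ThomCocycle i α)
    (O' : K'.GoodOrder i α) {k : ℕ} {c : chains K.complex (k + 2)}
    (hc : K.relClass (k + 2) c ∈ K.AC (k + 2)) :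
    (K'.face i α).relClass k (Λ' k ⟨capAux K T O k c.1, capAux_mem T O k c.1 c.2⟩) =
      cap T' O' k (K'.relClass (k + 2) (Λ (k + 2) c)) := by
  obtain ⟨P, η, hη, hTη⟩ := exists_coboundary_eq_thomCocycle hΛ T T' O'
  refine (Submodule.Quotient.eq _).2 ?_
  exact subdivision_cap_sub_cap_subdivision_mem hKK' hΛ hΛ' T O T' O' P η hη hTη c
    ((GoodTriangulation.isAdmissibleChain_mk c).1 hc.1)
    ((GoodTriangulation.isAdmissibleChain_mk (boundary K.complex (k + 1) c)).1 hc.2)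

theorem cap_eq_cap {K : GoodTriangulation (n + 1)} (T T' : K.ThomCocycle i α)
    (O O' : K.GoodOrder i α) (k : ℕ) (γ : K.RelChain (k + 2)) (hγ : γ ∈ K.AC (k + 2)) :
    cap T O k γ = cap T' O' k γ := by
  obtain ⟨c, rfl⟩ := Submodule.mkQ_surjective _ γ
  exact mk_subdivision_cap_eq le_rfl (isSubdivisionOperator_id _) (isSubdivisionOperator_id _)
    T O T' O' hγ

theorem relSubdivision_cap {K K' : GoodTriangulation (n + 1)} (h : K ≤ K')
    (T : K.ThomCocycle i α) (O : K.GoodOrder i α) (T' : K'.ThomCocycle i α)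
    (O' : K'.GoodOrder i α) (k : ℕ) (γ : K.RelChain (k + 2)) (hγ : γ ∈ K.AC (k + 2)) :
    relSubdivision (K.face i α).toTriangulation (K'.face i α).toTriangulation k (cap T O k γ) =
      cap T' O' k (relSubdivision K.toTriangulation K'.toTriangulation (k + 2) γ) := by
  obtain ⟨c, rfl⟩ := Submodule.mkQ_surjective _ γ
  exact mk_subdivision_cap_eq h (isSubdivisionOperator_subdivision h)
    (isSubdivisionOperator_subdivision (GoodTriangulation.face_le i α h)) T O T' O' hγ

/-- The cap product on admissible chains. -/
def capAC {K : GoodTriangulation (n + 1)} (T : K.ThomCocycle i α) (O : K.GoodOrder i α) (k : ℕ) :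
    K.AC (k + 2) →ₗ[ℚ] (K.face i α).AC k :=
  (cap T O k).restrict fun _ hγ => cap_mem_AC T O k hγ

open scoped Classical in
theorem ACLim.of_subdivisionAC {n p : ℕ} {K K' : GoodTriangulation n} (h : K ≤ K') (γ : K.AC p) :
    ACLim.of K' p (subdivisionAC p K K' h γ) = ACLim.of K p γ :=
  Module.DirectLimit.of_f

open scoped Classical in
theorem ACLim.boundary_of {n p : ℕ} (K : GoodTriangulation n) (γ : K.AC (p + 1)) :
    ACLim.boundary n p (ACLim.of K (p + 1) γ) = ACLim.of K p (K.boundaryAC p γ) :=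
  Module.DirectLimit.map_apply_of ..

open scoped Classical in
theorem ACLim.hom_ext {n p : ℕ} {M : Type} [AddCommMonoid M] [Module ℚ M]
    {f g : ACLim n p →ₗ[ℚ] M} (h : ∀ K γ, f (ACLim.of K p γ) = g (ACLim.of K p γ)) : f = g :=
  Module.DirectLimit.hom_ext fun K => LinearMap.ext fun γ => h K γ

open scoped Classical in
/-- The maps `γ ↦ T ∩ γ` pass to the direct limit. -/
theorem exists_faceMap (i : Fin (n + 1)) (α : Pole) (k : ℕ) :
    ∃ φ : ACLim (n + 1) (k + 2) →ₗ[ℚ] ACLim n k, ∀ (K : GoodTriangulation (n + 1))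
      (T : K.ThomCocycle i α) (O : K.GoodOrder i α) (γ : K.AC (k + 2)),
      φ (ACLim.of K (k + 2) γ) = ACLim.of (K.face i α) k (capAC T O k γ) := by
  let T : ∀ K : GoodTriangulation (n + 1), K.ThomCocycle i α := fun K =>
    (nonempty_thomCocycle K.toTriangulation i α).some
  let O : ∀ K : GoodTriangulation (n + 1), K.GoodOrder i α := fun K =>
    separatingGoodOrder K.toTriangulation i α
  refine ⟨Module.DirectLimit.lift ℚ _ _ _
    (fun K => ACLim.of (K.face i α) k ∘ₗ capAC (T K) (O K) k) fun K K' h γ => ?_,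
    fun K T' O' γ => ?_⟩
  · rw [LinearMap.comp_apply, LinearMap.comp_apply,
      ← ACLim.of_subdivisionAC (GoodTriangulation.face_le i α h) (capAC (T K) (O K) k γ)]
    congr 1
    exact Subtype.ext (relSubdivision_cap h (T K) (O K) (T K') (O K') k γ.1 γ.2).symm
  · refine (Module.DirectLimit.lift_of ..).trans ?_
    exact congrArg (ACLim.of (K.face i α) k)
      (Subtype.ext (cap_eq_cap (T K) T' (O K) O' k γ.1 γ.2))

end faceMaps

end CubicalChain

end

theorem mainTheorem3 (n : ℕ) (i : Fin (n + 1)) (α : Pole) :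
    (∀ (K : GoodTriangulation (n + 1)) (T : K.ThomCocycle i α) (O : K.GoodOrder i α) (k : ℕ),
      ∀ γ ∈ K.AC (k + 2), cap T O k γ ∈ (K.face i α).AC k) ∧
    (∀ (K : GoodTriangulation (n + 1)) (T T' : K.ThomCocycle i α) (O O' : K.GoodOrder i α) (k : ℕ),
      ∀ γ ∈ K.AC (k + 2), cap T O k γ = cap T' O' k γ) ∧
    (∀ K K' : GoodTriangulation (n + 1), K ≤ K' →
      IsSubdivisionOperator K.toTriangulation K'.toTriangulation
        (subdivision K.toTriangulation K'.toTriangulation) ∧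
      ∀ (T : K.ThomCocycle i α) (O : K.GoodOrder i α) (T' : K'.ThomCocycle i α)
        (O' : K'.GoodOrder i α) (k : ℕ), ∀ γ ∈ K.AC (k + 2),
        relSubdivision (K.face i α).toTriangulation (K'.face i α).toTriangulation k (cap T O k γ) =
          cap T' O' k (relSubdivision K.toTriangulation K'.toTriangulation (k + 2) γ)) ∧
    ∃! face : ∀ k : ℕ, ACLim (n + 1) (k + 2) →ₗ[ℚ] ACLim n k,
      (∀ (K : GoodTriangulation (n + 1)) (T : K.ThomCocycle i α) (O : K.GoodOrder i α) (k : ℕ)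
        (γ : K.AC (k + 2)), ∃ h : cap T O k γ.1 ∈ (K.face i α).AC k,
          face k (ACLim.of K (k + 2) γ) = ACLim.of (K.face i α) k ⟨cap T O k γ.1, h⟩) ∧
      ∀ (k : ℕ) (x : ACLim (n + 1) (k + 3)),
        face k (ACLim.boundary (n + 1) (k + 2) x) = ACLim.boundary n k (face (k + 1) x) := by
  have hTO : ∀ K : GoodTriangulation (n + 1), Nonempty (K.ThomCocycle i α × K.GoodOrder i α) :=
    fun K => (nonempty_thomCocycle K.toTriangulation i α).map fun T =>
      (T, separatingGoodOrder K.toTriangulation i α)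
  refine ⟨fun K T O k γ hγ => cap_mem_AC T O k hγ,
    fun K T T' O O' k γ hγ => cap_eq_cap T T' O O' k γ hγ,
    fun K K' h => ⟨isSubdivisionOperator_subdivision h,
      fun T O T' O' k γ hγ => relSubdivision_cap h T O T' O' k γ hγ⟩, ?_⟩
  choose φ hφ using exists_faceMap i α
  refine ⟨φ, ⟨fun K T O k γ => ⟨cap_mem_AC T O k γ.2, hφ k K T O γ⟩, fun k x => ?_⟩,
    fun ψ hψ => funext fun k => ACLim.hom_ext (f := ψ k) (g := φ k) fun K γ => ?_⟩
  · suffices h : φ k ∘ₗ ACLim.boundary (n + 1) (k + 2) = ACLim.boundary n k ∘ₗ φ (k + 1) from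
      LinearMap.congr_fun h x
    refine ACLim.hom_ext fun K γ => ?_
    obtain ⟨T, O⟩ := (hTO K).some
    rw [LinearMap.comp_apply, LinearMap.comp_apply, ACLim.boundary_of, hφ k K T O,
      hφ (k + 1) K T O, ACLim.boundary_of]
    congr 1
    exact Subtype.ext (relBoundary_cap T O k γ.1).symm
  · obtain ⟨T, O⟩ := (hTO K).some
    obtain ⟨h, hψK⟩ := hψ.1 K T O k γ
    rw [hψK, hφ k K T O]
    rfl
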